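/- **Theorem (mirror descent using quantum subgradient estimation).** There are absolute constants $c,C>0$ and $k\in\mathbb N$ such that the following holds. Let $d\ge 1$, let $\|\cdot\|$ be an $\ell_p$ norm on $\mathbb R^d$ with $p\in[1,\infty]$ and let $\|\cdot\|_*$ be its dual norm. Let $1\le\vartheta,\vartheta_*\le d$ with $\vartheta\vartheta_*\le d$ satisfy $\|x\|\le\vartheta\|x\|_\infty$ and $\|x\|_*\le\vartheta_*\|x\|_\infty$ for all $x\in\mathbb R^d$. Let $\mathcal X\subseteq\mathbb R^d$ be closed, bounded and convex, with $\|\cdot\|$-diameter $K$. Let $\mathcal P\subseteq\mathbb R^d$ be open and convex with $\mathcal X\subseteq\overline{\mathcal P}$ and $\mathcal X\cap\mathcal P\ne\emptyset$, and let $\Phi$ be a mirror map on $\mathcal P$, that is, a strictly convex differentiable function on $\mathcal P$ with $\nabla\Phi(\mathcal P)=\mathbb R^d$ and $\|\nabla\Phi(x)\|\to\infty$ as $x\to\partial\mathcal P$. Write $D_\Phi(x,y)=\Phi(x)-\Phi(y)-\langle\nabla\Phi(y),x-y\rangle$. Let $\mu,G,\varepsilon,\theta>0$ and $R\ge0$,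 let $\Phi$ be $\mu$-strongly convex on $\mathcal X\cap\mathcal P$ with respect to $\|\cdot\|$, let $x_1\in\mathcal X\cap\mathcal P$, and assume $$\theta\cdot G^4R^2K^2\vartheta_*^2\,\vartheta\, d^3\;\le\; c\,\mu\,\varepsilon^5 .$$ Fix a fixed-point number format for the oracle's output: $w$-bit two's complement with a given number of fractional bits. Put $\kappa=GR/(\sqrt\mu\,\varepsilon)$. Then there are $T\ge1$ and a quantum program $\mathcal E$, depending only on the above data, with the following property. Let $f:\mathbb R^d\to\mathbb R$ be any convex function that is $G$-Lipschitz with respect to $\|\cdot\|$ and attains its minimum over $\mathcal X$ at a point $x^\star\in\mathcal X\cap\mathcal P$ with $D_\Phi(x^\star,x_1)=R^2$. Let $U:|x\rangle|y\rangle\mapsto|x\rangle|y\oplus\tilde f(x)\rangle$ be any $\theta$-approximate binary oracle for $f$, meaning that $\tilde f$ takes values in the given format and $|\tilde f(x)-f(x)|<\theta$ for all $x$ at $\ell_\infty$-distance at most $\varepsilon/(G\vartheta)$ from $\mathcal X$. Run mirror descent $$x_{t+1}=\Pi^\Phi_{\mathcal X}\big((\nabla\Phi)^{-1}(\nabla\Phi(x_t)-\eta\,\tilde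 g_t)\big),\qquad \eta=\frac RG\sqrt{\frac\mu T},\qquad \Pi^\Phi_{\mathcal X}(y)=\operatorname*{arg\,min}_{x\in\mathcal X\cap\mathcal P}D_\Phi(x,y),$$ for $T$ iterations, where $\tilde g_t$ is the output of a fresh run of $\mathcal E$ on input $x_t$. Then: 1. With probability at least $2/3$ the average $\bar x=\frac1T\sum_{t=1}^Tx_t$ satisfies $\bar x\in\mathcal X$ and $f(\bar x)-f(x^\star)\le\varepsilon$. 2. If $T>1$, then for every $x\in\mathcal X$, with probability at least $1-\frac1{3T}$, the output $\tilde g$ of $\mathcal E$ on input $x$ is an approximate subgradient: $f(q)\ge f(x)+\langle\tilde g,q-x\rangle-\varepsilon$ for all $q\in\mathcal X$. (If $T=1$, the output is $x_1$ and no subgradient influences it.) 3. The total number of oracle queries is at most $C(1+\kappa^2)\,\big(1+\log(d(1+\kappa))\big)^k=\widetilde{\mathcal O}\big((GR/(\sqrt\mu\,\varepsilon))^2\big)$. 4. If $\mathcal T_{\rm next}$ denotes the cost of computing $x_{t+1}$ from $x_t$ and $\tilde g_t$, the total number of gates is at most $C\,(d+\mathcal T_{\rm next})(1+\kappa^2)\,\big(1+\log(d(1+\kappa)(1+GK/\varepsilon))\big)^k=\widetilde{\mathcal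 O}\big((d+\mathcal T_{\rm next})(GR/(\sqrt\mu\,\varepsilon))^2\big)$. Here a quantum program is a straight-line sequence of instructions on real-valued classical registers and qubits initialized to $|0\rangle$: real arithmetic (constants, $+$, $-$, $\times$, comparison), Hadamard, phase and controlled-phase gates with angle read from a classical register, measurement (with reset) of a qubit, and an oracle query on a hypergrid whose origin and spacing are read from classical registers and whose index is held in the input qubits. Each instruction counts as one gate. -/

import Mathlib

open scoped NNReal ENNReal Topology

noncomputable section

/-! ### Convex geometry in `ℓ_p` norms -/

/-- The space `ℝ^d`. The Euclidean structure is only used for the standard pairing `⟨g, x⟩` and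
for gradients; distances are measured in `lpNorm`. -/
abbrev Pt (d : ℕ) : Type := EuclideanSpace ℝ (Fin d)

/-- The `ℓ_p` norm of a vector of `ℝ^d`, `1 ≤ p ≤ ∞`. -/
def lpNorm {d : ℕ} (p : ℝ≥0∞) (x : Pt d) : ℝ :=
  ‖(WithLp.toLp p x.ofLp : PiLp p fun _ : Fin d => ℝ)‖

/-- The norm dual to `lpNorm p`. -/
def dualLpNorm {d : ℕ} (p : ℝ≥0∞) (g : Pt d) : ℝ :=
  sSup {r | ∃ x : Pt d, lpNorm p x ≤ 1 ∧ r = inner ℝ g x}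

/-- The diameter of a set in the `ℓ_p` norm. -/
def lpDiam {d : ℕ} (p : ℝ≥0∞) (X : Set (Pt d)) : ℝ :=
  sSup {r | ∃ x ∈ X, ∃ y ∈ X, r = lpNorm p (x - y)}

/-- `f` is `G`-Lipschitz on `ℝ^d` with respect to the `ℓ_p` norm. -/
def IsLpLipschitz {d : ℕ} (p : ℝ≥0∞) (G : ℝ) (f : Pt d → ℝ) : Prop :=
  ∀ x y, |f x - f y| ≤ G * lpNorm p (x - y)

/-- The Bregman divergence `D_Φ(x, y)`. -/
def bregman {d : ℕ} (Φ : Pt d → ℝ) (x y : Pt d) : ℝ :=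
  Φ x - Φ y - inner ℝ (gradient Φ y) (x - y)

/-- `Φ` is a mirror map for the feasible set `X` on the convex open set `P`. -/
structure IsMirrorMap {d : ℕ} (X P : Set (Pt d)) (Φ : Pt d → ℝ) : Prop where
  isOpen : IsOpen P
  convex : Convex ℝ P
  subset_closure : X ⊆ closure P
  inter_nonempty : (X ∩ P).Nonempty
  strictConvexOn : StrictConvexOn ℝ P Φ
  differentiableAt : ∀ x ∈ P, DifferentiableAt ℝ Φ x
  gradient_surjOn : ∀ v : Pt d, ∃ x ∈ P, gradient Φ x = v
  gradient_diverges : ∀ z ∈ frontier P,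
    Filter.Tendsto (fun x => ‖gradient Φ x‖) (𝓝[P] z) Filter.atTop

/-- `Φ` is `μ`-strongly convex on `S` with respect to the `ℓ_p` norm. -/
def IsLpStronglyConvexOn {d : ℕ} (p : ℝ≥0∞) (μ : ℝ) (S : Set (Pt d)) (Φ : Pt d → ℝ) : Prop :=
  ∀ x ∈ S, ∀ y ∈ S,
    Φ x + inner ℝ (gradient Φ x) (y - x) + μ / 2 * lpNorm p (y - x) ^ 2 ≤ Φ y

/-- The Bregman projection of `y` onto `X`: the minimizer of `D_Φ(·, y)` over `X ∩ P`. -/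
def bregmanProj {d : ℕ} (X P : Set (Pt d)) (Φ : Pt d → ℝ) (y : Pt d) : Pt d :=
  Classical.epsilon fun x => x ∈ X ∩ P ∧ ∀ x' ∈ X ∩ P, bregman Φ x y ≤ bregman Φ x' y

/-- One mirror descent update `Π_X^Φ ((∇Φ)⁻¹ (∇Φ(x) - η g))`. -/
def mirrorStep {d : ℕ} (X P : Set (Pt d)) (Φ : Pt d → ℝ) (η : ℝ) (x g : Pt d) : Pt d :=
  bregmanProj X P Φ (Function.invFunOn (gradient Φ) P (gradient Φ x - η • g))

/-- `g` is an `ε`-subgradient of `f` at `x`, relative to `X`. -/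
def IsApproxSubgradient {d : ℕ} (X : Set (Pt d)) (f : Pt d → ℝ) (ε : ℝ) (x g : Pt d) : Prop :=
  ∀ q ∈ X, f x + inner ℝ g (q - x) - ε ≤ f q

/-! ### Quantum programs with a binary evaluation oracle

A program runs on a machine with real-valued classical registers, indexed by `ℕ`, and qubits. The
qubits form an input register, with `b` qubits for each of the `d` coordinates, and an output
register of `w` qubits. -/

/-- The qubits: input register, then output register. -/
abbrev Qubit (d b w : ℕ) : Type := (Fin d × Fin b) ⊕ Fin w

/-- A computational basis state. -/
abbrev Basis (d b w : ℕ) : Type := Qubit d b w → Bool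

/-- A (not necessarily normalized) pure state, given by its amplitudes. -/
abbrev QState (d b w : ℕ) : Type := Basis d b w → ℂ

/-- Squared norm of a state. -/
def QState.normSq {d b w : ℕ} (ψ : QState d b w) : ℝ≥0 := ∑ a, ‖ψ a‖₊ ^ 2

/-- The instructions. `r`, `s`, `t` are addresses of classical registers. -/
inductive Instr (d b w : ℕ) : Type
  /-- `reg r := c` -/
  | const (r : ℕ) (c : ℝ)
  /-- `reg r := reg s + reg t` -/
  | add (r s t : ℕ)
  /-- `reg r := reg s - reg t` -/
  | sub (r s t : ℕ)
  /-- `reg r := reg s * reg t` -/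
  | mul (r s t : ℕ)
  /-- `reg r := 1` if `reg s ≤ reg t`, and `0` otherwise -/
  | le (r s t : ℕ)
  /-- Hadamard gate on the qubit `q` -/
  | had (q : Qubit d b w)
  /-- phase gate `diag(1, exp(i * reg r))` on the qubit `q` -/
  | phase (q : Qubit d b w) (r : ℕ)
  /-- controlled phase gate `diag(1, 1, 1, exp(i * reg r))` on the qubits `q` and `q'` -/
  | cphase (q q' : Qubit d b w) (r : ℕ)
  /-- measure the qubit `q`, write the outcome (`0` or `1`) to `reg r`, reset `q` to `|0⟩` -/
  | measure (q : Qubit d b w) (r : ℕ)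
  /-- one oracle query on the hypergrid with origin `(reg r, …, reg (r + d - 1))` and spacing
  `reg s` -/
  | query (r s : ℕ)

/-- A configuration of the machine. -/
structure Config (d b w : ℕ) where
  reg : ℕ → ℝ
  psi : QState d b w

/-- The point of the hypergrid with the given origin and spacing whose index is in the input
register: its `i`-th coordinate is `origin i + spacing * ∑ j, 2^j * (bit j of coordinate i)`. -/
def gridPoint {d b w : ℕ} (origin : Fin d → ℝ) (spacing : ℝ) (a : Basis d b w) : Pt d :=
  WithLp.toLp 2 fun i =>
    origin i + spacing * ∑ j : Fin b, if a (Sum.inl (i, j)) then (2 : ℝ) ^ (j : ℕ) else 0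

/-- Replace the content `y` of the output register by `y ⊕ v`. -/
def xorOutput {d b w : ℕ} (v : BitVec w) (a : Basis d b w) : Basis d b w
  | Sum.inl q => a (Sum.inl q)
  | Sum.inr j => xor (a (Sum.inr j)) (v.getLsbD j)

/-- Hadamard gate. -/
def hadGate {d b w : ℕ} (q : Qubit d b w) (ψ : QState d b w) : QState d b w := fun a =>
  (ψ (Function.update a q false) + (if a q then -1 else 1) * ψ (Function.update a q true)) /
    (Real.sqrt 2 : ℂ)

/-- Phase gate. -/
def phaseGate {d b w : ℕ} (q : Qubit d b w) (α : ℝ) (ψ : QState d b w) : QState d b w := fun a =>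
  if a q then Complex.exp (α * Complex.I) * ψ a else ψ a

/-- Controlled phase gate. -/
def cphaseGate {d b w : ℕ} (q q' : Qubit d b w) (α : ℝ) (ψ : QState d b w) : QState d b w :=
  fun a => if a q && a q' then Complex.exp (α * Complex.I) * ψ a else ψ a

/-- The binary oracle of `F` on a hypergrid, `|x⟩|y⟩ ↦ |x⟩|y ⊕ F(x)⟩`. -/
def queryGate {d b w : ℕ} (F : Pt d → BitVec w) (origin : Fin d → ℝ) (spacing : ℝ)
    (ψ : QState d b w) : QState d b w := fun a =>
  ψ (xorOutput (F (gridPoint origin spacing a)) a)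

/-- The unnormalized state after measuring `q` with outcome `o` and resetting `q` to `|0⟩`. -/
def collapse {d b w : ℕ} (q : Qubit d b w) (o : Bool) (ψ : QState d b w) : QState d b w := fun a =>
  if a q then 0 else ψ (Function.update a q o)

/-- Probability of the outcome `1` when the qubit `q` is measured (Born rule). -/
def bornProb {d b w : ℕ} (q : Qubit d b w) (ψ : QState d b w) : ℝ≥0 :=
  (collapse q true ψ).normSq / ((collapse q false ψ).normSq + (collapse q true ψ).normSq)

theorem bornProb_le_one {d b w : ℕ} (q : Qubit d b w) (ψ : QState d b w) : bornProb q ψ ≤ 1 :=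
  div_le_one_of_le₀ le_add_self zero_le

/-- The law of the outcome of measuring the qubit `q`. -/
def bornRule {d b w : ℕ} (q : Qubit d b w) (ψ : QState d b w) : PMF Bool :=
  PMF.ofFintype (fun o => cond o (bornProb q ψ : ℝ≥0∞) (1 - bornProb q ψ)) (by
    simp [bornProb_le_one q ψ])

/-- Execution of one instruction, with the oracle of `F`. -/
def Instr.exec {d b w : ℕ} (F : Pt d → BitVec w) (c : Config d b w) :
    Instr d b w → PMF (Config d b w)
  | .const r v => PMF.pure ⟨Function.update c.reg r v, c.psi⟩
  | .add r s t => PMF.pure ⟨Function.update c.reg r (c.reg s + c.reg t), c.psi⟩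
  | .sub r s t => PMF.pure ⟨Function.update c.reg r (c.reg s - c.reg t), c.psi⟩
  | .mul r s t => PMF.pure ⟨Function.update c.reg r (c.reg s * c.reg t), c.psi⟩
  | .le r s t => PMF.pure ⟨Function.update c.reg r (if c.reg s ≤ c.reg t then 1 else 0), c.psi⟩
  | .had q => PMF.pure ⟨c.reg, hadGate q c.psi⟩
  | .phase q r => PMF.pure ⟨c.reg, phaseGate q (c.reg r) c.psi⟩
  | .cphase q q' r => PMF.pure ⟨c.reg, cphaseGate q q' (c.reg r) c.psi⟩
  | .measure q r => (bornRule q c.psi).map fun o =>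
      ⟨Function.update c.reg r (if o then 1 else 0), collapse q o c.psi⟩
  | .query r s => PMF.pure ⟨c.reg, queryGate F (fun i => c.reg (r + i)) (c.reg s) c.psi⟩

/-- Execution of a program. -/
def execProg {d b w : ℕ} (F : Pt d → BitVec w) :
    List (Instr d b w) → Config d b w → PMF (Config d b w)
  | [], c => PMF.pure c
  | i :: is, c => (i.exec F c).bind (execProg F is)

/-- Is the instruction an oracle query? -/
def Instr.isQuery {d b w : ℕ} : Instr d b w → Bool
  | .query _ _ => true
  | _ => false

/-- Number of oracle queries of a program. -/
def queryCount {d b w : ℕ} (prog : List (Instr d b w)) : ℕ := prog.countP Instr.isQuery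

/-- Initial configuration on input `x`: the coordinates of `x` in the registers `0, …, d - 1`, all
other registers `0`, all qubits in the state `|0⟩`. -/
def initConfig {d : ℕ} (b w : ℕ) (x : Pt d) : Config d b w where
  reg := fun n => if h : n < d then x ⟨n, h⟩ else 0
  psi := fun a => if ∀ q, a q = false then 1 else 0

/-- The law of the vector that a program leaves in the registers `0, …, d - 1` on input `x`. -/
def estimate {d b w : ℕ} (F : Pt d → BitVec w) (prog : List (Instr d b w)) (x : Pt d) :
    PMF (Pt d) :=
  (execProg F prog (initConfig b w x)).map fun c => WithLp.toLp 2 fun i : Fin d => c.reg i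

/-- `F` is a `θ`-approximate binary oracle for `f` on `D`: the output bits, read as a signed
(two's complement) fixed-point number with `frac` fractional bits, are within `θ` of `f`. -/
def IsBinaryOracle {d w : ℕ} (frac : ℕ) (F : Pt d → BitVec w) (f : Pt d → ℝ) (θ : ℝ)
    (D : Set (Pt d)) : Prop :=
  ∀ x ∈ D, |((F x).toInt : ℝ) / 2 ^ frac - f x| < θ

/-- The closed `r`-neighbourhood of `X` in the `ℓ_∞` norm. -/
def supNbhd {d : ℕ} (X : Set (Pt d)) (r : ℝ) : Set (Pt d) :=
  {x | ∃ y ∈ X, lpNorm ∞ (x - y) ≤ r}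

/-! ### Mirror descent with estimated subgradients -/

/-- The law of `(x_{t+1}, x_1 + ⋯ + x_t)` after `t` iterations of mirror descent from `x₁`, where
the subgradient at each iterate is produced by a fresh run of `prog`. -/
def mirrorDescent {d b w : ℕ} (X P : Set (Pt d)) (Φ : Pt d → ℝ) (η : ℝ) (F : Pt d → BitVec w)
    (prog : List (Instr d b w)) (x₁ : Pt d) : ℕ → PMF (Pt d × Pt d)
  | 0 => PMF.pure (x₁, 0)
  | t + 1 => (mirrorDescent X P Φ η F prog x₁ t).bind fun s =>
      (estimate F prog s.1).map fun g => (mirrorStep X P Φ η s.1 g, s.2 + s.1)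

/-- The law of the average of the iterates `x_1, …, x_T`. -/
def mirrorDescentOutput {d b w : ℕ} (X P : Set (Pt d)) (Φ : Pt d → ℝ) (η : ℝ)
    (F : Pt d → BitVec w) (prog : List (Instr d b w)) (x₁ : Pt d) (T : ℕ) : PMF (Pt d) :=
  (mirrorDescent X P Φ η F prog x₁ T).map fun s => (1 / (T : ℝ)) • s.2

/-- The number of gates (elementary operations) of `T` iterations: each runs `prog`, adds the
iterate to the running sum (`d` additions), and moves to the next iterate at cost `Tnext`. -/
def gateCount {d b w : ℕ} (prog : List (Instr d b w)) (Tnext T : ℕ) : ℕ :=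
  T * (prog.length + d + Tnext)

/-- Probability of an event. -/
def prob {α : Type*} (law : PMF α) (S : Set α) : ℝ := (law.toOuterMeasure S).toReal

end

/-! ### Norms -/

section Norms

variable {d : ℕ} {p : ℝ≥0∞}

/-! Mirror descent tolerates inexact subgradients. If every step uses an `α`-approximate subgradient
of dual norm at most `H`, strong convexity of `Φ` bounds the regret by `D_Φ(x⋆, x₁) + T (η α + (H
η)² / (2 μ))` (`mirrorStep_regret`, `RegretBound.succ`). With `α = ε / 4` and `H = 2 G`, about `16
κ²` steps suffice (`regret_budget`). What remains is an estimator that uses logarithmically many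
queries and fails with probability at most `1 / (3 T)` at each point of `X`; a union bound over the
iterations then leaves `2/3`.

The estimator is Jordan's. If `f` is affine with slope `g` on a small hypergrid, writing `2π 2^m f`
into the phases of a uniform superposition gives a product state, in which bit `j` of coordinate `i`
carries the phase `2π 2^j x_i` with `x_i = g_i / (8 G)`. A semiclassical Fourier transform on each
coordinate reads off all slopes after only two queries (`wp_prep`, `hasPhase_linearPhase`,
`wp_stages`). The outcome is distributed as a squared Dirichlet kernel, whose tail is summable
(`dirichletSq_tail`).

A convex Lipschitz `f` need not be nearly affine around a given point, so the grid gets a random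
origin `z`. If `g` is a subgradient at `z`, the deviation `f (z + y) - f z - ⟨g, y⟩` lies between
`0` and the second difference `f (z + y) + f (z - y) - 2 f z`. Averaged over `z` in a much wider
grid, second differences telescope to boundary terms (`avg_second_difference_le`), so by Markov's
inequality most origins are good (`expect_gradProg_le`). A subgradient at a point near `x` is an
approximate subgradient at `x` (`NearSubgradient.isApproxSubgradient`).

At a good origin each coordinate of one run is wrong with probability at most `1/16`; a majority
vote over `r` runs at the same origin lowers the failure to `d / 2^r` (`wp_runs_vote_le`). If `κ² ≤
1/2` or `G K ≤ ε`, the starting point is already good enough and the empty program serves.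

Probabilities are computed with unnormalized states: `wp` sums over all measurement branches, each
weighted by its squared norm, so that programs are analysed by linear algebra alone
(`normSq_mul_expect`). -/

theorem lpNorm_nonneg (hp : 1 ≤ p) (x : Pt d) : 0 ≤ lpNorm p x := by
  have : Fact (1 ≤ p) := ⟨hp⟩
  exact norm_nonneg _

theorem lpNorm_smul (hp : 1 ≤ p) (a : ℝ) (x : Pt d) : lpNorm p (a • x) = |a| * lpNorm p x := by
  have : Fact (1 ≤ p) := ⟨hp⟩
  have h : (WithLp.toLp p (a • x).ofLp : PiLp p fun _ : Fin d => ℝ) = a • WithLp.toLp p x.ofLp := rfl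
  rw [lpNorm, h, norm_smul, Real.norm_eq_abs]; rfl

theorem lpNorm_neg (hp : 1 ≤ p) (x : Pt d) : lpNorm p (-x) = lpNorm p x := by
  have h := lpNorm_smul hp (-1) x
  simpa using h

theorem abs_apply_le_lpNorm (hp : 1 ≤ p) (x : Pt d) (i : Fin d) : |x i| ≤ lpNorm p x := by
  have : Fact (1 ≤ p) := ⟨hp⟩
  exact PiLp.norm_apply_le (WithLp.toLp p x.ofLp : PiLp p fun _ : Fin d => ℝ) i

theorem lpNorm_top_le {x : Pt d} {r : ℝ} (hr : 0 ≤ r) (h : ∀ i, |x i| ≤ r) : lpNorm ∞ x ≤ r := by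
  rw [lpNorm, PiLp.norm_toLp]
  exact (pi_norm_le_iff_of_nonneg hr).2 h

theorem lpNorm_single (hp : 1 ≤ p) (i : Fin d) (a : ℝ) :
    lpNorm p (EuclideanSpace.single i a : Pt d) = |a| := by
  have : Fact (1 ≤ p) := ⟨hp⟩
  have := PiLp.norm_single p (fun _ : Fin d => ℝ) i a
  exact this

theorem inner_eq_sum (g x : Pt d) : inner ℝ g x = ∑ i, g i * x i := by
  simp [PiLp.inner_apply, mul_comm]

/-- The real `sSup` of an unbounded set is `0`, so boundedness is what gives `dualLpNorm` its
meaning. Coordinates of the unit ball are at most `1` in absolute value, hence the `ℓ₁` norm of `g`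
is a bound. -/
theorem dualLpNorm_bddAbove (hp : 1 ≤ p) (g : Pt d) :
    BddAbove {r | ∃ x : Pt d, lpNorm p x ≤ 1 ∧ r = inner ℝ g x} := by
  refine ⟨∑ i, |g i|, ?_⟩
  rintro _ ⟨x, hx, rfl⟩
  rw [inner_eq_sum]
  refine Finset.sum_le_sum fun i _ => ?_
  calc g i * x i ≤ |g i| * |x i| := by rw [← abs_mul]; exact le_abs_self _
    _ ≤ |g i| * 1 := by gcongr; exact (abs_apply_le_lpNorm hp x i).trans hx
    _ = |g i| := mul_one _

theorem inner_le_dualLpNorm_mul (hp : 1 ≤ p) (g x : Pt d) :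
    inner ℝ g x ≤ dualLpNorm p g * lpNorm p x := by
  rcases (lpNorm_nonneg hp x).eq_or_lt with h | h
  · have hx : x = 0 := by
      ext i
      have := abs_apply_le_lpNorm hp x i
      rw [← h] at this
      simpa using this
    rw [← h, mul_zero, hx, inner_zero_right]
  · have := le_csSup (dualLpNorm_bddAbove hp g)
      ⟨(lpNorm p x)⁻¹ • x, by
        rw [lpNorm_smul hp, abs_of_pos (inv_pos.2 h), inv_mul_cancel₀ h.ne'], rfl⟩
    rw [inner_smul_right] at this
    change _ ≤ dualLpNorm p g at this
    rwa [inv_mul_le_iff₀ h, mul_comm] at this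

theorem lpDiam_bddAbove {X : Set (Pt d)} (hX : Bornology.IsBounded X) {ϑ : ℝ} (hϑ0 : 0 ≤ ϑ)
    (hϑ : ∀ x : Pt d, lpNorm p x ≤ ϑ * lpNorm ∞ x) :
    BddAbove {r | ∃ x ∈ X, ∃ y ∈ X, r = lpNorm p (x - y)} := by
  obtain ⟨D, hD⟩ := Metric.isBounded_iff.1 hX
  refine ⟨ϑ * D, ?_⟩
  rintro _ ⟨x, hx, y, hy, rfl⟩
  refine (hϑ _).trans ?_
  gcongr
  have h1 := hD hx hy
  rw [dist_eq_norm] at h1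
  exact lpNorm_top_le ((norm_nonneg _).trans h1) fun i => (PiLp.norm_apply_le (x - y) i).trans h1

theorem lpNorm_sub_le_lpDiam {X : Set (Pt d)} (hX : Bornology.IsBounded X) {ϑ : ℝ} (hϑ0 : 0 ≤ ϑ)
    (hϑ : ∀ x : Pt d, lpNorm p x ≤ ϑ * lpNorm ∞ x) {x y : Pt d} (hx : x ∈ X) (hy : y ∈ X) :
    lpNorm p (x - y) ≤ lpDiam p X :=
  le_csSup (lpDiam_bddAbove hX hϑ0 hϑ) ⟨x, hx, y, hy, rfl⟩

end Norms

/-! ### Subgradients of Lipschitz convex functions -/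

section Subgradient

variable {d : ℕ} {p : ℝ≥0∞} {f : Pt d → ℝ} {G : ℝ}

theorem IsLpLipschitz.continuous (hG : 0 ≤ G) {ϑ : ℝ} (hϑ0 : 0 ≤ ϑ)
    (hϑ : ∀ x : Pt d, lpNorm p x ≤ ϑ * lpNorm ∞ x) (hf : IsLpLipschitz p G f) : Continuous f := by
  refine (LipschitzWith.of_dist_le_mul (K := (G * ϑ).toNNReal) fun x y => ?_).continuous
  rw [Real.coe_toNNReal _ (by positivity), Real.dist_eq, dist_eq_norm, mul_assoc]
  refine (hf x y).trans ?_
  gcongr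
  refine (hϑ _).trans ?_
  gcongr
  exact lpNorm_top_le (norm_nonneg _) fun i => PiLp.norm_apply_le (x - y) i

/-- Hahn–Banach: the point `(z, f z)` is separated from the strict epigraph, which is convex, and
open because `f` is continuous. Rescaling the separating functional gives the slope. -/
theorem exists_subgradient (hf : ConvexOn ℝ Set.univ f) (hc : Continuous f) (z : Pt d) :
    ∃ g : Pt d, ∀ q, f z + inner ℝ g (q - z) ≤ f q := by
  have hconv : Convex ℝ {q : Pt d × ℝ | q.1 ∈ Set.univ ∧ f q.1 < q.2} := hf.convex_strict_epigraph
  have hopen : IsOpen {q : Pt d × ℝ | q.1 ∈ Set.univ ∧ f q.1 < q.2} := by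
    simp only [Set.mem_univ, true_and]
    exact isOpen_lt (hc.comp continuous_fst) continuous_snd
  obtain ⟨l, hl⟩ := geometric_hahn_banach_open_point (x := (z, f z)) hconv hopen (by simp)
  have hsplit : ∀ (x : Pt d) (t : ℝ), l (x, t) = l (x, 0) + t * l (0, 1) := by
    intro x t
    have : ((x, t) : Pt d × ℝ) = (x, 0) + t • (0, 1) := by simp
    rw [this, map_add, map_smul, smul_eq_mul]
  -- The hyperplane is not vertical: the epigraph contains the point `(z, f z + 1)` straight above.
  have hc0 : l (0, 1) < 0 := by
    have := hl (z, f z + 1) (by simp)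
    rw [hsplit, hsplit z (f z)] at this
    linarith
  set c := l (0, 1)
  set l1 : StrongDual ℝ (Pt d) := l.comp (ContinuousLinearMap.inl ℝ (Pt d) ℝ)
  have hl1 : ∀ x, l1 x = l (x, 0) := fun x => rfl
  refine ⟨(InnerProductSpace.toDual ℝ (Pt d)).symm ((-c)⁻¹ • l1), fun q => ?_⟩
  rw [InnerProductSpace.toDual_symm_apply]
  refine le_of_forall_pos_lt_add fun e he => ?_
  have := hl (q, f q + e) (by simp [he])
  rw [hsplit, hsplit z (f z), ← hl1, ← hl1] at this
  have h2 : l1 (q - z) < -c * (f q + e - f z) := by rw [map_sub]; linarith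
  have h3 : (-c)⁻¹ * l1 (q - z) < f q + e - f z := by
    rwa [inv_mul_lt_iff₀ (by linarith)]
  simp only [smul_apply, smul_eq_mul]
  linarith

theorem inner_subgradient_le (hf : IsLpLipschitz p G f) {z g : Pt d}
    (hg : ∀ q, f z + inner ℝ g (q - z) ≤ f q) (v : Pt d) : inner ℝ g v ≤ G * lpNorm p v := by
  have h1 := hg (z + v)
  have h2 := (abs_le.1 (hf (z + v) z)).2
  rw [add_sub_cancel_left] at h1 h2
  linarith

/-- Basis vectors have norm `1` in every `ℓ_p`. This bound keeps the rescaled slopes `g i / (8 G)`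
within `1/8`, where reading them modulo `1` is unambiguous. -/
theorem abs_subgradient_apply_le (hp : 1 ≤ p) (hf : IsLpLipschitz p G f) {z g : Pt d}
    (hg : ∀ q, f z + inner ℝ g (q - z) ≤ f q) (i : Fin d) : |g i| ≤ G := by
  have h1 := inner_subgradient_le hf hg (EuclideanSpace.single i 1)
  have h2 := inner_subgradient_le hf hg (-EuclideanSpace.single i 1)
  rw [lpNorm_neg hp] at h2
  rw [lpNorm_single hp] at h1 h2
  simp [EuclideanSpace.inner_single_right] at h1 h2
  exact abs_le.2 ⟨by linarith, h1⟩

end Subgradient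

/-! ### Mirror descent -/

section Mirror

variable {d : ℕ} {X P : Set (Pt d)} {Φ : Pt d → ℝ}

theorem hasDerivAt_line {x v : Pt d} (h : DifferentiableAt ℝ Φ x) :
    HasDerivAt (fun t : ℝ => Φ (x + t • v)) (inner ℝ (gradient Φ x) v) 0 := by
  have h1 : HasFDerivAt Φ (fderiv ℝ Φ x) (x + (0 : ℝ) • v) := by simpa using h.hasFDerivAt
  have h2 : HasDerivAt (fun t : ℝ => x + t • v) v 0 := by
    simpa using ((hasDerivAt_id (0 : ℝ)).smul_const v).const_add x
  have := h1.comp_hasDerivAt (0 : ℝ) h2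
  rwa [inner_gradient_left]

theorem slope_tendsto_inner_gradient {x v : Pt d} (h : DifferentiableAt ℝ Φ x) :
    Filter.Tendsto (fun t : ℝ => t⁻¹ * (Φ (x + t • v) - Φ x)) (𝓝[>] 0)
      (𝓝 (inner ℝ (gradient Φ x) v)) := by
  have := (hasDerivAt_line (v := v) h).tendsto_slope_zero_right
  simpa using this

theorem gradient_inequality (hc : ConvexOn ℝ P Φ) {x y : Pt d} (hx : x ∈ P) (hy : y ∈ P)
    (h : DifferentiableAt ℝ Φ x) : Φ x + inner ℝ (gradient Φ x) (y - x) ≤ Φ y := by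
  have h1 : inner ℝ (gradient Φ x) (y - x) ≤ Φ y - Φ x := by
    refine le_of_tendsto (slope_tendsto_inner_gradient (v := y - x) h) ?_
    filter_upwards [Ioo_mem_nhdsGT (show (0 : ℝ) < 1 by norm_num)] with t ht
    rw [inv_mul_le_iff₀ ht.1]
    have h2 := hc.2 hx hy (sub_nonneg.2 ht.2.le) ht.1.le (by ring)
    have h3 : (1 - t) • x + t • y = x + t • (y - x) := by module
    rw [h3] at h2
    simp only [smul_eq_mul] at h2
    linarith
  linarith

/-- First-order optimality of a minimizer of the Bregman divergence. -/
theorem bregman_first_order (hX : Convex ℝ X) (hP : Convex ℝ P) {x y u : Pt d}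
    (hx : x ∈ X ∩ P) (hd : DifferentiableAt ℝ Φ x) (hu : u ∈ X ∩ P)
    (hmin : ∀ x' ∈ X ∩ P, bregman Φ x y ≤ bregman Φ x' y) :
    0 ≤ inner ℝ (gradient Φ x - gradient Φ y) (u - x) := by
  rw [inner_sub_left, sub_nonneg]
  refine ge_of_tendsto (slope_tendsto_inner_gradient (v := u - x) hd) ?_
  filter_upwards [Ioo_mem_nhdsGT (show (0 : ℝ) < 1 by norm_num)] with t ht
  rw [le_inv_mul_iff₀ ht.1]
  have hm : x + t • (u - x) ∈ X ∩ P := by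
    have := (hX.inter hP) hx hu (sub_nonneg.2 ht.2.le) ht.1.le (by ring)
    have h3 : (1 - t) • x + t • u = x + t • (u - x) := by module
    rwa [h3] at this
  have := hmin _ hm
  simp only [bregman] at this
  have h4 : x + t • (u - x) - y = (x - y) + t • (u - x) := by abel
  rw [h4, inner_add_right, inner_smul_right] at this
  linarith

/-- Compactness of `X` gives a limit of a minimizing sequence, and the work is to keep this limit
off the frontier of the open set `P`. Were it there, the gradients along the segment from the limit
to an interior point `x0` would stay bounded, against the divergence of `∇Φ` at the frontier. -/
theorem exists_bregman_minimizer (hcl : IsClosed X) (hb : Bornology.IsBounded X)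
    (hX : Convex ℝ X) (hm : IsMirrorMap X P Φ) {y : Pt d} (hy : y ∈ P) :
    ∃ x ∈ X ∩ P, ∀ x' ∈ X ∩ P, bregman Φ x y ≤ bregman Φ x' y := by
  classical
  -- `Ψ` differs from `bregman Φ · y` by a constant, so it has the same minimizers; it is convex
  -- with gradient `∇Φ - ∇Φ(y)` and hence minimal over `P` at `y`.
  set Ψ : Pt d → ℝ := fun x => Φ x - inner ℝ (gradient Φ y) x with hΨ
  have hbr : ∀ x, bregman Φ x y = Ψ x - Ψ y := by
    intro x; simp only [bregman, hΨ, inner_sub_right]; ring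
  have hconv := hm.strictConvexOn.convexOn
  have hgi : ∀ x ∈ P, ∀ u ∈ P, Ψ x + inner ℝ (gradient Φ x - gradient Φ y) (u - x) ≤ Ψ u := by
    intro x hx u hu
    have := gradient_inequality hconv hx hu (hm.differentiableAt x hx)
    simp only [hΨ, inner_sub_left, inner_sub_right] at this ⊢
    linarith
  have hlow : ∀ u ∈ P, Ψ y ≤ Ψ u := by
    intro u hu; simpa using hgi y hy u hu
  have hcont : ContinuousOn Ψ P := fun x hx =>
    ((hm.differentiableAt x hx).continuousAt.sub
      (continuous_const.inner continuous_id).continuousAt).continuousWithinAt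
  have hΨc : ConvexOn ℝ P Ψ := by
    refine hconv.sub ⟨hm.convex, fun x _ u _ a b _ _ _ => ?_⟩
    simp [inner_add_right, inner_smul_right]
  obtain ⟨x0, hx0⟩ := hm.inter_nonempty
  set I := sInf (Ψ '' (X ∩ P)) with hI
  have hne : (Ψ '' (X ∩ P)).Nonempty := ⟨_, x0, hx0, rfl⟩
  have hbdd : BddBelow (Ψ '' (X ∩ P)) := ⟨Ψ y, by rintro _ ⟨u, hu, rfl⟩; exact hlow u hu.2⟩
  have hIle : ∀ u ∈ X ∩ P, I ≤ Ψ u := fun u hu => csInf_le hbdd ⟨u, hu, rfl⟩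
  obtain ⟨v, -, hvt, hv⟩ := exists_seq_tendsto_sInf hne hbdd
  choose xs hxs hxsv using hv
  obtain ⟨xh, hxh, φ, hφ, hlim⟩ :=
    (Metric.isCompact_of_isClosed_isBounded hcl hb).tendsto_subseq fun n => (hxs n).1
  have hΨlim : Filter.Tendsto (fun n => Ψ (xs (φ n))) Filter.atTop (𝓝 I) := by
    simp only [hxsv]; exact hvt.comp hφ.tendsto_atTop
  suffices hxP : xh ∈ P by
    refine ⟨xh, ⟨hxh, hxP⟩, fun x' hx' => ?_⟩
    rw [hbr, hbr]
    have h1 : Filter.Tendsto (fun n => Ψ (xs (φ n))) Filter.atTop (𝓝 (Ψ xh)) :=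
      ((hcont xh hxP).continuousAt (hm.isOpen.mem_nhds hxP)).tendsto.comp hlim
    have := tendsto_nhds_unique h1 hΨlim
    linarith [hIle x' hx']
  by_contra hxP
  have hfr : xh ∈ frontier P := by
    rw [hm.isOpen.frontier_eq]; exact ⟨hm.subset_closure hxh, hxP⟩
  set pt : ℝ → Pt d := fun t => xh + t • (x0 - xh) with hpt
  have hptmem : ∀ t ∈ Set.Ioc (0 : ℝ) 1, pt t ∈ X ∩ P := by
    intro t ht
    have h3 : pt t = (1 - t) • xh + t • x0 := by simp only [hpt]; module
    rw [h3]
    refine ⟨hX hxh hx0.1 (sub_nonneg.2 ht.2) ht.1.le (by ring), ?_⟩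
    have := hm.convex.combo_closure_interior_mem_interior (hm.subset_closure hxh)
      (hm.isOpen.interior_eq.symm ▸ hx0.2) (sub_nonneg.2 ht.2) ht.1 (by ring)
    rwa [hm.isOpen.interior_eq] at this
  -- Continuity of `Ψ` is known only inside `P`, so convexity is applied on segments from the
  -- minimizing sequence to `x0`, and the limit is taken afterwards.
  have hchord : ∀ t ∈ Set.Ioc (0 : ℝ) 1, Ψ (pt t) ≤ (1 - t) * I + t * Ψ x0 := by
    intro t ht
    have h1 : Filter.Tendsto (fun n => Ψ (xs (φ n) + t • (x0 - xs (φ n)))) Filter.atTop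
        (𝓝 (Ψ (pt t))) := by
      refine ((hcont _ (hptmem t ht).2).continuousAt
        (hm.isOpen.mem_nhds (hptmem t ht).2)).tendsto.comp ?_
      exact hlim.add ((tendsto_const_nhds.sub hlim).const_smul t)
    refine le_of_tendsto_of_tendsto' h1 ((hΨlim.const_mul (1 - t)).add_const _) fun n => ?_
    have := hΨc.2 (hxs (φ n)).2 hx0.2 (sub_nonneg.2 ht.2) ht.1.le (by ring)
    have h3 : (1 - t) • xs (φ n) + t • x0 = xs (φ n) + t • (x0 - xs (φ n)) := by module
    rw [h3] at this
    simpa using this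
  -- `Ψ` does not decrease on the whole from the boundary limit to `pt t`: its limit at the boundary
  -- end is at most the infimum `I`, and `Ψ (pt t) ≥ I`. By convexity the directional derivative at
  -- `pt t` is then nonnegative.
  have hmono : ∀ t ∈ Set.Ioc (0 : ℝ) 1,
      0 ≤ inner ℝ (gradient Φ (pt t) - gradient Φ y) (x0 - xh) := by
    intro t ht
    have hstep : ∀ r ∈ Set.Ioo (0 : ℝ) t, Ψ (pt t) - Ψ (pt r) ≤
        (t - r) * inner ℝ (gradient Φ (pt t) - gradient Φ y) (x0 - xh) := by
      intro r hr
      have h1 := hgi _ (hptmem t ht).2 _ (hptmem r ⟨hr.1, hr.2.le.trans ht.2⟩).2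
      have h2 : pt r - pt t = (-(t - r)) • (x0 - xh) := by simp only [hpt]; module
      rw [h2, inner_smul_right] at h1
      linarith
    have hlim2 : Filter.Tendsto (fun r : ℝ => (t - r) *
        inner ℝ (gradient Φ (pt t) - gradient Φ y) (x0 - xh) + ((1 - r) * I + r * Ψ x0)) (𝓝[>] 0)
        (𝓝 ((t - 0) * inner ℝ (gradient Φ (pt t) - gradient Φ y) (x0 - xh) +
          ((1 - 0) * I + 0 * Ψ x0))) := by
      refine tendsto_nhdsWithin_of_tendsto_nhds (Continuous.tendsto ?_ 0)
      fun_prop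
    have h5 : Ψ (pt t) ≤ (t - 0) * inner ℝ (gradient Φ (pt t) - gradient Φ y) (x0 - xh) +
          ((1 - 0) * I + 0 * Ψ x0) := by
      refine ge_of_tendsto hlim2 ?_
      filter_upwards [Ioo_mem_nhdsGT ht.1] with r hr
      have h6 := hchord r ⟨hr.1, hr.2.le.trans ht.2⟩
      linarith [hstep r hr]
    have h7 := hIle _ (hptmem t ht)
    have h8 : 0 ≤ t * inner ℝ (gradient Φ (pt t) - gradient Φ y) (x0 - xh) := by linarith
    exact nonneg_of_mul_nonneg_right h8 ht.1
  obtain ⟨r, hr, hball⟩ := Metric.nhds_basis_closedBall.mem_iff.1 (hm.isOpen.mem_nhds hx0.2)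
  obtain ⟨B, hB⟩ := ((isCompact_closedBall x0 r).bddAbove_image (hcont.mono hball))
  have hgrad : ∀ t ∈ Set.Ioc (0 : ℝ) 1, ‖gradient Φ (pt t) - gradient Φ y‖ ≤ (B - Ψ y) / r := by
    intro t ht
    set g := gradient Φ (pt t) - gradient Φ y with hg
    rcases eq_or_ne g 0 with h0 | h0
    · rw [h0, norm_zero]
      have := hB ⟨x0, Metric.mem_closedBall_self hr.le, rfl⟩
      have h2 := hlow x0 hx0.2
      exact div_nonneg (by linarith) hr.le
    have hn : 0 < ‖g‖ := norm_pos_iff.2 h0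
    -- Moving from `x0` in the gradient direction, inside a ball on which `Ψ ≤ B`, raises `Ψ` by at
    -- least `r ‖g‖` above its lower bound `Ψ y`.
    set u := x0 + (r / ‖g‖) • g with hu
    have hub : u ∈ Metric.closedBall x0 r := by
      rw [Metric.mem_closedBall, dist_eq_norm, hu, add_sub_cancel_left, norm_smul, norm_div,
        norm_norm, Real.norm_of_nonneg hr.le, div_mul_cancel₀ _ hn.ne']
    have h1 := hgi _ (hptmem t ht).2 u (hball hub)
    have h2 : u - pt t = (r / ‖g‖) • g + (1 - t) • (x0 - xh) := by
      simp only [hpt, hu]; module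
    rw [← hg, h2, inner_add_right, inner_smul_right, inner_smul_right,
      real_inner_self_eq_norm_sq] at h1
    have h3 : r / ‖g‖ * ‖g‖ ^ 2 = r * ‖g‖ := by field_simp
    have h4 := mul_nonneg (sub_nonneg.2 ht.2) (hmono t ht)
    have h5 := hB ⟨u, hub, rfl⟩
    have h6 := hlow _ (hptmem t ht).2
    rw [le_div_iff₀ hr]
    linarith
  have htend : Filter.Tendsto pt (𝓝[>] 0) (𝓝[P] xh) := by
    refine tendsto_nhdsWithin_iff.2 ⟨?_, ?_⟩
    · have : Filter.Tendsto pt (𝓝 0) (𝓝 (pt 0)) := by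
        refine Continuous.tendsto ?_ 0
        simp only [hpt]; fun_prop
      simp only [hpt, zero_smul, add_zero] at this
      exact tendsto_nhdsWithin_of_tendsto_nhds this
    · filter_upwards [Ioc_mem_nhdsGT (show (0 : ℝ) < 1 by norm_num)] with t ht
      exact (hptmem t ht).2
  have hdiv := (hm.gradient_diverges xh hfr).comp htend
  have h1 := hdiv.eventually_gt_atTop ((B - Ψ y) / r + ‖gradient Φ y‖)
  obtain ⟨t, ht1, ht2⟩ := (h1.and (Ioc_mem_nhdsGT (show (0 : ℝ) < 1 by norm_num))).exists
  have h2 := hgrad t ht2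
  have h3 := norm_sub_norm_le (gradient Φ (pt t)) (gradient Φ y)
  simp only [Function.comp] at ht1
  linarith

/-- `invFunOn` is a true inverse image because `∇Φ` maps `P` onto the whole space, and `epsilon`
picks a true minimizer by `exists_bregman_minimizer`; both would otherwise be arbitrary values. -/
theorem mirrorStep_spec (hcl : IsClosed X) (hb : Bornology.IsBounded X)
    (hX : Convex ℝ X) (hm : IsMirrorMap X P Φ) (η : ℝ) (x g : Pt d) :
    mirrorStep X P Φ η x g ∈ X ∩ P ∧ ∀ u ∈ X ∩ P,
      0 ≤ inner ℝ (gradient Φ (mirrorStep X P Φ η x g) - (gradient Φ x - η • g))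
        (u - mirrorStep X P Φ η x g) := by
  have hsur : ∃ a ∈ P, gradient Φ a = gradient Φ x - η • g := hm.gradient_surjOn _
  set y := Function.invFunOn (gradient Φ) P (gradient Φ x - η • g) with hy
  have hyP : y ∈ P := Function.invFunOn_mem hsur
  have hyg : gradient Φ y = gradient Φ x - η • g := Function.invFunOn_eq hsur
  have hex : ∃ x, x ∈ X ∩ P ∧ ∀ x' ∈ X ∩ P, bregman Φ x y ≤ bregman Φ x' y := by
    obtain ⟨x, hx, h⟩ := exists_bregman_minimizer hcl hb hX hm hyP
    exact ⟨x, hx, h⟩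
  have hspec := Classical.epsilon_spec hex
  change bregmanProj X P Φ y ∈ X ∩ P ∧ _ at hspec
  refine ⟨hspec.1, fun u hu => ?_⟩
  rw [← hyg]
  exact bregman_first_order hX hm.convex hspec.1 (hm.differentiableAt _ hspec.1.2) hu hspec.2

/-- One-step regret bound of mirror descent. -/
theorem mirrorStep_regret {p : ℝ≥0∞} (hp : 1 ≤ p) {μ η H : ℝ} (hcl : IsClosed X)
    (hb : Bornology.IsBounded X) (hX : Convex ℝ X) (hm : IsMirrorMap X P Φ)
    (hsc : IsLpStronglyConvexOn p μ (X ∩ P) Φ) (hμ : 0 < μ) (hη : 0 ≤ η) {x xs g : Pt d}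
    (hx : x ∈ X ∩ P) (hxs : xs ∈ X ∩ P) (hg : ∀ v, inner ℝ g v ≤ H * lpNorm p v) :
    η * inner ℝ g (x - xs) ≤ bregman Φ xs x - bregman Φ xs (mirrorStep X P Φ η x g) +
      (H * η) ^ 2 / (2 * μ) := by
  obtain ⟨h1, h2⟩ := mirrorStep_spec hcl hb hX hm η x g
  set x' := mirrorStep X P Φ η x g
  have h3 := h2 xs hxs
  have h4 := hsc x hx x' h1
  have h5 := hg (x - x')
  have hnorm : lpNorm p (x - x') = lpNorm p (x' - x) := by
    rw [← lpNorm_neg hp, neg_sub]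
  rw [hnorm] at h5
  -- Young's inequality: moving from `x` to `x'` costs at most `H η ‖x' - x‖`, and the quadratic
  -- term of strong convexity absorbs this.
  have h6 : (H * η) * lpNorm p (x' - x) ≤
      (H * η) ^ 2 / (2 * μ) + μ / 2 * lpNorm p (x' - x) ^ 2 := by
    have : 0 ≤ (H * η - μ * lpNorm p (x' - x)) ^ 2 / (2 * μ) := by positivity
    have e : (H * η - μ * lpNorm p (x' - x)) ^ 2 / (2 * μ) = (H * η) ^ 2 / (2 * μ) +
      μ / 2 * lpNorm p (x' - x) ^ 2 - (H * η) * lpNorm p (x' - x) := by field_simp; ring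
    linarith
  have h7 := mul_le_mul_of_nonneg_left h5 hη
  simp only [bregman, inner_sub_left, inner_sub_right, inner_smul_left, RCLike.conj_to_real]
    at h3 h4 h7 ⊢
  linarith

end Mirror

/-! ### Expectations -/

noncomputable section

/-- Expectation of a nonnegative function. -/
def expect {α : Type*} (law : PMF α) (φ : α → ℝ≥0∞) : ℝ≥0∞ := ∑' a, law a * φ a

theorem expect_pure {α : Type*} (a : α) (φ : α → ℝ≥0∞) : expect (PMF.pure a) φ = φ a := by
  classical
  rw [expect, tsum_eq_single a]
  · simp
  · intro b hb; simp [PMF.pure_apply, hb]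

theorem expect_bind {α β : Type*} (law : PMF α) (k : α → PMF β) (φ : β → ℝ≥0∞) :
    expect (law.bind k) φ = expect law fun a => expect (k a) φ := by
  simp only [expect, PMF.bind_apply, ← ENNReal.tsum_mul_right, ← ENNReal.tsum_mul_left]
  rw [ENNReal.tsum_comm]
  simp only [mul_assoc]

theorem expect_map {α β : Type*} (law : PMF α) (g : α → β) (φ : β → ℝ≥0∞) :
    expect (law.map g) φ = expect law fun a => φ (g a) := by
  rw [← PMF.bind_pure_comp, expect_bind]
  simp only [Function.comp, expect_pure]

theorem expect_mono {α : Type*} (law : PMF α) {φ φ' : α → ℝ≥0∞} (h : ∀ a, φ a ≤ φ' a) :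
    expect law φ ≤ expect law φ' :=
  ENNReal.tsum_le_tsum fun a => by gcongr; exact h a

theorem expect_add {α : Type*} (law : PMF α) (φ φ' : α → ℝ≥0∞) :
    expect law (fun a => φ a + φ' a) = expect law φ + expect law φ' := by
  simp only [expect, mul_add, ENNReal.tsum_add]

theorem expect_const {α : Type*} (law : PMF α) (r : ℝ≥0∞) : expect law (fun _ => r) = r := by
  rw [expect, ENNReal.tsum_mul_right, law.tsum_coe, one_mul]

theorem expect_bool (law : PMF Bool) (φ : Bool → ℝ≥0∞) :
    expect law φ = law false * φ false + law true * φ true := by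
  rw [expect, tsum_fintype, Fintype.sum_bool, add_comm]

/-- A probability is large when the expectation of the indicator of the complement is small. -/
theorem one_sub_le_prob {α : Type*} (law : PMF α) (S : Set α) {δ : ℝ} (hδ : 0 ≤ δ)
    (h : expect law (Sᶜ.indicator 1) ≤ ENNReal.ofReal δ) : 1 - δ ≤ prob law S := by
  have h1 : expect law (S.indicator 1) + expect law (Sᶜ.indicator 1) = 1 := by
    rw [← expect_add, ← expect_const law 1]
    congr 1
    funext a
    exact congrFun (Set.indicator_self_add_compl S 1) a
  have h2 : law.toOuterMeasure S = expect law (S.indicator 1) := by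
    rw [PMF.toOuterMeasure_apply, expect]
    refine tsum_congr fun a => ?_
    by_cases ha : a ∈ S <;> simp [ha]
  have h3 : expect law (S.indicator 1) ≠ ∞ := by
    intro h0; rw [h0] at h1; simp at h1
  have h4 : 1 ≤ expect law (S.indicator 1) + ENNReal.ofReal δ := by rw [← h1]; gcongr
  have h5 := ENNReal.toReal_mono (by simp [h3]) h4
  rw [ENNReal.toReal_add h3 (by simp), ENNReal.toReal_ofReal hδ] at h5
  rw [prob, h2]
  simp at h5
  linarith

/-! ### Gates -/

section Gates

variable {d b w : ℕ}

theorem coe_normSq (ψ : QState d b w) : (ψ.normSq : ℝ) = ∑ a, ‖ψ a‖ ^ 2 := by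
  simp [QState.normSq]

/-- Flip one bit of a basis state. -/
def flipBit (q : Qubit d b w) : Basis d b w ≃ Basis d b w where
  toFun a := Function.update a q (!(a q))
  invFun a := Function.update a q (!(a q))
  left_inv a := by simp
  right_inv a := by simp

/-- Basis states are paired with their flip at `q`, and the state with `q = 0` represents the pair.
Norm identities for a gate on `q` can then be checked pair by pair. -/
theorem sum_basis_split (q : Qubit d b w) (f : Basis d b w → ℝ) :
    ∑ a, f a = ∑ a, if a q then 0 else f (Function.update a q false) +
      f (Function.update a q true) := by
  have h1 : ∑ a : Basis d b w, (if a q then f a else 0) =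
      ∑ a : Basis d b w, if a q then 0 else f (Function.update a q true) := by
    rw [← Equiv.sum_comp (flipBit q)]
    refine Finset.sum_congr rfl fun a _ => ?_
    by_cases h : a q <;> simp [flipBit, h]
  have h2 : ∑ a, f a = ∑ a : Basis d b w, (if a q then f a else 0) +
      ∑ a : Basis d b w, (if a q then 0 else f (Function.update a q false)) := by
    rw [← Finset.sum_add_distrib]
    refine Finset.sum_congr rfl fun a _ => ?_
    by_cases h : a q
    · simp [h]
    · have : Function.update a q false = a := by
        rw [← Bool.eq_false_iff.2 h, Function.update_eq_self]
      simp [h, this]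
  rw [h2, h1, ← Finset.sum_add_distrib]
  refine Finset.sum_congr rfl fun a _ => ?_
  by_cases h : a q <;> simp [h, add_comm]

theorem normSq_hadGate (q : Qubit d b w) (ψ : QState d b w) : (hadGate q ψ).normSq = ψ.normSq := by
  rw [← NNReal.coe_inj, coe_normSq, coe_normSq, sum_basis_split q,
    sum_basis_split q fun a => ‖ψ a‖ ^ 2]
  refine Finset.sum_congr rfl fun a _ => ?_
  split_ifs
  · rfl
  simp only [hadGate, Function.update_idem, Function.update_self, Bool.false_eq_true, if_false,
    if_true, one_mul, neg_mul, ← sub_eq_add_neg, norm_div, div_pow]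
  have h2 : ‖(Real.sqrt 2 : ℂ)‖ ^ 2 = 2 := by
    rw [Complex.norm_real, Real.norm_eq_abs, sq_abs, Real.sq_sqrt (by norm_num)]
  rw [h2]
  simp only [Complex.sq_norm, Complex.normSq_add, Complex.normSq_sub]
  ring

theorem norm_exp_ofReal_mul_I' (α : ℝ) : ‖Complex.exp (α * Complex.I)‖₊ = 1 := by
  rw [← NNReal.coe_inj]; simp

theorem normSq_phaseGate (q : Qubit d b w) (α : ℝ) (ψ : QState d b w) :
    (phaseGate q α ψ).normSq = ψ.normSq := by
  refine Finset.sum_congr rfl fun a _ => ?_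
  unfold phaseGate
  split_ifs <;> simp

theorem normSq_cphaseGate (q q' : Qubit d b w) (α : ℝ) (ψ : QState d b w) :
    (cphaseGate q q' α ψ).normSq = ψ.normSq := by
  refine Finset.sum_congr rfl fun a _ => ?_
  unfold cphaseGate
  split_ifs <;> simp

theorem gridPoint_xorOutput (o : Fin d → ℝ) (s : ℝ) (v : BitVec w) (a : Basis d b w) :
    gridPoint o s (xorOutput v a) = gridPoint o s a := rfl

theorem xorOutput_xorOutput (v : BitVec w) (a : Basis d b w) :
    xorOutput v (xorOutput v a) = a := by
  funext q
  cases q <;> simp [xorOutput]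

theorem normSq_queryGate (F : Pt d → BitVec w) (o : Fin d → ℝ) (s : ℝ) (ψ : QState d b w) :
    (queryGate F o s ψ).normSq = ψ.normSq := by
  let e : Basis d b w ≃ Basis d b w :=
    { toFun := fun a => xorOutput (F (gridPoint o s a)) a
      invFun := fun a => xorOutput (F (gridPoint o s a)) a
      left_inv := fun a => by simp only [gridPoint_xorOutput, xorOutput_xorOutput]
      right_inv := fun a => by simp only [gridPoint_xorOutput, xorOutput_xorOutput] }
  exact Equiv.sum_comp e fun a => ‖ψ a‖₊ ^ 2

theorem normSq_collapse (q : Qubit d b w) (ψ : QState d b w) :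
    (collapse q false ψ).normSq + (collapse q true ψ).normSq = ψ.normSq := by
  rw [← NNReal.coe_inj, NNReal.coe_add, coe_normSq, coe_normSq, coe_normSq,
    ← Finset.sum_add_distrib, sum_basis_split q fun a => ‖ψ a‖ ^ 2]
  refine Finset.sum_congr rfl fun a _ => ?_
  unfold collapse
  split_ifs <;> simp

theorem normSq_smul (c : ℂ) (ψ : QState d b w) :
    QState.normSq (c • ψ) = ‖c‖₊ ^ 2 * ψ.normSq := by
  simp [QState.normSq, Finset.mul_sum, mul_pow]

theorem normSq_add_le (ψ₁ ψ₂ : QState d b w) :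
    QState.normSq (ψ₁ + ψ₂) ≤ 2 * ψ₁.normSq + 2 * ψ₂.normSq := by
  simp only [QState.normSq, Finset.mul_sum, ← Finset.sum_add_distrib]
  refine Finset.sum_le_sum fun a _ => ?_
  rw [Pi.add_apply]
  refine (pow_le_pow_left' (nnnorm_add_le _ _) 2).trans ?_
  rw [← NNReal.coe_le_coe]
  push_cast
  nlinarith [sq_nonneg (‖ψ₁ a‖ - ‖ψ₂ a‖)]

theorem hadGate_add (q : Qubit d b w) (ψ₁ ψ₂ : QState d b w) :
    hadGate q (ψ₁ + ψ₂) = hadGate q ψ₁ + hadGate q ψ₂ := by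
  funext a; simp only [hadGate, Pi.add_apply]; ring

theorem hadGate_smul (q : Qubit d b w) (c : ℂ) (ψ : QState d b w) :
    hadGate q (c • ψ) = c • hadGate q ψ := by
  funext a; simp only [hadGate, Pi.smul_apply, smul_eq_mul]; ring

theorem phaseGate_add (q : Qubit d b w) (α : ℝ) (ψ₁ ψ₂ : QState d b w) :
    phaseGate q α (ψ₁ + ψ₂) = phaseGate q α ψ₁ + phaseGate q α ψ₂ := by
  funext a; simp only [phaseGate, Pi.add_apply]; split_ifs <;> ring

theorem phaseGate_smul (q : Qubit d b w) (α : ℝ) (c : ℂ) (ψ : QState d b w) :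
    phaseGate q α (c • ψ) = c • phaseGate q α ψ := by
  funext a; simp only [phaseGate, Pi.smul_apply, smul_eq_mul]; split_ifs <;> ring

theorem cphaseGate_add (q q' : Qubit d b w) (α : ℝ) (ψ₁ ψ₂ : QState d b w) :
    cphaseGate q q' α (ψ₁ + ψ₂) = cphaseGate q q' α ψ₁ + cphaseGate q q' α ψ₂ := by
  funext a; simp only [cphaseGate, Pi.add_apply]; split_ifs <;> ring

theorem cphaseGate_smul (q q' : Qubit d b w) (α : ℝ) (c : ℂ) (ψ : QState d b w) :
    cphaseGate q q' α (c • ψ) = c • cphaseGate q q' α ψ := by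
  funext a; simp only [cphaseGate, Pi.smul_apply, smul_eq_mul]; split_ifs <;> ring

theorem collapse_add (q : Qubit d b w) (o : Bool) (ψ₁ ψ₂ : QState d b w) :
    collapse q o (ψ₁ + ψ₂) = collapse q o ψ₁ + collapse q o ψ₂ := by
  funext a; simp only [collapse, Pi.add_apply]; split_ifs <;> simp

theorem collapse_smul (q : Qubit d b w) (o : Bool) (c : ℂ) (ψ : QState d b w) :
    collapse q o (c • ψ) = c • collapse q o ψ := by
  funext a; simp only [collapse, Pi.smul_apply, smul_eq_mul]; split_ifs <;> simp

end Gates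

/-! ### Weakest preexpectations

The state is kept unnormalized, so that the squared norm of a branch is its probability. -/

section Wp

variable {d b w : ℕ}

/-- The configuration after one instruction, if a measurement has the outcome `o`. -/
def Instr.step (F : Pt d → BitVec w) (o : Bool) (c : Config d b w) : Instr d b w → Config d b w
  | .const r v => ⟨Function.update c.reg r v, c.psi⟩
  | .add r s t => ⟨Function.update c.reg r (c.reg s + c.reg t), c.psi⟩
  | .sub r s t => ⟨Function.update c.reg r (c.reg s - c.reg t), c.psi⟩
  | .mul r s t => ⟨Function.update c.reg r (c.reg s * c.reg t), c.psi⟩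
  | .le r s t => ⟨Function.update c.reg r (if c.reg s ≤ c.reg t then 1 else 0), c.psi⟩
  | .had q => ⟨c.reg, hadGate q c.psi⟩
  | .phase q r => ⟨c.reg, phaseGate q (c.reg r) c.psi⟩
  | .cphase q q' r => ⟨c.reg, cphaseGate q q' (c.reg r) c.psi⟩
  | .measure q r => ⟨Function.update c.reg r (if o then 1 else 0), collapse q o c.psi⟩
  | .query r s => ⟨c.reg, queryGate F (fun i => c.reg (r + i)) (c.reg s) c.psi⟩

/-- Is the instruction a measurement? -/
def Instr.isMeasure : Instr d b w → Bool
  | .measure _ _ => true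
  | _ => false

/-- The sum over the branches of one instruction. -/
def Instr.wp (F : Pt d → BitVec w) (i : Instr d b w) (κ : Config d b w → ℝ≥0∞)
    (c : Config d b w) : ℝ≥0∞ :=
  if i.isMeasure then κ (i.step F false c) + κ (i.step F true c) else κ (i.step F false c)

/-- The sum over the branches of a program. -/
def wp (F : Pt d → BitVec w) : List (Instr d b w) → (Config d b w → ℝ≥0∞) →
    Config d b w → ℝ≥0∞
  | [], κ => κ
  | i :: is, κ => i.wp F (wp F is κ)

/-- The contribution of a branch to the expectation of a function of the registers. -/
def weight (φ : (ℕ → ℝ) → ℝ≥0∞) (c : Config d b w) : ℝ≥0∞ := c.psi.normSq * φ c.reg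

variable (F : Pt d → BitVec w)

theorem wp_append (p q : List (Instr d b w)) (κ : Config d b w → ℝ≥0∞) :
    wp F (p ++ q) κ = wp F p (wp F q κ) := by
  induction p with
  | nil => rfl
  | cons i is ih => simp only [List.cons_append, wp, ih]

theorem normSq_step (i : Instr d b w) (c : Config d b w) (h : ¬ i.isMeasure) :
    (i.step F false c).psi.normSq = c.psi.normSq := by
  cases i <;> first
    | exact absurd rfl h
    | simp [Instr.step, normSq_hadGate, normSq_phaseGate, normSq_cphaseGate, normSq_queryGate]

/-- Operational meaning of `wp`. -/
theorem normSq_mul_expect (prog : List (Instr d b w)) (φ : (ℕ → ℝ) → ℝ≥0∞) (c : Config d b w) :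
    c.psi.normSq * expect (execProg F prog c) (fun c => φ c.reg) = wp F prog (weight φ) c := by
  induction prog generalizing c with
  | nil => simp [execProg, expect_pure, wp, weight]
  | cons i is ih =>
    rw [execProg, expect_bind, wp, Instr.wp]
    by_cases hm : i.isMeasure
    · cases i <;> simp only [Instr.isMeasure, Bool.false_eq_true] at hm
      rename_i q r
      simp only [Instr.isMeasure, if_true, ← ih]
      simp only [Instr.exec, expect_map, expect_bool, bornRule, PMF.ofFintype_apply, cond_true,
        cond_false, Instr.step, mul_add, ← mul_assoc]
      have hp : ∀ n0 n1 : ℝ≥0, n0 + n1 = c.psi.normSq → n1 / (n0 + n1) = bornProb q c.psi →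
          (c.psi.normSq : ℝ≥0∞) * (1 - (bornProb q c.psi : ℝ≥0∞)) = n0 ∧
          (c.psi.normSq : ℝ≥0∞) * (bornProb q c.psi : ℝ≥0∞) = n1 := by
        intro n0 n1 h1 h2
        rw [← h2, ← h1]
        -- For the zero state the Born quotient is `0 / 0 = 0`, which is harmless since both
        -- branches have norm `0`.
        have e1 : (n0 + n1) * (n1 / (n0 + n1)) = n1 := by
          rcases eq_or_ne (n0 + n1) 0 with h | h
          · rw [h, zero_mul]; exact (add_eq_zero.1 h).2.symm
          · exact mul_div_cancel₀ _ h
        constructor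
        · have : (n0 + n1) * (1 - n1 / (n0 + n1)) = n0 := by
            rw [mul_tsub, e1, mul_one, add_tsub_cancel_right]
          rw [← ENNReal.coe_one, ← ENNReal.coe_sub, ← ENNReal.coe_mul, this]
        · rw [← ENNReal.coe_mul, e1]
      obtain ⟨h1, h2⟩ := hp _ _ (normSq_collapse q c.psi) rfl
      rw [h1, h2]
    · rw [if_neg hm, ← ih, normSq_step F i c hm]
      cases i <;> first
        | exact absurd rfl hm
        | simp only [Instr.exec, expect_pure, Instr.step]

theorem wp_mono_of_inv (I : Config d b w → Prop) {κ κ' : Config d b w → ℝ≥0∞}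
    (h : ∀ c, I c → κ c ≤ κ' c) (prog : List (Instr d b w))
    (hI : ∀ i ∈ prog, ∀ o c, I c → I (i.step F o c)) {c : Config d b w} (hc : I c) :
    wp F prog κ c ≤ wp F prog κ' c := by
  induction prog generalizing c with
  | nil => exact h c hc
  | cons i is ih =>
    have hs := fun o => hI i (by simp) o c hc
    have hi := fun o => ih (fun j hj => hI j (by simp [hj])) (hs o)
    simp only [wp, Instr.wp]
    split_ifs
    · exact add_le_add (hi _) (hi _)
    · exact hi _

theorem wp_mono {κ κ' : Config d b w → ℝ≥0∞} (h : ∀ c, κ c ≤ κ' c) (prog : List (Instr d b w))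
    (c : Config d b w) : wp F prog κ c ≤ wp F prog κ' c :=
  wp_mono_of_inv F (fun _ => True) (fun c _ => h c) prog (fun _ _ _ _ _ => trivial) trivial

theorem wp_add (κ κ' : Config d b w → ℝ≥0∞) (prog : List (Instr d b w)) (c : Config d b w) :
    wp F prog (fun c => κ c + κ' c) c = wp F prog κ c + wp F prog κ' c := by
  induction prog generalizing c with
  | nil => rfl
  | cons i is ih =>
    simp only [wp, Instr.wp, ih]
    split_ifs
    · ring
    · rfl

theorem wp_const_mul (r : ℝ≥0∞) (κ : Config d b w → ℝ≥0∞) (prog : List (Instr d b w))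
    (c : Config d b w) : wp F prog (fun c => r * κ c) c = r * wp F prog κ c := by
  induction prog generalizing c with
  | nil => rfl
  | cons i is ih =>
    simp only [wp, Instr.wp, ih]
    split_ifs
    · ring
    · rfl

theorem wp_weight_one (prog : List (Instr d b w)) (c : Config d b w) :
    wp F prog (weight fun _ => 1) c = c.psi.normSq := by
  rw [← normSq_mul_expect, expect_const, mul_one]

theorem wp_weight_sum {ι : Type*} (s : Finset ι) (φ : ι → (ℕ → ℝ) → ℝ≥0∞)
    (prog : List (Instr d b w)) (c : Config d b w) :
    wp F prog (weight fun reg => ∑ i ∈ s, φ i reg) c = ∑ i ∈ s, wp F prog (weight (φ i)) c := by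
  classical
  induction s using Finset.induction_on with
  | empty =>
    have := wp_const_mul F 0 (fun _ => 0) prog c
    simp only [zero_mul] at this
    have h0 : (weight fun _ => 0 : Config d b w → ℝ≥0∞) = fun _ => 0 := by
      funext c; simp [weight]
    simpa only [Finset.sum_empty, h0] using this
  | insert a s ha ih =>
    rw [Finset.sum_insert ha, ← ih, ← wp_add]
    congr 1
    funext c
    simp only [weight, Finset.sum_insert ha, mul_add]

/-- Homogeneity in the state. -/
def IsHomogeneous (κ : Config d b w → ℝ≥0∞) : Prop :=
  ∀ reg (z : ℂ) ψ, κ ⟨reg, z • ψ⟩ = (‖z‖₊ ^ 2 : ℝ≥0) * κ ⟨reg, ψ⟩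

theorem isHomogeneous_weight (φ : (ℕ → ℝ) → ℝ≥0∞) :
    IsHomogeneous (weight φ : Config d b w → ℝ≥0∞) := by
  intro reg z ψ
  simp only [weight, normSq_smul, ENNReal.coe_mul, mul_assoc]

theorem Instr.step_smul (i : Instr d b w) (o : Bool) (reg : ℕ → ℝ) (z : ℂ) (ψ : QState d b w) :
    i.step F o ⟨reg, z • ψ⟩ = ⟨(i.step F o ⟨reg, ψ⟩).reg, z • (i.step F o ⟨reg, ψ⟩).psi⟩ := by
  cases i <;>
    simp only [Instr.step, hadGate_smul, phaseGate_smul, cphaseGate_smul, collapse_smul] <;> rfl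

theorem Instr.step_add (i : Instr d b w) (o : Bool) (reg : ℕ → ℝ) (ψ₁ ψ₂ : QState d b w) :
    (i.step F o ⟨reg, ψ₁⟩).reg = (i.step F o ⟨reg, ψ₂⟩).reg ∧
    i.step F o ⟨reg, ψ₁ + ψ₂⟩ =
      ⟨(i.step F o ⟨reg, ψ₁⟩).reg, (i.step F o ⟨reg, ψ₁⟩).psi + (i.step F o ⟨reg, ψ₂⟩).psi⟩ := by
  cases i <;>
    simp only [Instr.step, hadGate_add, phaseGate_add, cphaseGate_add, collapse_add,
      true_and] <;> rfl

/-- All instructions act linearly on the state. Once every qubit has been measured and reset, the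
state is a multiple of `zeroKet`, so homogeneity reduces every later claim to `zeroKet` itself. -/
theorem IsHomogeneous.wp {κ : Config d b w → ℝ≥0∞} (h : IsHomogeneous κ)
    (prog : List (Instr d b w)) : IsHomogeneous (wp F prog κ) := by
  induction prog with
  | nil => exact h
  | cons i is ih =>
    intro reg z ψ
    simp only [_root_.wp, Instr.wp, Instr.step_smul]
    rw [ih, ih]
    split_ifs
    · rw [mul_add]
    · rfl

/-- Each branch is linear in the state and contributes a squared norm, so the factor `2` from
`normSq_add_le` passes through unchanged. This is how the true phase state is replaced by the ideal
one. -/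
theorem wp_weight_add_le (φ : (ℕ → ℝ) → ℝ≥0∞) (prog : List (Instr d b w)) (reg : ℕ → ℝ)
    (ψ₁ ψ₂ : QState d b w) : wp F prog (weight φ) ⟨reg, ψ₁ + ψ₂⟩ ≤
      2 * wp F prog (weight φ) ⟨reg, ψ₁⟩ + 2 * wp F prog (weight φ) ⟨reg, ψ₂⟩ := by
  induction prog generalizing reg ψ₁ ψ₂ with
  | nil =>
    simp only [wp, weight]
    calc ((QState.normSq (ψ₁ + ψ₂) : ℝ≥0) : ℝ≥0∞) * φ reg
        ≤ ((2 * ψ₁.normSq + 2 * ψ₂.normSq : ℝ≥0) : ℝ≥0∞) * φ reg := by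
          gcongr; exact normSq_add_le ψ₁ ψ₂
      _ = _ := by push_cast; ring
  | cons i is ih =>
    have key : ∀ o, wp F is (weight φ) (i.step F o ⟨reg, ψ₁ + ψ₂⟩) ≤
        2 * wp F is (weight φ) (i.step F o ⟨reg, ψ₁⟩) +
        2 * wp F is (weight φ) (i.step F o ⟨reg, ψ₂⟩) := by
      intro o
      obtain ⟨h1, h2⟩ := Instr.step_add F i o reg ψ₁ ψ₂
      rw [h2]
      refine (ih _ _ _).trans (le_of_eq ?_)
      congr 2
      rw [h1]
    simp only [wp, Instr.wp]
    split_ifs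
    · refine (add_le_add (key _) (key _)).trans (le_of_eq ?_)
      ring
    · exact key _

/-- The register that an instruction writes to. -/
def Instr.dest : Instr d b w → Option ℕ
  | .const r _ | .add r _ _ | .sub r _ _ | .mul r _ _ | .le r _ _ | .measure _ r => some r
  | _ => none

theorem Instr.step_reg_of_ne_dest (i : Instr d b w) (o : Bool) (c : Config d b w) {r : ℕ}
    (h : i.dest ≠ some r) : (i.step F o c).reg r = c.reg r := by
  cases i <;> simp only [Instr.dest, ne_eq, Option.some.injEq] at h <;> simp only [Instr.step] <;>
    exact Function.update_of_ne (Ne.symm h) _ _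

/-- A program changes only the registers that it writes to. -/
theorem wp_frame {κ κ' : Config d b w → ℝ≥0∞} (A : Set ℕ) (prog : List (Instr d b w))
    (hA : ∀ i ∈ prog, ∀ r ∈ A, i.dest ≠ some r) {c : Config d b w}
    (h : ∀ c' : Config d b w, (∀ r ∈ A, c'.reg r = c.reg r) → κ c' ≤ κ' c') :
    wp F prog κ c ≤ wp F prog κ' c := by
  refine wp_mono_of_inv F (fun c' => ∀ r ∈ A, c'.reg r = c.reg r) h prog ?_ fun _ _ => rfl
  intro i hi o c' hc' r hr
  rw [i.step_reg_of_ne_dest F o c' (hA i hi r hr), hc' r hr]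

theorem wp_weight_le_of_frame {φ : (ℕ → ℝ) → ℝ≥0∞} (A : Set ℕ) (prog : List (Instr d b w))
    (hA : ∀ i ∈ prog, ∀ r ∈ A, i.dest ≠ some r) {c : Config d b w} {M : ℝ≥0∞}
    (h : ∀ reg : ℕ → ℝ, (∀ r ∈ A, reg r = c.reg r) → φ reg ≤ M) :
    wp F prog (weight φ) c ≤ M * c.psi.normSq := by
  rw [← wp_weight_one F prog c, ← wp_const_mul]
  refine wp_frame F A prog hA fun c' hc' => ?_
  simp only [weight, mul_one]
  rw [mul_comm]
  gcongr
  exact h _ hc'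

end Wp

end

noncomputable section

/-! ### The squared Dirichlet kernel -/

/-- The squared Dirichlet kernel of length `2^n`, normalized to be `1` at `0`. -/
def dirichletSq (n : ℕ) (x : ℝ) : ℝ := ∏ j ∈ Finset.range n, Real.cos (Real.pi * (2 ^ j * x)) ^ 2

theorem dirichletSq_nonneg (n : ℕ) (x : ℝ) : 0 ≤ dirichletSq n x :=
  Finset.prod_nonneg fun _ _ => sq_nonneg _

/-- Repeated use of `sin 2y = 2 sin y cos y`. The product form is what a qubit-by-qubit measurement
produces; the quotient of sines is what decays. -/
theorem dirichletSq_mul_sin (n : ℕ) (x : ℝ) :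
    dirichletSq n x * (2 ^ n * Real.sin (Real.pi * x)) ^ 2 =
      Real.sin (Real.pi * (2 ^ n * x)) ^ 2 := by
  induction n with
  | zero => simp [dirichletSq]
  | succ n ih =>
    have h : Real.pi * (2 ^ (n + 1) * x) = 2 * (Real.pi * (2 ^ n * x)) := by ring
    rw [dirichletSq, Finset.prod_range_succ, h, Real.sin_two_mul, ← dirichletSq]
    linear_combination (4 * Real.cos (Real.pi * (2 ^ n * x)) ^ 2) * ih

theorem dirichletSq_succ (n : ℕ) (x : ℝ) : dirichletSq (n + 1) x =
    dirichletSq n x * Real.cos (Real.pi * (2 ^ n * x)) ^ 2 := Finset.prod_range_succ _ _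

theorem cos_sq_sub_int (θ : ℝ) (k : ℤ) :
    Real.cos (Real.pi * (θ - k)) ^ 2 = Real.cos (Real.pi * θ) ^ 2 := by
  have h : Real.pi * (θ - k) = Real.pi * θ - k * Real.pi := by ring
  rw [h, Real.cos_sub_int_mul_pi, mul_pow, ← zpow_natCast, ← zpow_mul, mul_comm k, zpow_mul]
  norm_num

theorem dirichletSq_sub_int (n : ℕ) (x : ℝ) (k : ℤ) :
    dirichletSq n (x - k) = dirichletSq n x := by
  refine Finset.prod_congr rfl fun j _ => ?_
  have h : (2 : ℝ) ^ j * (x - k) = 2 ^ j * x - ((2 ^ j * k : ℤ) : ℝ) := by push_cast; ring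
  rw [h, cos_sq_sub_int]

theorem dirichletSq_le {n : ℕ} {x : ℝ} (hx : |x| ≤ 1 / 2) (h0 : x ≠ 0) :
    dirichletSq n x ≤ 1 / 4 * ((2 ^ n * |x|) ^ 2)⁻¹ := by
  have hsin : 2 * |x| ≤ |Real.sin (Real.pi * x)| := by
    have h1 := Real.mul_abs_le_abs_sin (x := Real.pi * x) (by
      rw [abs_mul, abs_of_pos Real.pi_pos]; nlinarith [Real.pi_pos])
    rw [abs_mul, abs_of_pos Real.pi_pos] at h1
    have h2 : 2 / Real.pi * (Real.pi * |x|) = 2 * |x| := by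
      field_simp
    linarith
  have h1 := dirichletSq_mul_sin n x
  have h2 : Real.sin (Real.pi * (2 ^ n * x)) ^ 2 ≤ 1 := Real.sin_sq_le_one _
  have hpos : 0 < (2 ^ n * |x|) ^ 2 := by positivity
  have h3 : 4 * (2 ^ n * |x|) ^ 2 ≤ (2 ^ n * Real.sin (Real.pi * x)) ^ 2 := by
    rw [mul_pow, mul_pow, ← sq_abs (Real.sin _)]
    have : (2 * |x|) ^ 2 ≤ |Real.sin (Real.pi * x)| ^ 2 := by gcongr
    nlinarith [pow_pos (show (0 : ℝ) < 2 by norm_num) n, sq_nonneg ((2 : ℝ) ^ n)]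
  have h4 : dirichletSq n x * (4 * (2 ^ n * |x|) ^ 2) ≤ 1 := by
    calc _ ≤ dirichletSq n x * (2 ^ n * Real.sin (Real.pi * x)) ^ 2 := by
          gcongr; exact dirichletSq_nonneg n x
      _ ≤ 1 := by rw [h1]; exact h2
  rw [← div_eq_mul_inv, le_div_iff₀ hpos]
  linarith

/-- Distinct integers from `64` on: the sum is part of the tail of `∑ 1 / m²`, which is at most `2 /
64`. -/
theorem sum_inv_sq_le_of_injOn {ι : Type*} (s : Finset ι) (t : ι → ℕ) (ht : ∀ i ∈ s, 64 ≤ t i)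
    (hinj : Set.InjOn t s) : ∑ i ∈ s, ((t i : ℝ) ^ 2)⁻¹ ≤ 1 / 32 := by
  classical
  rw [← Finset.sum_image (f := fun m : ℕ => ((m : ℝ) ^ 2)⁻¹) hinj]
  have hsub : s.image t ⊆ Finset.Ioo 63 ((s.image t).sup id + 1) := by
    intro m hm
    obtain ⟨i, hi, rfl⟩ := Finset.mem_image.1 hm
    rw [Finset.mem_Ioo]
    have := ht i hi
    have h2 := Finset.le_sup (f := id) hm
    simp only [id] at h2
    omega
  calc _ ≤ ∑ m ∈ Finset.Ioo 63 ((s.image t).sup id + 1), ((m : ℝ) ^ 2)⁻¹ :=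
        Finset.sum_le_sum_of_subset_of_nonneg hsub fun _ _ _ => by positivity
    _ ≤ _ := (sum_Ioo_inv_sq_le 63 _).trans (by norm_num)

/-- Tail bound for phase estimation: the outcome `Y / 2^n` is within `64 / 2^n` of `x` modulo `1`
except with probability `1 / 64`. -/
theorem dirichletSq_tail (n : ℕ) (x : ℝ) (B : Finset ℕ) (hB : B ⊆ Finset.range (2 ^ n))
    (hfar : ∀ Y ∈ B, ∀ k : ℤ, 64 / 2 ^ n < |x - Y / 2 ^ n - k|) :
    ∑ Y ∈ B, dirichletSq n (x - Y / 2 ^ n) ≤ 1 / 64 := by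
  classical
  have hN : (0 : ℝ) < 2 ^ n := by positivity
  set k : ℕ → ℤ := fun Y => round (x - Y / 2 ^ n) with hk
  set u : ℕ → ℝ := fun Y => 2 ^ n * (x - Y / 2 ^ n - k Y) with hu
  have hfl : ∀ Y, ⌊u Y⌋ = ⌊2 ^ n * x⌋ - (Y + 2 ^ n * k Y) := by
    intro Y
    have : u Y = 2 ^ n * x - ((Y + 2 ^ n * k Y : ℤ) : ℝ) := by
      simp only [hu]; push_cast; field_simp; ring
    rw [this, Int.floor_sub_intCast]
  -- The floors differ by integers `Y + 2^n k` that are distinct modulo `2^n`, because `Y < 2^n`.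
  have hinj : Set.InjOn (fun Y => ⌊u Y⌋) B := by
    intro Y hY Y' hY' h
    simp only [hfl] at h
    have h1 := Finset.mem_range.1 (hB hY)
    have h2 := Finset.mem_range.1 (hB hY')
    have h3 : (Y : ℤ) + 2 ^ n * k Y = Y' + 2 ^ n * k Y' := by linarith
    have h4 := congrArg (· % (2 ^ n : ℤ)) h3
    simp only [Int.add_mul_emod_self_left] at h4
    rw [Int.emod_eq_of_lt (by positivity) (by exact_mod_cast h1),
      Int.emod_eq_of_lt (by positivity) (by exact_mod_cast h2)] at h4
    exact_mod_cast h4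
  have habs : ∀ Y ∈ B, 64 < |u Y| := by
    intro Y hY
    have := hfar Y hY (k Y)
    rw [div_lt_iff₀ hN] at this
    simp only [hu, abs_mul, abs_of_pos hN]
    linarith
  have hterm : ∀ Y ∈ B, dirichletSq n (x - Y / 2 ^ n) ≤ 1 / 4 * ((|u Y|) ^ 2)⁻¹ := by
    intro Y hY
    rw [← dirichletSq_sub_int n _ (k Y)]
    have h1 := dirichletSq_le (n := n) (x := x - Y / 2 ^ n - k Y) (abs_sub_round _) (by
      intro h0
      have := habs Y hY
      simp only [hu, h0, mul_zero, abs_zero] at this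
      norm_num at this)
    simpa only [hu, abs_mul, abs_of_pos hN] using h1
  rw [← Finset.sum_filter_add_sum_filter_not B fun Y => 0 ≤ u Y]
  have hpos : ∑ Y ∈ B with 0 ≤ u Y, dirichletSq n (x - Y / 2 ^ n) ≤ 1 / 4 * (1 / 32) := by
    have hge : ∀ Y ∈ B.filter fun Y => 0 ≤ u Y, 64 ≤ ⌊u Y⌋ := by
      intro Y hY
      obtain ⟨h1, h2⟩ := Finset.mem_filter.1 hY
      have := habs Y h1
      rw [abs_of_nonneg h2] at this
      exact Int.le_floor.2 (by push_cast; exact this.le)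
    calc _ ≤ ∑ Y ∈ B with 0 ≤ u Y, 1 / 4 * (((⌊u Y⌋.toNat : ℕ) : ℝ) ^ 2)⁻¹ := by
          refine Finset.sum_le_sum fun Y hY => ?_
          obtain ⟨h1, h2⟩ := Finset.mem_filter.1 hY
          refine (hterm Y h1).trans ?_
          have h3 := hge Y hY
          have h4 : ((⌊u Y⌋.toNat : ℕ) : ℝ) = (⌊u Y⌋ : ℝ) := by
            exact_mod_cast congrArg (Int.cast : ℤ → ℝ) (Int.toNat_of_nonneg (by omega : 0 ≤ ⌊u Y⌋))
          have h5 : (64 : ℝ) ≤ (⌊u Y⌋ : ℝ) := by exact_mod_cast h3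
          rw [h4, abs_of_nonneg h2]
          gcongr
          exact Int.floor_le _
      _ ≤ _ := by
        rw [← Finset.mul_sum]
        gcongr
        refine sum_inv_sq_le_of_injOn _ _ (fun Y hY => by have := hge Y hY; omega) ?_
        intro Y hY Y' hY' h
        have h1 := hge Y hY
        have h2 := hge Y' hY'
        refine hinj (Finset.mem_filter.1 hY).1 (Finset.mem_filter.1 hY').1 ?_
        simp only at h ⊢
        omega
  have hneg : ∑ Y ∈ B with ¬ 0 ≤ u Y, dirichletSq n (x - Y / 2 ^ n) ≤ 1 / 4 * (1 / 32) := by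
    have hge : ∀ Y ∈ B.filter fun Y => ¬ 0 ≤ u Y, ⌊u Y⌋ ≤ -65 := by
      intro Y hY
      obtain ⟨h1, h2⟩ := Finset.mem_filter.1 hY
      have := habs Y h1
      rw [abs_of_neg (not_le.1 h2)] at this
      have h3 : ⌊u Y⌋ < -64 := Int.floor_lt.2 (by push_cast; linarith)
      omega
    -- On the negative side `|u| > -⌊u⌋ - 1`, and `|u| > 64` makes this integer at least `64`. Each
    -- sign contributes `1/4 · 1/32`.
    calc _ ≤ ∑ Y ∈ B with ¬ 0 ≤ u Y, 1 / 4 * ((((-⌊u Y⌋ - 1).toNat : ℕ) : ℝ) ^ 2)⁻¹ := by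
          refine Finset.sum_le_sum fun Y hY => ?_
          obtain ⟨h1, h2⟩ := Finset.mem_filter.1 hY
          refine (hterm Y h1).trans ?_
          have h3 := hge Y hY
          have h4 : (((-⌊u Y⌋ - 1).toNat : ℕ) : ℝ) = -(⌊u Y⌋ : ℝ) - 1 := by
            exact_mod_cast congrArg (Int.cast : ℤ → ℝ)
              (Int.toNat_of_nonneg (by omega : 0 ≤ -⌊u Y⌋ - 1))
          have h5 : (⌊u Y⌋ : ℝ) ≤ -65 := by exact_mod_cast h3
          rw [h4, abs_of_neg (not_le.1 h2)]
          gcongr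
          · nlinarith
          · linarith
          · have := Int.lt_floor_add_one (u Y); linarith
      _ ≤ _ := by
        rw [← Finset.mul_sum]
        gcongr
        refine sum_inv_sq_le_of_injOn _ _ (fun Y hY => by have := hge Y hY; omega) ?_
        intro Y hY Y' hY' h
        have h1 := hge Y hY
        have h2 := hge Y' hY'
        refine hinj (Finset.mem_filter.1 hY).1 (Finset.mem_filter.1 hY').1 ?_
        simp only at h ⊢
        omega
  linarith

theorem sum_range_two_mul {M : Type*} [AddCommMonoid M] (f : ℕ → M) (n : ℕ) :
    ∑ i ∈ Finset.range (2 * n), f i = ∑ i ∈ Finset.range n, (f (2 * i) + f (2 * i + 1)) := by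
  induction n with
  | zero => simp
  | succ n ih =>
    rw [Nat.mul_succ, Finset.sum_range_succ, Finset.sum_range_succ, ih, Finset.sum_range_succ,
      add_assoc]

/-! ### Reachable configurations -/

section Reach

variable {d b w : ℕ} (F : Pt d → BitVec w)

/-- `c'` is reached from `c` for some outcomes of the measurements. -/
def Reach : List (Instr d b w) → Config d b w → Config d b w → Prop
  | [], c, c' => c' = c
  | i :: is, c, c' => ∃ o, Reach is (i.step F o c) c'

theorem Reach.append_iff {p q : List (Instr d b w)} {c c'' : Config d b w} :
    Reach F (p ++ q) c c'' ↔ ∃ c', Reach F p c c' ∧ Reach F q c' c'' := by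
  induction p generalizing c with
  | nil => simp [Reach]
  | cons i is ih =>
    simp only [List.cons_append, Reach, ih]
    exact ⟨fun ⟨o, c', h⟩ => ⟨c', ⟨o, h.1⟩, h.2⟩, fun ⟨c', ⟨o, h1⟩, h2⟩ => ⟨o, c', h1, h2⟩⟩

theorem wp_mono_of_reach {κ κ' : Config d b w → ℝ≥0∞} {prog : List (Instr d b w)}
    {c : Config d b w} (h : ∀ c', Reach F prog c c' → κ c' ≤ κ' c') :
    wp F prog κ c ≤ wp F prog κ' c := by
  induction prog generalizing c with
  | nil => exact h c rfl
  | cons i is ih =>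
    have hi := fun o => ih (c := i.step F o c) fun c' hc' => h c' ⟨o, hc'⟩
    simp only [wp, Instr.wp]
    split_ifs
    · exact add_le_add (hi _) (hi _)
    · exact hi _

theorem Reach.inv (I : Config d b w → Prop) {prog : List (Instr d b w)}
    (hI : ∀ i ∈ prog, ∀ o c, I c → I (i.step F o c)) {c c' : Config d b w}
    (h : Reach F prog c c') (hc : I c) : I c' := by
  induction prog generalizing c with
  | nil => rw [show c' = c from h]; exact hc
  | cons i is ih =>
    obtain ⟨o, ho⟩ := h
    exact ih (fun j hj => hI j (by simp [hj])) ho (hI i (by simp) o c hc)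

theorem Reach.reg_eq {prog : List (Instr d b w)} {r : ℕ} (hr : ∀ i ∈ prog, i.dest ≠ some r)
    {c c' : Config d b w} (h : Reach F prog c c') : c'.reg r = c.reg r :=
  Reach.inv F (fun c' => c'.reg r = c.reg r)
    (fun i hi o c' hc' => by rw [i.step_reg_of_ne_dest F o c' (hr i hi), hc']) h rfl

end Reach
end

noncomputable section

/-! ### Semiclassical Fourier transform -/

section Measure

variable {d b w : ℕ} (F : Pt d → BitVec w)

/-- The qubit `q` is in the state `(|0⟩ + exp(iβ)|1⟩)/√2` and not entangled with the others. -/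
def HasPhase (q : Qubit d b w) (β : ℝ) (ψ : QState d b w) : Prop :=
  ∀ a, ψ (Function.update a q true) =
    Complex.exp (β * Complex.I) * ψ (Function.update a q false)

/-- The qubit `q` is in the state `|0⟩`. -/
def ZeroOn (q : Qubit d b w) (ψ : QState d b w) : Prop := ∀ a, a q = true → ψ a = 0

theorem HasPhase.hadGate {q q' : Qubit d b w} (hq : q' ≠ q) {β : ℝ} {ψ : QState d b w}
    (h : HasPhase q β ψ) : HasPhase q β (hadGate q' ψ) := by
  intro a
  simp only [_root_.hadGate, Function.update_of_ne hq, Function.update_comm hq.symm, h _]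
  ring

theorem HasPhase.phaseGate {q q' : Qubit d b w} (hq : q' ≠ q) {β α : ℝ} {ψ : QState d b w}
    (h : HasPhase q β ψ) : HasPhase q β (phaseGate q' α ψ) := by
  intro a
  simp only [_root_.phaseGate, Function.update_of_ne hq, h _]
  split_ifs <;> ring

theorem HasPhase.collapse {q q' : Qubit d b w} (hq : q' ≠ q) {β : ℝ} {o : Bool}
    {ψ : QState d b w} (h : HasPhase q β ψ) : HasPhase q β (collapse q' o ψ) := by
  intro a
  simp only [_root_.collapse, Function.update_of_ne hq, Function.update_comm hq.symm, h _]
  split_ifs <;> ring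

theorem HasPhase.smul {q : Qubit d b w} {β : ℝ} {ψ : QState d b w} (h : HasPhase q β ψ) (z : ℂ) :
    HasPhase q β (z • ψ) := by
  intro a
  simp only [Pi.smul_apply, smul_eq_mul, h a]
  ring

theorem ZeroOn.hadGate {q q' : Qubit d b w} (hq : q' ≠ q) {ψ : QState d b w}
    (h : ZeroOn q ψ) : ZeroOn q (hadGate q' ψ) := by
  intro a ha
  simp only [_root_.hadGate]
  rw [h _ (by rwa [Function.update_of_ne hq.symm]), h _ (by rwa [Function.update_of_ne hq.symm])]
  simp

theorem ZeroOn.phaseGate {q q' : Qubit d b w} {α : ℝ} {ψ : QState d b w}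
    (h : ZeroOn q ψ) : ZeroOn q (phaseGate q' α ψ) := by
  intro a ha
  simp [_root_.phaseGate, h a ha]

theorem zeroOn_collapse (q : Qubit d b w) (o : Bool) (ψ : QState d b w) :
    ZeroOn q (collapse q o ψ) := by
  intro a ha
  simp [collapse, ha]

theorem ZeroOn.collapse {q q' : Qubit d b w} (hq : q' ≠ q) {o : Bool} {ψ : QState d b w}
    (h : ZeroOn q ψ) : ZeroOn q (collapse q' o ψ) := by
  intro a ha
  simp only [_root_.collapse]
  rw [h _ (by rwa [Function.update_of_ne hq.symm])]
  simp

theorem nnnorm_half_one_add_exp (γ : ℝ) (o : Bool) :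
    ‖(1 + (if o then -1 else 1) * Complex.exp (γ * Complex.I)) / 2‖₊ ^ 2 =
      (Real.cos ((γ - Real.pi * (if o then 1 else 0)) / 2) ^ 2).toNNReal := by
  rw [← NNReal.coe_inj, Real.coe_toNNReal _ (sq_nonneg _)]
  push_cast
  rw [Complex.sq_norm, Real.cos_sq]
  have h : 2 * ((γ - Real.pi * (if o then 1 else 0)) / 2) =
      γ - Real.pi * (if o then 1 else 0) := by ring
  rw [h, Complex.normSq_div, Complex.exp_mul_I, ← Complex.ofReal_cos, ← Complex.ofReal_sin]
  have h4 : Complex.normSq 2 = 4 := by norm_num [Complex.normSq_apply]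
  rw [h4]
  have hcs := Real.sin_sq_add_cos_sq γ
  cases o
  · simp [Complex.normSq_apply, -Complex.ofReal_cos, -Complex.ofReal_sin]
    linear_combination hcs / 4
  · simp [Complex.normSq_apply, Real.cos_sub_pi, -Complex.ofReal_cos, -Complex.ofReal_sin]
    linear_combination hcs / 4

/-- A qubit with a definite phase is unentangled, so measuring it only multiplies the rest of the
state by a scalar. Together with `nnnorm_half_one_add_exp` the probability of an outcome is a
squared cosine. -/
theorem collapse_hadGate_phaseGate {q : Qubit d b w} {α β : ℝ} {ψ : QState d b w}
    (h : HasPhase q β ψ) (o : Bool) :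
    collapse q o (hadGate q (phaseGate q α ψ)) =
      ((1 + (if o then -1 else 1) * Complex.exp ((α + β : ℝ) * Complex.I)) / 2) •
        ((Real.sqrt 2 : ℂ) • collapse q false ψ) := by
  funext a
  simp only [collapse, hadGate, phaseGate, Pi.smul_apply, smul_eq_mul, Function.update_self,
    Function.update_idem, Bool.false_eq_true, if_false, if_true]
  have hs : (Real.sqrt 2 : ℂ) * (Real.sqrt 2 : ℂ) = 2 := by
    rw [← Complex.ofReal_mul, Real.mul_self_sqrt (by norm_num)]; norm_num
  have hs0 : (Real.sqrt 2 : ℂ) ≠ 0 := by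
    intro h0; rw [h0] at hs; norm_num at hs
  by_cases ha : a q
  · simp [ha]
  · rw [if_neg ha, if_neg ha, h a, div_eq_iff hs0]
    push_cast
    rw [add_mul, Complex.exp_add]
    cases o
    · simp only [Bool.false_eq_true, if_false]
      linear_combination (-(1 / 2) * ψ (Function.update a q false) * (1 +
        (Complex.exp (α * Complex.I) * Complex.exp (β * Complex.I)))) * hs
    · simp only [if_true]
      linear_combination (-(1 / 2) * ψ (Function.update a q false) * (1 -
        (Complex.exp (α * Complex.I) * Complex.exp (β * Complex.I)))) * hs

theorem normSq_sqrt_two_smul_collapse {q : Qubit d b w} {β : ℝ} {ψ : QState d b w}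
    (h : HasPhase q β ψ) :
    QState.normSq ((Real.sqrt 2 : ℂ) • collapse q false ψ) = ψ.normSq := by
  have h1 : collapse q true ψ = Complex.exp (β * Complex.I) • collapse q false ψ := by
    funext a
    simp only [collapse, Pi.smul_apply, smul_eq_mul, h a]
    split_ifs <;> simp
  have h2 := normSq_collapse q ψ
  rw [h1, normSq_smul, norm_exp_ofReal_mul_I'] at h2
  have h3 : ‖(Real.sqrt 2 : ℂ)‖₊ ^ 2 = 2 := by
    rw [← NNReal.coe_inj]
    push_cast
    rw [Complex.norm_real, Real.norm_eq_abs, sq_abs, Real.sq_sqrt (by norm_num)]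
  rw [normSq_smul, h3, ← h2]
  ring

/-- Measure the qubit `q` in the basis rotated by the angle in the register `V`, and update `V`;
`t` and `t + 1` are auxiliary registers. -/
def stage (q : Qubit d b w) (V t : ℕ) : List (Instr d b w) :=
  [.phase q V, .had q, .measure q t, .const (t + 1) Real.pi, .mul t t (t + 1), .sub V V t,
    .const (t + 1) (1 / 2), .mul V V (t + 1)]

/-- Registers after a `stage` with outcome `o`. -/
def stageReg (V t : ℕ) (reg : ℕ → ℝ) (o : Bool) : ℕ → ℝ :=
  ((Instr.mul V V (t + 1) : Instr 0 0 0).step (fun _ => 0) o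
    ((Instr.const (t + 1) (1 / 2) : Instr 0 0 0).step (fun _ => 0) o
    ((Instr.sub V V t : Instr 0 0 0).step (fun _ => 0) o
    ((Instr.mul t t (t + 1) : Instr 0 0 0).step (fun _ => 0) o
    ((Instr.const (t + 1) Real.pi : Instr 0 0 0).step (fun _ => 0) o
    ⟨Function.update reg t (if o then 1 else 0), 0⟩))))).reg

theorem stageReg_self {V t : ℕ} (h1 : V ≠ t) (h2 : V ≠ t + 1) (reg : ℕ → ℝ) (o : Bool) :
    stageReg V t reg o V = (reg V - Real.pi * (if o then 1 else 0)) / 2 := by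
  simp [stageReg, Instr.step, h1, h2]
  split_ifs <;> ring

theorem wp_stage (q : Qubit d b w) (V t : ℕ) (κ : Config d b w → ℝ≥0∞) (reg : ℕ → ℝ)
    (ψ : QState d b w) : wp F (stage q V t) κ ⟨reg, ψ⟩ =
      κ ⟨stageReg V t reg false, collapse q false (hadGate q (phaseGate q (reg V) ψ))⟩ +
      κ ⟨stageReg V t reg true, collapse q true (hadGate q (phaseGate q (reg V) ψ))⟩ := by
  simp [stage, wp, Instr.wp, Instr.isMeasure, Instr.step, stageReg]

theorem reach_stage {q : Qubit d b w} {V t : ℕ} {c c' : Config d b w}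
    (h : Reach F (stage q V t) c c') :
    ∃ o, c'.psi = collapse q o (hadGate q (phaseGate q (c.reg V) c.psi)) := by
  simp only [stage, Reach, Instr.step] at h
  obtain ⟨-, -, o, -, -, -, -, -, rfl⟩ := h
  exact ⟨o, rfl⟩

/-- Measure the lowest `n` qubits of the coordinate `i`, highest first. -/
def stages (i : Fin d) (V t : ℕ) : (n : ℕ) → n ≤ b → List (Instr d b w)
  | 0, _ => []
  | n + 1, h => stage (Sum.inl (i, ⟨n, h⟩)) V t ++ stages i V t n (Nat.le_of_succ_le h)

/-- The register holds `-2π u`, where `u` encodes the bits found so far. The highest qubit has phase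
`2π 2^n x`, whose measurement reveals the lowest bit of `Y`; the correction by `u` removes it from
the next phase. Every stage contributes one cosine, and the product over stages is the Dirichlet
kernel. -/
theorem wp_stages (i : Fin d) {V t : ℕ} (h1 : V ≠ t) (h2 : V ≠ t + 1) (g : ℝ → ℝ≥0∞) (x : ℝ)
    (n : ℕ) (hn : n ≤ b) (u : ℝ) (reg : ℕ → ℝ) (ψ : QState d b w)
    (hu : reg V = -(2 * Real.pi * u))
    (hψ : ∀ j : Fin b, (j : ℕ) < n → HasPhase (Sum.inl (i, j)) (2 * Real.pi * (2 ^ (j : ℕ) * x)) ψ) :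
    wp F (stages i V t n hn) (weight fun reg => g (reg V)) ⟨reg, ψ⟩ =
      ψ.normSq * ∑ Y ∈ Finset.range (2 ^ n),
        ENNReal.ofReal (dirichletSq n (x - (2 * u + Y) / 2 ^ n)) *
          g (-(Real.pi * ((2 * u + Y) / 2 ^ n))) := by
  induction n generalizing u reg ψ with
  | zero =>
    simp only [stages, wp, weight, hu, pow_zero, Finset.range_one, Finset.sum_singleton,
      dirichletSq, Finset.range_zero, Finset.prod_empty, ENNReal.ofReal_one, one_mul,
      Nat.cast_zero]
    congr 3
    ring
  | succ n ih =>
    have hq := hψ ⟨n, hn⟩ (Nat.lt_succ_self n)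
    have hom := (isHomogeneous_weight (d := d) (b := b) (w := w) fun reg => g (reg V)).wp F
      (stages i V t n (Nat.le_of_succ_le hn))
    set χ : QState d b w := (Real.sqrt 2 : ℂ) • collapse (Sum.inl (i, ⟨n, hn⟩)) false ψ with hχ
    have hχψ : χ.normSq = ψ.normSq := normSq_sqrt_two_smul_collapse hq
    have hχp : ∀ j : Fin b, (j : ℕ) < n →
        HasPhase (Sum.inl (i, j)) (2 * Real.pi * (2 ^ (j : ℕ) * x)) χ := by
      intro j hj
      refine ((hψ j (by omega)).collapse ?_).smul _
      intro h
      have := congrArg Fin.val (Prod.mk.inj (Sum.inl.inj h)).2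
      simp only at this
      omega
    have key : ∀ o : Bool, wp F (stages i V t n (Nat.le_of_succ_le hn))
        (weight fun reg => g (reg V)) ⟨stageReg V t reg o, collapse (Sum.inl (i, ⟨n, hn⟩)) o
          (hadGate (Sum.inl (i, ⟨n, hn⟩)) (phaseGate (Sum.inl (i, ⟨n, hn⟩)) (reg V) ψ))⟩ =
        ψ.normSq * ∑ Y ∈ Finset.range (2 ^ n), ENNReal.ofReal (dirichletSq (n + 1)
            (x - (2 * u + ((2 * Y + (if o then 1 else 0) : ℕ) : ℝ)) / 2 ^ (n + 1))) *
          g (-(Real.pi * ((2 * u + ((2 * Y + (if o then 1 else 0) : ℕ) : ℝ)) / 2 ^ (n + 1)))) := by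
      intro o
      rw [collapse_hadGate_phaseGate hq o, hom, ih _ ((u + (if o then 1 else 0) / 2) / 2) _ _
        (by rw [stageReg_self h1 h2, hu]; split_ifs <;> ring) hχp, hχψ, mul_left_comm,
        nnnorm_half_one_add_exp, Finset.mul_sum]
      congr 1
      refine Finset.sum_congr rfl fun Y _ => ?_
      have e : (2 * ((u + (if o then 1 else 0) / 2) / 2) + Y) / 2 ^ n =
          (2 * u + ((2 * Y + (if o then 1 else 0) : ℕ) : ℝ)) / 2 ^ (n + 1) := by
        rw [pow_succ]; push_cast; field_simp; split_ifs <;> ring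
      rw [e, ← mul_assoc]
      congr 1
      rw [dirichletSq_succ, mul_comm,
        ENNReal.ofReal_mul (dirichletSq_nonneg _ _)]
      congr 1
      rw [ENNReal.ofReal]
      congr 2
      -- The angle of this stage and the factor of the kernel differ by the bits still to be found,
      -- a multiple `Y` of `π`, which the square does not see.
      rw [← cos_sq_sub_int _ (-(Y : ℤ))]
      congr 2
      rw [hu, ← e]
      push_cast
      field_simp
      split_ifs <;> ring
    rw [stages, wp_append, wp_stage, key, key, ← mul_add, ← Finset.sum_add_distrib,
      show Finset.range (2 ^ (n + 1)) = Finset.range (2 * 2 ^ n) by rw [pow_succ, mul_comm],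
      sum_range_two_mul]
    simp

theorem reach_stages {i : Fin d} {V t : ℕ} {n : ℕ} {hn : n ≤ b} {c c' : Config d b w}
    (h : Reach F (stages i V t n hn) c c') {q : Qubit d b w}
    (hq : ZeroOn q c.psi ∨ ∃ j : Fin b, (j : ℕ) < n ∧ q = Sum.inl (i, j)) : ZeroOn q c'.psi := by
  induction n generalizing c with
  | zero =>
    rw [show c' = c from h]
    rcases hq with h | ⟨j, hj, -⟩
    · exact h
    · omega
  | succ n ih =>
    obtain ⟨c1, h1, h2⟩ := (Reach.append_iff F).1 h
    obtain ⟨o, ho⟩ := reach_stage F h1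
    refine ih h2 ?_
    rw [ho]
    by_cases hqq : q = Sum.inl (i, ⟨n, hn⟩)
    · left; rw [hqq]; exact zeroOn_collapse _ _ _
    · rcases hq with h | ⟨j, hj, rfl⟩
      · left
        exact ((h.phaseGate).hadGate (Ne.symm hqq)).collapse (Ne.symm hqq)
      · right
        refine ⟨j, ?_, rfl⟩
        rcases Nat.lt_succ_iff_lt_or_eq.1 hj with h | h
        · exact h
        · exact absurd (by simp [← h]) hqq

end Measure
end

noncomputable section

/-! ### Reading one slope, and then all slopes, from the phases. -/

section Coordinate

variable {d b w : ℕ} (F : Pt d → BitVec w)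

/-- Turn the angle `-π Y / 2^b` in the register `V` into the estimate `8 G Y / 2^b` of a slope, where
`Y / 2^b` is understood modulo `1` and in `[-1/2, 1/2)`. -/
def decode (G : ℝ) (V t : ℕ) : List (Instr d b w) :=
  [.const t (-(Real.pi / 2)), .le t V t, .const (t + 1) Real.pi, .mul t t (t + 1), .add V V t,
    .const (t + 1) (-(8 * G / Real.pi)), .mul V V (t + 1)]

/-- The effect of `decode` on the register `V`. -/
def decodeVal (G A : ℝ) : ℝ :=
  (A + (if A ≤ -(Real.pi / 2) then 1 else 0) * Real.pi) * -(8 * G / Real.pi)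

theorem wp_decode (G : ℝ) {V t : ℕ} (h1 : V ≠ t) (h2 : V ≠ t + 1) (g : ℝ → ℝ≥0∞)
    (c : Config d b w) : wp F (decode G V t) (weight fun reg => g (reg V)) c =
      weight (fun reg => g (decodeVal G (reg V))) c := by
  simp [decode, wp, Instr.wp, Instr.isMeasure, Instr.step, weight, decodeVal, h1, h2]

/-- With `|x|` and `δ` at most `1/8`, the value `y` is within `1/4` of an integer, so `k` is `0` or
`-1` according to whether `y` is below or above `1/2`. This is the test made by `decode`. -/
theorem abs_decodeVal_sub_le {G x y δ : ℝ} (hG : 0 ≤ G) (hx : |x| ≤ 1 / 8) (hy0 : 0 ≤ y)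
    (hy1 : y < 1) (hδ : δ ≤ 1 / 8) (k : ℤ) (hk : |x - y - k| ≤ δ) :
    |decodeVal G (-(Real.pi * y)) - 8 * G * x| ≤ 8 * G * δ := by
  have hπ := Real.pi_pos
  obtain ⟨a1, a2⟩ := abs_le.1 hx
  obtain ⟨b1, b2⟩ := abs_le.1 hk
  have hcond : (-(Real.pi * y) ≤ -(Real.pi / 2)) ↔ 1 / 2 ≤ y := by
    rw [neg_le_neg_iff]
    constructor
    · intro h; nlinarith
    · intro h; nlinarith
  have hk1 : -2 < k := by
    have : (-2 : ℝ) < k := by linarith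
    exact_mod_cast this
  have hk2 : k < 1 := by
    have : (k : ℝ) < 1 := by linarith
    exact_mod_cast this
  have hval : decodeVal G (-(Real.pi * y)) - 8 * G * x = -(8 * G * (x - y - k)) := by
    unfold decodeVal
    obtain rfl | rfl : k = -1 ∨ k = 0 := by omega
    · rw [if_pos (hcond.2 (by push_cast at b2; linarith))]
      push_cast
      field_simp
      ring
    · rw [if_neg (fun h => by have := hcond.1 h; push_cast at b1; linarith)]
      push_cast
      field_simp
      ring
  rw [hval, abs_neg, abs_mul, abs_of_nonneg (by positivity)]
  gcongr

/-- Estimate the slope of the phase in the coordinate `i`, with result in the register `V`. -/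
def measCoord (G : ℝ) (i : Fin d) (V t : ℕ) : List (Instr d b w) :=
  .const V 0 :: (stages i V t b le_rfl ++ decode G V t)

/-- The error `64 / 2^b` of phase estimation, times the scale `8 G`, is `512 G / 2^b`. The
assumption on `b` makes `64 / 2^b ≤ 1/8`, as needed to decode without wrapping. -/
theorem wp_measCoord_le {G : ℝ} (hG : 0 ≤ G) (i : Fin d) {V t : ℕ} (h1 : V ≠ t) (h2 : V ≠ t + 1)
    (hb : (512 : ℝ) ≤ 2 ^ b) {x : ℝ} (hx : |x| ≤ 1 / 8) (c : Config d b w)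
    (hψ : ∀ j : Fin b, HasPhase (Sum.inl (i, j)) (2 * Real.pi * (2 ^ (j : ℕ) * x)) c.psi) :
    wp F (measCoord G i V t) (weight fun reg =>
      if |reg V - 8 * G * x| ≤ 512 * G / 2 ^ b then 0 else 1) c ≤ 1 / 64 * c.psi.normSq := by
  classical
  have hN : (0 : ℝ) < 2 ^ b := by positivity
  set g : ℝ → ℝ≥0∞ := fun v => if |v - 8 * G * x| ≤ 512 * G / 2 ^ b then 0 else 1 with hg
  have e1 : wp F (decode G V t) (weight fun reg => g (reg V)) =
      (weight fun reg => g (decodeVal G (reg V)) : Config d b w → ℝ≥0∞) :=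
    funext fun c => wp_decode F G h1 h2 g c
  rw [measCoord, wp, wp_append, e1, Instr.wp]
  simp only [Instr.isMeasure, Bool.false_eq_true, if_false, Instr.step]
  rw [wp_stages F i h1 h2 (fun v => g (decodeVal G v)) x b le_rfl 0 _ _ (by simp)
    fun j _ => hψ j, mul_comm]
  gcongr
  simp only [mul_zero, zero_add]
  set B := (Finset.range (2 ^ b)).filter fun Y =>
    ∀ k : ℤ, 64 / 2 ^ b < |x - (Y : ℕ) / 2 ^ b - k| with hB
  have hle : ∀ Y ∈ Finset.range (2 ^ b),
      ENNReal.ofReal (dirichletSq b (x - Y / 2 ^ b)) *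
        g (decodeVal G (-(Real.pi * (Y / 2 ^ b)))) ≤
      if (∀ k : ℤ, 64 / 2 ^ b < |x - Y / 2 ^ b - k|) then
        ENNReal.ofReal (dirichletSq b (x - Y / 2 ^ b)) else 0 := by
    intro Y hY
    split_ifs with hfar
    · refine mul_le_of_le_one_right' ?_
      simp only [hg]
      split_ifs <;> simp
    · push Not at hfar
      obtain ⟨k, hk⟩ := hfar
      have hY1 : (Y : ℝ) < 2 ^ b := by exact_mod_cast Finset.mem_range.1 hY
      have := abs_decodeVal_sub_le hG hx (y := Y / 2 ^ b) (by positivity)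
        ((div_lt_one hN).2 hY1) (by rw [div_le_iff₀ hN]; linarith) k hk
      have h3 : 8 * G * (64 / 2 ^ b) = 512 * G / 2 ^ b := by ring
      rw [h3] at this
      simp [hg, this]
  refine (Finset.sum_le_sum hle).trans ?_
  rw [← Finset.sum_filter, ← hB, ← ENNReal.ofReal_sum_of_nonneg fun _ _ => dirichletSq_nonneg _ _]
  have h4 := dirichletSq_tail b x B (Finset.filter_subset _ _) fun Y hY k =>
    (Finset.mem_filter.1 hY).2 k
  refine (ENNReal.ofReal_le_ofReal h4).trans (le_of_eq ?_)
  rw [ENNReal.ofReal_div_of_pos (by norm_num)]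
  norm_num

theorem mem_stages {i : Fin d} {V t n : ℕ} {hn : n ≤ b} {x : Instr d b w}
    (h : x ∈ stages i V t n hn) : ∃ j, x ∈ stage (Sum.inl (i, j) : Qubit d b w) V t := by
  induction n with
  | zero => simp [stages] at h
  | succ n ih =>
    rw [stages, List.mem_append] at h
    rcases h with h | h
    · exact ⟨_, h⟩
    · exact ih h

theorem mem_measCoord {G : ℝ} {i : Fin d} {V t : ℕ} {x : Instr d b w}
    (h : x ∈ measCoord G i V t) : x = .const V 0 ∨
      (∃ j, x ∈ stage (Sum.inl (i, j) : Qubit d b w) V t) ∨ x ∈ decode G V t := by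
  rw [measCoord, List.mem_cons, List.mem_append] at h
  rcases h with h | h | h
  · exact Or.inl h
  · exact Or.inr (Or.inl (mem_stages h))
  · exact Or.inr (Or.inr h)

theorem dest_measCoord {G : ℝ} {i : Fin d} {V t : ℕ} {x : Instr d b w}
    (h : x ∈ measCoord G i V t) {r : ℕ} (h1 : r ≠ V) (h2 : r ≠ t) (h3 : r ≠ t + 1) :
    x.dest ≠ some r := by
  rcases mem_measCoord h with rfl | ⟨j, h⟩ | h
  · simpa [Instr.dest] using h1.symm
  · simp only [stage, List.mem_cons, List.not_mem_nil, or_false] at h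
    rcases h with rfl | rfl | rfl | rfl | rfl | rfl | rfl | rfl <;>
      simp [Instr.dest, h1.symm, h2.symm, h3.symm]
  · simp only [decode, List.mem_cons, List.not_mem_nil, or_false] at h
    rcases h with rfl | rfl | rfl | rfl | rfl | rfl | rfl <;>
      simp [Instr.dest, h1.symm, h2.symm, h3.symm]

theorem hasPhase_step_measCoord {G : ℝ} {i i' : Fin d} (hi : i' ≠ i) {V t : ℕ} {x : Instr d b w}
    (h : x ∈ measCoord G i' V t) {j : Fin b} {β : ℝ} (o : Bool) {c : Config d b w}
    (hc : HasPhase (Sum.inl (i, j)) β c.psi) : HasPhase (Sum.inl (i, j)) β (x.step F o c).psi := by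
  rcases mem_measCoord h with rfl | ⟨j', h⟩ | h
  · exact hc
  · have hq : (Sum.inl (i', j') : Qubit d b w) ≠ Sum.inl (i, j) := by
      intro h; exact hi (Prod.mk.inj (Sum.inl.inj h)).1
    simp only [stage, List.mem_cons, List.not_mem_nil, or_false] at h
    rcases h with rfl | rfl | rfl | rfl | rfl | rfl | rfl | rfl <;> simp only [Instr.step] <;>
      first
      | exact hc
      | exact hc.phaseGate hq
      | exact hc.hadGate hq
      | exact hc.collapse hq
  · simp only [decode, List.mem_cons, List.not_mem_nil, or_false] at h
    rcases h with rfl | rfl | rfl | rfl | rfl | rfl | rfl <;> exact hc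

theorem reach_measCoord {G : ℝ} {i : Fin d} {V t : ℕ} {c c' : Config d b w}
    (h : Reach F (measCoord G i V t) c c') {q : Qubit d b w}
    (hq : ZeroOn q c.psi ∨ ∃ j : Fin b, q = Sum.inl (i, j)) : ZeroOn q c'.psi := by
  obtain ⟨o, h⟩ := h
  obtain ⟨c1, h1, h2⟩ := (Reach.append_iff F).1 h
  have h3 : ZeroOn q c1.psi := by
    refine reach_stages F h1 ?_
    rcases hq with h | ⟨j, rfl⟩
    · exact Or.inl h
    · exact Or.inr ⟨j, j.2, rfl⟩
  refine Reach.inv F (fun c => ZeroOn q c.psi) ?_ h2 h3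
  intro x hx o c hc
  simp only [decode, List.mem_cons, List.not_mem_nil, or_false] at hx
  rcases hx with rfl | rfl | rfl | rfl | rfl | rfl | rfl <;> exact hc

/-- Estimate the slopes in the coordinates of a list; the result for the coordinate `i` goes to the
register `V + i`. -/
def measList (G : ℝ) (V t : ℕ) (l : List (Fin d)) : List (Instr d b w) :=
  l.flatMap fun i => measCoord G i (V + i) t

theorem dest_measList {G : ℝ} {V t : ℕ} {l : List (Fin d)} {x : Instr d b w}
    (h : x ∈ measList G V t l) {r : ℕ} (h1 : ∀ i ∈ l, r ≠ V + i) (h2 : r ≠ t) (h3 : r ≠ t + 1) :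
    x.dest ≠ some r := by
  obtain ⟨i, hi, hx⟩ := List.mem_flatMap.1 h
  exact dest_measCoord hx (h1 i hi) h2 h3

theorem reach_measList {G : ℝ} {V t : ℕ} {l : List (Fin d)} {c c' : Config d b w}
    (h : Reach F (measList G V t l) c c') {q : Qubit d b w}
    (hq : ZeroOn q c.psi ∨ ∃ i ∈ l, ∃ j : Fin b, q = Sum.inl (i, j)) : ZeroOn q c'.psi := by
  induction l generalizing c with
  | nil =>
    rw [show c' = c from h]
    simpa using hq
  | cons i l ih =>
    obtain ⟨c1, h1, h2⟩ := (Reach.append_iff F).1 h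
    refine ih h2 ?_
    rcases hq with h | ⟨i', hi', j, rfl⟩
    · exact Or.inl (reach_measCoord F h1 (Or.inl h))
    · rcases List.mem_cons.1 hi' with rfl | hi'
      · exact Or.inl (reach_measCoord F h1 (Or.inr ⟨j, rfl⟩))
      · exact Or.inr ⟨i', hi', j, rfl⟩

/-- Coordinates measured before `i` leave the phases of its qubits alone, and those measured after
leave its result register alone. -/
theorem wp_measList_le {G : ℝ} (hG : 0 ≤ G) (i : Fin d) {V t : ℕ} (hV : t + 1 < V)
    (hb : (512 : ℝ) ≤ 2 ^ b) {x : ℝ} (hx : |x| ≤ 1 / 8) (c : Config d b w)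
    (hψ : ∀ j : Fin b, HasPhase (Sum.inl (i, j)) (2 * Real.pi * (2 ^ (j : ℕ) * x)) c.psi) :
    wp F (measList G V t (List.finRange d)) (weight fun reg =>
      if |reg (V + i) - 8 * G * x| ≤ 512 * G / 2 ^ b then 0 else 1) c ≤ 1 / 64 * c.psi.normSq := by
  obtain ⟨l1, l2, hl⟩ := List.append_of_mem (List.mem_finRange i)
  have hnd := List.nodup_finRange d
  rw [hl, List.nodup_append] at hnd
  have hi1 : i ∉ l1 := fun h => hnd.2.2 i h i (by simp) rfl
  have hi2 : i ∉ l2 := (List.nodup_cons.1 hnd.2.1).1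
  set φ : (ℕ → ℝ) → ℝ≥0∞ := fun reg =>
    if |reg (V + i) - 8 * G * x| ≤ 512 * G / 2 ^ b then 0 else 1 with hφ
  have hne : ∀ l : List (Fin d), i ∉ l → ∀ i' ∈ l, V + (i : ℕ) ≠ V + i' := by
    intro l hl i' hi' h
    have : i = i' := Fin.ext (by omega)
    exact hl (this ▸ hi')
  have e : measList G V t (List.finRange d) = measList G V t l1 ++
      (measCoord G i (V + i) t ++ measList G V t l2 : List (Instr d b w)) := by
    rw [hl]; simp [measList]
  rw [e, wp_append, wp_append]
  calc _ ≤ wp F (measList G V t l1) (wp F (measCoord G i (V + i) t) (weight φ)) c := by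
        refine wp_mono F (fun c => wp_mono F (fun c => ?_) _ c) _ c
        refine (wp_weight_le_of_frame F {V + (i : ℕ)} _ ?_ (M := φ c.reg) ?_).trans
          (le_of_eq (mul_comm _ _))
        · rintro x hx r rfl
          exact dest_measList hx (hne l2 hi2) (by omega) (by omega)
        · intro reg hreg
          simp only [hφ, hreg _ rfl, le_refl]
    _ ≤ wp F (measList G V t l1) (fun c => 1 / 64 * weight (fun _ => 1) c) c := by
        refine wp_mono_of_inv F (fun c => ∀ j : Fin b,
          HasPhase (Sum.inl (i, j)) (2 * Real.pi * (2 ^ (j : ℕ) * x)) c.psi) ?_ _ ?_ hψ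
        · intro c hc
          refine (wp_measCoord_le F hG i (by omega) (by omega) hb hx c hc).trans ?_
          simp [weight]
        · intro x hx o c hc j
          obtain ⟨i', hi', hx⟩ := List.mem_flatMap.1 hx
          exact hasPhase_step_measCoord F (by rintro rfl; exact hi1 hi') hx o (hc j)
    _ = _ := by rw [wp_const_mul, wp_weight_one]

end Coordinate

/-! ### Preparation of the phase state -/

section Prep

variable {d b w : ℕ} (F : Pt d → BitVec w)

/-- The state `|0 … 0⟩`. -/
def zeroKet : QState d b w := fun a => if ∀ q, a q = false then 1 else 0

theorem normSq_zeroKet : (zeroKet : QState d b w).normSq = 1 := by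
  rw [QState.normSq, Finset.sum_eq_single (fun _ => false)]
  · simp [zeroKet]
  · intro a _ ha
    have : ¬ ∀ q, a q = false := fun h => ha (funext h)
    rw [zeroKet, if_neg this]; simp
  · simp

theorem zeroOn_zeroKet (q : Qubit d b w) : ZeroOn q (zeroKet : QState d b w) := by
  intro a ha
  have : ¬ ∀ q, a q = false := fun h => by simp [h q] at ha
  rw [zeroKet, if_neg this]

theorem eq_smul_zeroKet {ψ : QState d b w} (h : ∀ q, ZeroOn q ψ) :
    ψ = ψ (fun _ => false) • zeroKet := by
  funext a
  by_cases ha : ∀ q, a q = false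
  · have : a = fun _ => false := funext ha
    simp [zeroKet, this]
  · have h1 := ha
    push Not at ha
    obtain ⟨q, hq⟩ := ha
    rw [Pi.smul_apply, zeroKet, if_neg h1, h q a (by simpa using hq), smul_zero]

/-- All qubits of the input register. -/
def inputQubits (d b w : ℕ) : List (Qubit d b w) :=
  (List.finRange d).flatMap fun i => (List.finRange b).map fun j => Sum.inl (i, j)

theorem mem_inputQubits (i : Fin d) (j : Fin b) :
    (Sum.inl (i, j) : Qubit d b w) ∈ inputQubits d b w := by
  simp [inputQubits]

theorem inr_notMem_inputQubits (j : Fin w) :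
    (Sum.inr j : Qubit d b w) ∉ inputQubits d b w := by
  simp [inputQubits]

theorem nodup_inputQubits : (inputQubits d b w).Nodup := by
  rw [inputQubits, List.nodup_flatMap]
  refine ⟨fun i _ => (List.nodup_finRange b).map fun j j' h => ?_, ?_⟩
  · exact (Prod.mk.inj (Sum.inl.inj h)).2
  · refine (List.nodup_finRange d).imp fun {i i'} h => ?_
    simp only [Function.onFun, List.disjoint_left, List.mem_map]
    rintro q ⟨j, -, rfl⟩ ⟨j', -, h'⟩
    exact h (Prod.mk.inj (Sum.inl.inj h')).1.symm

/-- Hadamard gates on all qubits of a list. -/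
def hadList (l : List (Qubit d b w)) (ψ : QState d b w) : QState d b w :=
  l.foldl (fun ψ q => hadGate q ψ) ψ

theorem wp_hadList (l : List (Qubit d b w)) (κ : Config d b w → ℝ≥0∞) (reg : ℕ → ℝ)
    (ψ : QState d b w) : wp F (l.map Instr.had) κ ⟨reg, ψ⟩ = κ ⟨reg, hadList l ψ⟩ := by
  induction l generalizing ψ with
  | nil => rfl
  | cons q l ih => simp [wp, Instr.wp, Instr.isMeasure, Instr.step, ih, hadList]

theorem normSq_hadList (l : List (Qubit d b w)) (ψ : QState d b w) :
    (hadList l ψ).normSq = ψ.normSq := by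
  induction l generalizing ψ with
  | nil => rfl
  | cons q l ih => rw [hadList, List.foldl_cons, ← hadList, ih, normSq_hadGate]

theorem zeroOn_hadList {l : List (Qubit d b w)} {q : Qubit d b w} (hq : q ∉ l)
    {ψ : QState d b w} (h : ZeroOn q ψ) : ZeroOn q (hadList l ψ) := by
  induction l generalizing ψ with
  | nil => exact h
  | cons q' l ih =>
    rw [List.mem_cons, not_or] at hq
    exact ih hq.2 (h.hadGate (Ne.symm hq.1))

theorem hasPhase_hadList_of_notMem {l : List (Qubit d b w)} {q : Qubit d b w} (hq : q ∉ l)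
    {β : ℝ} {ψ : QState d b w} (h : HasPhase q β ψ) : HasPhase q β (hadList l ψ) := by
  induction l generalizing ψ with
  | nil => exact h
  | cons q' l ih =>
    rw [List.mem_cons, not_or] at hq
    exact ih hq.2 (h.hadGate (Ne.symm hq.1))

theorem hasPhase_hadGate_of_zeroOn {q : Qubit d b w} {ψ : QState d b w} (h : ZeroOn q ψ) :
    HasPhase q 0 (hadGate q ψ) := by
  intro a
  simp [hadGate, h (Function.update a q true) (by simp)]

theorem hasPhase_hadList {l : List (Qubit d b w)} (hl : l.Nodup) {q : Qubit d b w} (hq : q ∈ l)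
    {ψ : QState d b w} (h : ZeroOn q ψ) : HasPhase q 0 (hadList l ψ) := by
  induction l generalizing ψ with
  | nil => simp at hq
  | cons q' l ih =>
    rw [List.nodup_cons] at hl
    by_cases hqq : q = q'
    · subst hqq
      exact hasPhase_hadList_of_notMem hl.1 (hasPhase_hadGate_of_zeroOn h)
    · exact ih hl.2 ((List.mem_cons.1 hq).resolve_left hqq) (h.hadGate (Ne.symm hqq))

/-- The uniform superposition over the input register. -/
def uniformKet : QState d b w := hadList (inputQubits d b w) zeroKet

theorem normSq_uniformKet : (uniformKet : QState d b w).normSq = 1 := by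
  rw [uniformKet, normSq_hadList, normSq_zeroKet]

theorem zeroOn_uniformKet (j : Fin w) : ZeroOn (Sum.inr j) (uniformKet : QState d b w) :=
  zeroOn_hadList (inr_notMem_inputQubits j) (zeroOn_zeroKet _)

theorem hasPhase_uniformKet (i : Fin d) (j : Fin b) :
    HasPhase (Sum.inl (i, j)) 0 (uniformKet : QState d b w) :=
  hasPhase_hadList nodup_inputQubits (mem_inputQubits i j) (zeroOn_zeroKet _)

/-- The phase that the phase gates with the angles in `J` apply to the output `v`. -/
def outputPhase (J : List (Fin w × ℝ)) (v : Fin w → Bool) : ℝ :=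
  (J.map fun x => if v x.1 then x.2 else 0).sum

theorem wp_phaseList (t : ℕ) (J : List (Fin w × ℝ)) (reg : ℕ → ℝ) (ψ : QState d b w) :
    ∃ reg' : ℕ → ℝ, (∀ r, r ≠ t → reg' r = reg r) ∧ ∀ κ : Config d b w → ℝ≥0∞,
      wp F (J.flatMap fun x => [.const t x.2, .phase (Sum.inr x.1) t]) κ ⟨reg, ψ⟩ =
        κ ⟨reg', fun a => Complex.exp (outputPhase J (fun j => a (Sum.inr j)) * Complex.I) *
          ψ a⟩ := by
  induction J generalizing reg ψ with
  | nil => exact ⟨reg, fun _ _ => rfl, fun κ => by simp [wp, outputPhase]⟩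
  | cons x J ih =>
    obtain ⟨reg', h1, h2⟩ := ih (Function.update reg t x.2) (phaseGate (Sum.inr x.1) x.2 ψ)
    refine ⟨reg', fun r hr => by rw [h1 r hr, Function.update_of_ne hr], fun κ => ?_⟩
    rw [List.flatMap_cons, wp_append]
    simp only [wp, Instr.wp, Instr.isMeasure, Instr.step, Bool.false_eq_true, if_false,
      Function.update_self, h2]
    congr 2
    funext a
    simp only [phaseGate, outputPhase, List.map_cons, List.sum_cons]
    split_ifs
    · push_cast
      rw [add_mul, Complex.exp_add]
      ring
    · simp

/-- Prepare the state whose phases are the oracle values on the hypergrid with origin in the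
registers `0, …, d - 1` and spacing `s`. -/
def prep (s : ℝ) (J : List (Fin w × ℝ)) (t : ℕ) : List (Instr d b w) :=
  .const (t + 2) s :: ((inputQubits d b w).map Instr.had ++ (.query 0 (t + 2) ::
    ((J.flatMap fun x => [.const t x.2, .phase (Sum.inr x.1) t]) ++ [.query 0 (t + 2)])))

/-- The phase of the basis state `a` after `prep`. -/
def oraclePhase (J : List (Fin w × ℝ)) (z : Pt d) (s : ℝ) (a : Basis d b w) : ℝ :=
  outputPhase J fun j => (F (gridPoint (fun i => z i) s a)).getLsbD j

/-- Compute, phase, uncompute: the phases are diagonal and do not touch the index, so the second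
query cancels the first and returns the output register to zero. -/
theorem wp_prep (s : ℝ) (J : List (Fin w × ℝ)) {t : ℕ} (ht : d ≤ t) (reg : ℕ → ℝ) (z : Pt d)
    (hz : ∀ i : Fin d, reg i = z i) :
    ∃ reg' : ℕ → ℝ, (∀ r, r ≠ t → r ≠ t + 2 → reg' r = reg r) ∧ ∀ κ : Config d b w → ℝ≥0∞,
      wp F (prep s J t) κ ⟨reg, zeroKet⟩ =
        κ ⟨reg', fun a => Complex.exp (oraclePhase F J z s a * Complex.I) * uniformKet a⟩ := by
  obtain ⟨reg', h1, h2⟩ := wp_phaseList F t J (Function.update reg (t + 2) s)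
    (queryGate F (fun i => z i) s (uniformKet : QState d b w))
  refine ⟨reg', fun r hr hr2 => by rw [h1 r hr, Function.update_of_ne hr2], fun κ => ?_⟩
  have hor : (fun i : Fin d => Function.update reg (t + 2) s (0 + (i : ℕ))) = fun i => z i := by
    funext i
    rw [zero_add, Function.update_of_ne (by omega), hz]
  have hor' : (fun i : Fin d => reg' (0 + (i : ℕ))) = fun i => z i := by
    rw [← hor]
    funext i
    exact h1 _ (by omega)
  have hs' : reg' (t + 2) = s := by rw [h1 _ (by omega), Function.update_self]
  rw [prep, wp, wp_append, Instr.wp]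
  simp only [Instr.isMeasure, Instr.step, Bool.false_eq_true, if_false]
  rw [wp_hadList, wp, wp_append, Instr.wp, ← uniformKet]
  simp only [Instr.isMeasure, Instr.step, Bool.false_eq_true, if_false, hor, Function.update_self,
    h2]
  simp only [wp, Instr.wp, Instr.isMeasure, Instr.step, Bool.false_eq_true, if_false, hor', hs']
  congr 2
  funext a
  simp only [queryGate, gridPoint_xorOutput, xorOutput_xorOutput]
  -- The amplitude vanishes unless the output register is zero, and then the XOR writes exactly the
  -- oracle bits.
  by_cases ha : ∃ j, a (Sum.inr j) = true
  · obtain ⟨j, hj⟩ := ha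
    rw [zeroOn_uniformKet j a hj, mul_zero, mul_zero]
  · push Not at ha
    congr 4
    simp only [oraclePhase]
    congr 1
    funext j
    simp [xorOutput, ha j]

theorem gridIndex_update (i : Fin d) (j : Fin b) (o : Bool) (a : Basis d b w) (i' : Fin d) :
    (∑ j' : Fin b, if Function.update a (Sum.inl (i, j)) o (Sum.inl (i', j')) then
      (2 : ℝ) ^ (j' : ℕ) else 0) =
    (∑ j' : Fin b, if Function.update a (Sum.inl (i, j)) false (Sum.inl (i', j')) then
      (2 : ℝ) ^ (j' : ℕ) else 0) + if i' = i ∧ o then 2 ^ (j : ℕ) else 0 := by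
  by_cases hi : i' = i
  · subst hi
    rw [← Finset.sum_erase_add _ _ (Finset.mem_univ j),
      ← Finset.sum_erase_add Finset.univ (fun j' : Fin b =>
        if Function.update a (Sum.inl (i', j)) false (Sum.inl (i', j')) then
          (2 : ℝ) ^ (j' : ℕ) else 0) (Finset.mem_univ j)]
    simp only [Function.update_self, Bool.false_eq_true, if_false, add_zero, true_and]
    congr 1
    refine Finset.sum_congr rfl fun j' hj' => ?_
    have : (Sum.inl (i', j') : Qubit d b w) ≠ Sum.inl (i', j) := by
      intro h; exact (Finset.mem_erase.1 hj').1 (Prod.mk.inj (Sum.inl.inj h)).2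
    rw [Function.update_of_ne this, Function.update_of_ne this]
  · simp [hi]

/-- The index that a basis state holds for the coordinate `i`. -/
def gridIndex (a : Basis d b w) (i : Fin d) : ℝ :=
  ∑ j : Fin b, if a (Sum.inl (i, j)) then (2 : ℝ) ^ (j : ℕ) else 0

/-- The phase of an affine function with slopes `x`. -/
def linearPhase (γ : ℝ) (x : Fin d → ℝ) (a : Basis d b w) : ℝ :=
  γ + 2 * Real.pi * ∑ i, x i * gridIndex a i

/-- An affine phase splits into a product over the qubits: setting bit `j` of coordinate `i` adds
`2π 2^j x i`, whatever the other bits are. -/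
theorem hasPhase_linearPhase (γ : ℝ) (x : Fin d → ℝ) (i : Fin d) (j : Fin b) :
    HasPhase (Sum.inl (i, j)) (2 * Real.pi * (2 ^ (j : ℕ) * x i))
      (fun a => Complex.exp (linearPhase γ x a * Complex.I) * uniformKet a : QState d b w) := by
  intro a
  have h := hasPhase_uniformKet (w := w) i j a
  simp only [Complex.ofReal_zero, zero_mul, Complex.exp_zero, one_mul] at h
  have e : linearPhase γ x (Function.update a (Sum.inl (i, j)) true) =
      2 * Real.pi * (2 ^ (j : ℕ) * x i) +
        linearPhase γ x (Function.update a (Sum.inl (i, j)) false) := by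
    simp only [linearPhase, gridIndex]
    simp only [gridIndex_update i j true a, mul_add, Finset.sum_add_distrib]
    simp [Finset.sum_ite_eq']
    ring
  simp only [h, e]
  rw [Complex.ofReal_add, add_mul, Complex.exp_add]
  ring

end Prep
end

noncomputable section

/-! ### Repeated runs -/

section Runs

variable {d b w : ℕ} (F : Pt d → BitVec w)

/-- One run of the gradient estimation, with origin of the hypergrid in the registers
`0, …, d - 1` and results in the registers `V, …, V + d - 1`. -/
def runProg (s G : ℝ) (J : List (Fin w × ℝ)) (t V : ℕ) : List (Instr d b w) :=
  prep s J t ++ measList G V t (List.finRange d)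

/-- The origin of the hypergrid is `z`, and all qubits are in the state `|0⟩`. -/
def IsReady (z : Pt d) (c : Config d b w) : Prop :=
  (∃ y : ℂ, c.psi = y • zeroKet) ∧ ∀ i : Fin d, c.reg i = z i

variable {F} {s G : ℝ} {J : List (Fin w × ℝ)} {t V : ℕ} {z : Pt d}

theorem IsHomogeneous.le_of_zeroKet {κ κ' : Config d b w → ℝ≥0∞} (hκ : IsHomogeneous κ)
    (hκ' : IsHomogeneous κ') {c : Config d b w} (hc : IsReady z c)
    (h : κ ⟨c.reg, zeroKet⟩ ≤ κ' ⟨c.reg, zeroKet⟩) : κ c ≤ κ' c := by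
  obtain ⟨⟨y, hy⟩, -⟩ := hc
  obtain ⟨reg, ψ⟩ := c
  simp only at hy h
  rw [hy, hκ, hκ']
  gcongr

/-- A run resets all qubits and keeps the origin, so it leads from ready configurations to ready
ones, and only those need to be compared. -/
theorem wp_runProg_mono {κ κ' : Config d b w → ℝ≥0∞} (hκ : IsHomogeneous κ)
    (hκ' : IsHomogeneous κ') (ht : d ≤ t) (hV : t + 2 < V)
    (h : ∀ c, IsReady z c → κ c ≤ κ' c) {c : Config d b w} (hc : IsReady z c) :
    wp F (runProg s G J t V) κ c ≤ wp F (runProg s G J t V) κ' c := by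
  refine (hκ.wp F _).le_of_zeroKet (hκ'.wp F _) hc ?_
  obtain ⟨reg', h1, h2⟩ := wp_prep (b := b) F s J ht c.reg z hc.2
  rw [runProg, wp_append, wp_append, h2, h2]
  refine wp_mono_of_reach F fun c' hc' => h c' ⟨⟨_, eq_smul_zeroKet fun q => ?_⟩, fun i => ?_⟩
  · refine reach_measList F hc' ?_
    rcases q with ⟨i, j⟩ | j
    · exact Or.inr ⟨i, List.mem_finRange i, j, rfl⟩
    · left
      intro a ha
      simp only
      rw [zeroOn_uniformKet j a ha, mul_zero]
  · exact (Reach.reg_eq F (fun x hx => dest_measList hx (fun _ _ => by omega) (by omega)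
      (by omega)) hc').trans ((h1 i (by omega) (by omega)).trans (hc.2 i))

/-- The program that makes `n` runs. -/
def runsProg (s G : ℝ) (J : List (Fin w × ℝ)) (t V : ℕ) (n : ℕ) : List (Instr d b w) :=
  (List.range n).flatMap fun ρ => runProg s G J t (V + ρ * d)

theorem runsProg_succ (n : ℕ) : (runsProg s G J t V (n + 1) : List (Instr d b w)) =
    runsProg s G J t V n ++ runProg s G J t (V + n * d) := by
  simp [runsProg, List.range_succ]

theorem wp_runsProg_mono {κ κ' : Config d b w → ℝ≥0∞} (hκ : IsHomogeneous κ)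
    (hκ' : IsHomogeneous κ') (ht : d ≤ t) (hV : t + 2 < V)
    (h : ∀ c, IsReady z c → κ c ≤ κ' c) (n : ℕ) {c : Config d b w} (hc : IsReady z c) :
    wp F (runsProg s G J t V n) κ c ≤ wp F (runsProg s G J t V n) κ' c := by
  induction n generalizing κ κ' with
  | zero => exact h c hc
  | succ n ih =>
    rw [runsProg_succ, wp_append, wp_append]
    exact ih (hκ.wp F _) (hκ'.wp F _) fun c hc =>
      wp_runProg_mono hκ hκ' ht (by omega) h hc

/-- The indicator of a bad estimate of the slope `8 G x` in the register `r`. -/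
def badSlope (b : ℕ) (G x : ℝ) (r : ℕ) (reg : ℕ → ℝ) : ℝ≥0∞ :=
  if |reg r - 8 * G * x| ≤ 512 * G / 2 ^ b then 0 else 1

/-- The oracle phases on the hypergrid at `z` are close to those of an affine function with
slopes `x`. -/
def PhasesClose (F : Pt d → BitVec w) (b : ℕ) (s : ℝ) (J : List (Fin w × ℝ)) (z : Pt d)
    (x : Fin d → ℝ) : Prop :=
  ∃ γ, ∑ a : Basis d b w, ‖(uniformKet : QState d b w) a‖ ^ 2 *
    ‖Complex.exp (oraclePhase F J z s a * Complex.I) -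
      Complex.exp (linearPhase γ x a * Complex.I)‖ ^ 2 ≤ 1 / 64

/-- The state with affine phases fails with probability at most `1/64`, and the true state differs
from it by a vector of squared norm at most `1/64`. `wp_weight_add_le` doubles both, giving `4/64`.
-/
theorem wp_runProg_bad_le (hG : 0 ≤ G) (ht : d ≤ t) (hV : t + 2 < V) (hb : (512 : ℝ) ≤ 2 ^ b)
    {x : Fin d → ℝ} (hx : ∀ i, |x i| ≤ 1 / 8) (hclose : PhasesClose F b s J z x) (i : Fin d)
    {reg : ℕ → ℝ} (hz : ∀ i : Fin d, reg i = z i) :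
    wp F (runProg s G J t V) (weight (badSlope b G (x i) (V + i)))
      (⟨reg, zeroKet⟩ : Config d b w) ≤ 1 / 16 := by
  obtain ⟨γ, hγ⟩ := hclose
  obtain ⟨reg', h1, h2⟩ := wp_prep (b := b) F s J ht reg z hz
  rw [runProg, wp_append, h2]
  set ψ : QState d b w := fun a => Complex.exp (oraclePhase F J z s a * Complex.I) * uniformKet a
  set χ : QState d b w := fun a => Complex.exp (linearPhase γ x a * Complex.I) * uniformKet a with hχ
  have e : ψ = χ + (ψ - χ) := by abel
  have hχ1 : χ.normSq = 1 := by
    rw [← normSq_uniformKet (d := d) (b := b) (w := w)]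
    refine Finset.sum_congr rfl fun a _ => ?_
    simp only [hχ, nnnorm_mul, norm_exp_ofReal_mul_I', one_mul]
  have hdiff : ((ψ - χ).normSq : ℝ≥0∞) ≤ 1 / 64 := by
    have h3 : ((ψ - χ).normSq : ℝ) ≤ 1 / 64 := by
      rw [coe_normSq]
      refine le_trans (le_of_eq ?_) hγ
      refine Finset.sum_congr rfl fun a _ => ?_
      rw [← mul_pow, ← norm_mul, mul_comm (uniformKet a), sub_mul]
      rfl
    have h4 : (ψ - χ).normSq ≤ (1 / 64 : ℝ≥0) := by
      rw [← NNReal.coe_le_coe]; simpa using h3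
    calc ((ψ - χ).normSq : ℝ≥0∞) ≤ ((1 / 64 : ℝ≥0) : ℝ≥0∞) := by exact_mod_cast h4
      _ = 1 / 64 := by
        rw [ENNReal.coe_div (by norm_num)]; norm_num
  have hideal := wp_measList_le F hG i (V := V) (t := t) (by omega) hb (hx i)
    (⟨reg', χ⟩ : Config d b w) fun j => hasPhase_linearPhase γ x i j
  have hrest : wp F (measList G V t (List.finRange d)) (weight (badSlope b G (x i) (V + i)))
      (⟨reg', ψ - χ⟩ : Config d b w) ≤ 1 / 64 := by
    refine le_trans ?_ hdiff
    rw [← wp_weight_one F (measList G V t (List.finRange d)) (⟨reg', ψ - χ⟩ : Config d b w)]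
    refine wp_mono F (fun c => ?_) _ _
    unfold weight badSlope
    gcongr
    split_ifs <;> simp
  rw [e]
  refine (wp_weight_add_le F _ _ reg' χ (ψ - χ)).trans ?_
  simp only [hχ1, ENNReal.coe_one, mul_one] at hideal
  calc _ ≤ 2 * (1 / 64 : ℝ≥0∞) + 2 * (1 / 64) := by
        gcongr
        exact hideal
    _ = 1 / 16 := by
      have h64 : (1 / 64 : ℝ≥0∞) = ((1 / 64 : ℝ≥0) : ℝ≥0∞) := by
        rw [ENNReal.coe_div (by norm_num)]; norm_num
      have h16 : (1 / 16 : ℝ≥0∞) = ((1 / 16 : ℝ≥0) : ℝ≥0∞) := by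
        rw [ENNReal.coe_div (by norm_num)]; norm_num
      rw [h64, h16, ← ENNReal.coe_ofNat, ← ENNReal.coe_mul, ← ENNReal.coe_add, ENNReal.coe_inj,
        ← NNReal.coe_inj]
      push_cast
      norm_num

/-- `16` to the number of bad estimates of a slope in the first `n` runs. -/
def badPower (b : ℕ) (G x : ℝ) (d V i n : ℕ) (reg : ℕ → ℝ) : ℝ≥0∞ :=
  ∏ ρ ∈ Finset.range n, (1 + 15 * badSlope b G x (V + ρ * d + i) reg)

/-- Earlier results are untouched, so a new run multiplies the exponential moment by at most `1 +
15/16 ≤ 2`. -/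
theorem wp_runProg_badPower_le (hG : 0 ≤ G) (ht : d ≤ t) (hV : t + 2 < V)
    (hb : (512 : ℝ) ≤ 2 ^ b) {x : Fin d → ℝ} (hx : ∀ i, |x i| ≤ 1 / 8)
    (hclose : PhasesClose F b s J z x) (i : Fin d) (n : ℕ) {reg : ℕ → ℝ}
    (hz : ∀ i : Fin d, reg i = z i) :
    wp F (runProg s G J t (V + n * d)) (weight (badPower b G (x i) d V i (n + 1)))
      (⟨reg, zeroKet⟩ : Config d b w) ≤ 2 * badPower b G (x i) d V i n reg := by
  set P := badPower b G (x i) d V i n reg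
  calc _ ≤ wp F (runProg s G J t (V + n * d)) (fun c => P * (weight (fun _ => 1) c +
        15 * weight (badSlope b G (x i) (V + n * d + i)) c))
          (⟨reg, zeroKet⟩ : Config d b w) := by
        obtain ⟨reg', h1, h2⟩ := wp_prep (b := b) F s J ht reg z hz
        rw [runProg, wp_append, wp_append, h2, h2]
        refine wp_mono_of_reach F fun c' hc' => le_of_eq ?_
        have hP : badPower b G (x i) d V i n c'.reg = P := by
          refine Finset.prod_congr rfl fun ρ hρ => ?_
          have hlt : ρ * d + i < n * d := by
            have := Finset.mem_range.1 hρ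
            have h5 : (ρ + 1) * d ≤ n * d := Nat.mul_le_mul_right d this
            have := i.2
            rw [Nat.succ_mul] at h5
            omega
          have : c'.reg (V + ρ * d + i) = reg (V + ρ * d + i) :=
            (Reach.reg_eq F (fun x hx => dest_measList hx (fun _ _ => by omega) (by omega)
              (by omega)) hc').trans (h1 _ (by omega) (by omega))
          simp only [badSlope, this]
        simp only [weight, badPower, Finset.prod_range_succ]
        rw [← badPower, hP]
        ring
    _ = P * (1 + 15 * wp F (runProg s G J t (V + n * d))
          (weight (badSlope b G (x i) (V + n * d + i))) (⟨reg, zeroKet⟩ : Config d b w)) := by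
        rw [wp_const_mul, wp_add, wp_const_mul, wp_weight_one]
        simp only [normSq_zeroKet, ENNReal.coe_one]
    _ ≤ P * (1 + 15 * (1 / 16)) := by
        gcongr
        exact wp_runProg_bad_le hG ht (by omega) hb hx hclose i hz
    _ ≤ P * 2 := by
        gcongr
        have h16 : (15 * (1 / 16) : ℝ≥0∞) ≤ 1 := by
          rw [mul_one_div]
          exact ENNReal.div_le_of_le_mul (by norm_num)
        calc (1 + 15 * (1 / 16) : ℝ≥0∞) ≤ 1 + 1 := by gcongr
          _ = 2 := by norm_num
    _ = _ := mul_comm _ _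

theorem wp_runsProg_badPower_le (hG : 0 ≤ G) (ht : d ≤ t) (hV : t + 2 < V)
    (hb : (512 : ℝ) ≤ 2 ^ b) {x : Fin d → ℝ} (hx : ∀ i, |x i| ≤ 1 / 8)
    (hclose : PhasesClose F b s J z x) (i : Fin d) (n : ℕ) {reg : ℕ → ℝ}
    (hz : ∀ i : Fin d, reg i = z i) :
    wp F (runsProg s G J t V n) (weight (badPower b G (x i) d V i n))
      (⟨reg, zeroKet⟩ : Config d b w) ≤ 2 ^ n := by
  induction n with
  | zero => simp [runsProg, wp, weight, badPower, normSq_zeroKet]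
  | succ n ih =>
    have hom2 : IsHomogeneous fun c : Config d b w =>
        2 * weight (badPower b G (x i) d V i n) c := by
      intro reg y ψ
      simp only [isHomogeneous_weight _ reg y ψ]
      ring
    rw [runsProg_succ, wp_append]
    refine (wp_runsProg_mono (z := z) ((isHomogeneous_weight _).wp F _) hom2 ht hV (fun c hc => ?_)
      n ⟨⟨1, (one_smul _ _).symm⟩, hz⟩).trans ?_
    · refine ((isHomogeneous_weight _).wp F _).le_of_zeroKet hom2 hc ?_
      refine (wp_runProg_badPower_le hG ht hV hb hx hclose i n hc.2).trans (le_of_eq ?_)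
      simp [weight, normSq_zeroKet]
    · rw [wp_const_mul, pow_succ, mul_comm]
      gcongr

/-- Half of the runs being bad gives `16^(n/2) = 4^n`. Against the moment bound `2^n` this leaves
`2^(-n)` in Markov's inequality. -/
theorem four_pow_le_badPower {x : ℝ} {i n : ℕ} {reg : ℕ → ℝ}
    (h : n ≤ 2 * ((Finset.range n).filter fun ρ =>
      ¬ |reg (V + ρ * d + i) - 8 * G * x| ≤ 512 * G / 2 ^ b).card) :
    4 ^ n ≤ badPower b G x d V i n reg := by
  classical
  have e : badPower b G x d V i n reg = 16 ^ ((Finset.range n).filter fun ρ =>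
      ¬ |reg (V + ρ * d + i) - 8 * G * x| ≤ 512 * G / 2 ^ b).card := by
    rw [← Finset.prod_const, Finset.prod_filter]
    refine Finset.prod_congr rfl fun ρ _ => ?_
    unfold badSlope
    split_ifs
    · simp
    · norm_num
  rw [e]
  calc (4 : ℝ≥0∞) ^ n ≤ 4 ^ (2 * ((Finset.range n).filter fun ρ =>
        ¬ |reg (V + ρ * d + i) - 8 * G * x| ≤ 512 * G / 2 ^ b).card) :=
        pow_le_pow_right₀ (by norm_num) h
    _ = _ := by rw [pow_mul]; norm_num

end Runs

/-! ### Majority vote -/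

section Vote

variable {d b w : ℕ}

/-- The effect of a classical instruction on the registers. -/
def Instr.regStep (reg : ℕ → ℝ) (i : Instr d b w) : ℕ → ℝ :=
  (i.step (fun _ => 0) false ⟨reg, 0⟩).reg

/-- Does the instruction act on the classical registers only? -/
def Instr.isClassical : Instr d b w → Bool
  | .const _ _ | .add _ _ _ | .sub _ _ _ | .mul _ _ _ | .le _ _ _ => true
  | _ => false

/-- The effect of a classical program on the registers. -/
def regRun (prog : List (Instr d b w)) (reg : ℕ → ℝ) : ℕ → ℝ := prog.foldl Instr.regStep reg

theorem wp_classical (F : Pt d → BitVec w) {prog : List (Instr d b w)}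
    (h : ∀ i ∈ prog, i.isClassical) (κ : Config d b w → ℝ≥0∞) (c : Config d b w) :
    wp F prog κ c = κ ⟨regRun prog c.reg, c.psi⟩ := by
  induction prog generalizing c with
  | nil => rfl
  | cons i is ih =>
    have hi := h i (by simp)
    rw [wp, Instr.wp, regRun, List.foldl_cons, ← regRun]
    cases i <;> simp only [Instr.isClassical, Bool.false_eq_true] at hi <;>
      simp only [Instr.isMeasure, Bool.false_eq_true, if_false] <;>
      rw [ih fun j hj => h j (by simp [hj])] <;> rfl

theorem regRun_append (p q : List (Instr d b w)) (reg : ℕ → ℝ) :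
    regRun (p ++ q) reg = regRun q (regRun p reg) := by
  simp [regRun]

theorem regRun_of_dest {prog : List (Instr d b w)} {r : ℕ} (h : ∀ i ∈ prog, i.dest ≠ some r)
    (reg : ℕ → ℝ) : regRun prog reg r = reg r := by
  induction prog generalizing reg with
  | nil => rfl
  | cons i is ih =>
    rw [regRun, List.foldl_cons, ← regRun, ih (fun j hj => h j (by simp [hj])), Instr.regStep,
      Instr.step_reg_of_ne_dest _ _ _ _ (h i (by simp))]

/-- Add `1` to the register `t` if the registers `u` and `v` differ by at most the root of the
register `t + 2`. -/
def compareProg (t u v : ℕ) : List (Instr d b w) :=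
  [.sub (t + 1) u v, .mul (t + 1) (t + 1) (t + 1), .le (t + 1) (t + 1) (t + 2), .add t t (t + 1)]

/-- Count the registers `V i` with `i < n` that agree with the register `u`. -/
def countProg (D : ℝ) (t u : ℕ) (V : ℕ → ℕ) (n : ℕ) : List (Instr d b w) :=
  [.const t 0, .const (t + 2) D] ++ (List.range n).flatMap fun ρ => compareProg t u (V ρ)

theorem dest_compareProg {t u v r : ℕ} {x : Instr d b w} (h : x ∈ compareProg t u v) (h0 : r ≠ t)
    (h1 : r ≠ t + 1) : x.dest ≠ some r := by
  simp only [compareProg, List.mem_cons, List.not_mem_nil, or_false] at h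
  rcases h with rfl | rfl | rfl | rfl <;> simp [Instr.dest, h0.symm, h1.symm]

theorem dest_countProg {D : ℝ} {t u r n : ℕ} {V : ℕ → ℕ} {x : Instr d b w}
    (h : x ∈ countProg D t u V n) (h0 : r ≠ t) (h1 : r ≠ t + 1) (h2 : r ≠ t + 2) :
    x.dest ≠ some r := by
  rw [countProg, List.mem_append] at h
  rcases h with h | h
  · simp only [List.mem_cons, List.not_mem_nil, or_false] at h
    rcases h with rfl | rfl <;> simp [Instr.dest, h0.symm, h2.symm]
  · obtain ⟨ρ, -, h⟩ := List.mem_flatMap.1 h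
    exact dest_compareProg h h0 h1

/-- The number of registers that agree with the register `u`. -/
def agreeCount (D : ℝ) (u : ℕ) (V : ℕ → ℕ) (n : ℕ) (reg : ℕ → ℝ) : ℕ :=
  ((Finset.range n).filter fun ρ => (reg u - reg (V ρ)) ^ 2 ≤ D).card

theorem regRun_countProg (D : ℝ) {t u : ℕ} {V : ℕ → ℕ} (hu : t + 2 < u) (hV : ∀ ρ, t + 2 < V ρ)
    (n : ℕ) (reg : ℕ → ℝ) :
    regRun (countProg D t u V n : List (Instr d b w)) reg t = agreeCount D u V n reg := by
  have hD : ∀ n, regRun (countProg D t u V n : List (Instr d b w)) reg (t + 2) = D := by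
    intro n
    rw [countProg, regRun_append, regRun_of_dest]
    · simp [regRun, Instr.regStep, Instr.step]
    · intro i hi
      obtain ⟨ρ, -, h⟩ := List.mem_flatMap.1 hi
      exact dest_compareProg h (by omega) (by omega)
  induction n with
  | zero => simp [countProg, agreeCount, regRun, Instr.regStep, Instr.step]
  | succ n ih =>
    have e : (countProg D t u V (n + 1) : List (Instr d b w)) =
        countProg D t u V n ++ compareProg t u (V n) := by
      simp [countProg, List.range_succ]
    have hval : ∀ reg : ℕ → ℝ, regRun (compareProg t u (V n) : List (Instr d b w)) reg t =
        reg t + if (reg u - reg (V n)) ^ 2 ≤ reg (t + 2) then 1 else 0 := by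
      intro reg
      simp [compareProg, regRun, Instr.regStep, Instr.step, sq]
    have hk : ∀ r, t + 2 < r → regRun (countProg D t u V n : List (Instr d b w)) reg r = reg r :=
      fun r hr => regRun_of_dest (fun i hi => dest_countProg hi (by omega) (by omega) (by omega)) _
    rw [e, regRun_append, hval, ih, hk u hu, hk _ (hV n), hD, agreeCount, agreeCount,
      Finset.range_add_one, Finset.filter_insert]
    split_ifs
    · rw [Finset.card_insert_of_notMem (by simp)]; push_cast; rfl
    · simp

/-- Copy the register `V a` to the register `o` if it agrees with more than half of the registers
`V 0, …, V (n - 1)`. -/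
def selectProg (D : ℝ) (t o : ℕ) (V : ℕ → ℕ) (n a : ℕ) : List (Instr d b w) :=
  countProg D t (V a) V n ++ [.const (t + 2) ((n + 1) / 2), .le t (t + 2) t, .sub (t + 1) (V a) o,
    .mul (t + 1) t (t + 1), .add o o (t + 1)]

theorem dest_selectProg {D : ℝ} {t o r n a : ℕ} {V : ℕ → ℕ} {x : Instr d b w}
    (h : x ∈ selectProg D t o V n a) (h0 : r ≠ t) (h1 : r ≠ t + 1) (h2 : r ≠ t + 2)
    (ho : r ≠ o) : x.dest ≠ some r := by
  rw [selectProg, List.mem_append] at h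
  rcases h with h | h
  · exact dest_countProg h h0 h1 h2
  · simp only [List.mem_cons, List.not_mem_nil, or_false] at h
    rcases h with rfl | rfl | rfl | rfl | rfl <;>
      simp [Instr.dest, h0.symm, h1.symm, h2.symm, ho.symm]

theorem regRun_selectProg (D : ℝ) {t o : ℕ} {V : ℕ → ℕ} (hV : ∀ ρ, t + 2 < V ρ) (ho : o < t)
    (n a : ℕ) (reg : ℕ → ℝ) :
    regRun (selectProg D t o V n a : List (Instr d b w)) reg o =
      if n < 2 * agreeCount D (V a) V n reg then reg (V a) else reg o := by
  have hval : ∀ reg : ℕ → ℝ, regRun ([.const (t + 2) ((n + 1) / 2), .le t (t + 2) t,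
      .sub (t + 1) (V a) o, .mul (t + 1) t (t + 1), .add o o (t + 1)] : List (Instr d b w)) reg o =
        reg o + (if (n + 1) / 2 ≤ reg t then 1 else 0) * (reg (V a) - reg o) := by
    intro reg
    have h1 := hV a
    have e1 : V a ≠ t := by omega
    have e3 : V a ≠ t + 2 := by omega
    have e4 : o ≠ t := by omega
    have e5 : o ≠ t + 1 := by omega
    have e6 : o ≠ t + 2 := by omega
    simp [regRun, Instr.regStep, Instr.step, e1, e3, e4, e5, e6]
  have hk : ∀ r, r ≠ t → r ≠ t + 1 → r ≠ t + 2 →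
      regRun (countProg D t (V a) V n : List (Instr d b w)) reg r = reg r :=
    fun r h0 h1 h2 => regRun_of_dest (fun i hi => dest_countProg hi h0 h1 h2) _
  have hva := hV a
  rw [selectProg, regRun_append, hval, regRun_countProg D hva hV,
    hk o (by omega) (by omega) (by omega), hk (V a) (by omega) (by omega) (by omega)]
  -- The count is an integer, so the threshold `(n + 1) / 2` turns the machine's non-strict
  -- comparison into a strict majority.
  have hiff : ((n : ℝ) + 1) / 2 ≤ (agreeCount D (V a) V n reg : ℝ) ↔
      n < 2 * agreeCount D (V a) V n reg := by
    rw [div_le_iff₀ (by norm_num), ← Nat.succ_le_iff]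
    constructor
    · intro h
      have : ((n + 1 : ℕ) : ℝ) ≤ ((2 * agreeCount D (V a) V n reg : ℕ) : ℝ) := by
        push_cast; linarith
      exact_mod_cast this
    · intro h
      have : ((n + 1 : ℕ) : ℝ) ≤ ((2 * agreeCount D (V a) V n reg : ℕ) : ℝ) := by exact_mod_cast h
      push_cast at this
      linarith
  simp only [hiff]
  split_ifs <;> ring

/-- Write to the register `o` a value that agrees with more than half of the registers
`V 0, …, V (n - 1)`. -/
def voteProg (D : ℝ) (t o : ℕ) (V : ℕ → ℕ) (n : ℕ) : List (Instr d b w) :=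
  (List.range n).flatMap fun a => selectProg D t o V n a

theorem dest_voteProg {D : ℝ} {t o r n : ℕ} {V : ℕ → ℕ} {x : Instr d b w}
    (h : x ∈ voteProg D t o V n) (h0 : r ≠ t) (h1 : r ≠ t + 1) (h2 : r ≠ t + 2)
    (ho : r ≠ o) : x.dest ≠ some r := by
  obtain ⟨a, -, h⟩ := List.mem_flatMap.1 h
  exact dest_selectProg h h0 h1 h2 ho

/-- The candidates are never overwritten and a later winner replaces an earlier one, so the result
is the last winner. The induction runs over the candidates tried, with the number `n` of voters
fixed. -/
theorem regRun_voteProg (D : ℝ) {t o : ℕ} {V : ℕ → ℕ} (hV : ∀ ρ, t + 2 < V ρ) (ho : o < t)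
    (n : ℕ) (reg : ℕ → ℝ) (hex : ∃ a < n, n < 2 * agreeCount D (V a) V n reg) :
    ∃ a < n, n < 2 * agreeCount D (V a) V n reg ∧
      regRun (voteProg D t o V n : List (Instr d b w)) reg o = reg (V a) := by
  have key : ∀ m, (∃ a < m, n < 2 * agreeCount D (V a) V n reg) →
      ∃ a < m, n < 2 * agreeCount D (V a) V n reg ∧
      regRun ((List.range m).flatMap fun a => selectProg D t o V n a : List (Instr d b w)) reg o =
        reg (V a) := by
    intro m
    induction m with
    | zero => rintro ⟨a, ha, -⟩; omega
    | succ m ih =>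
      rintro ⟨a, ha, hsel⟩
      set reg' := regRun ((List.range m).flatMap fun a => selectProg D t o V n a :
        List (Instr d b w)) reg with hreg'
      have hk : ∀ ρ, reg' (V ρ) = reg (V ρ) := by
        intro ρ
        have := hV ρ
        refine regRun_of_dest (fun i hi => ?_) _
        obtain ⟨a, -, h⟩ := List.mem_flatMap.1 hi
        exact dest_selectProg h (by omega) (by omega) (by omega) (by omega)
      have hag : agreeCount D (V m) V n reg' = agreeCount D (V m) V n reg := by
        simp only [agreeCount, hk]
      rw [List.range_succ, List.flatMap_append, regRun_append, ← hreg', List.flatMap_singleton,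
        regRun_selectProg D hV ho, hag, hk]
      by_cases hm : n < 2 * agreeCount D (V m) V n reg
      · exact ⟨m, by omega, hm, if_pos hm⟩
      · rw [if_neg hm]
        have ham : a < m := by
          rcases Nat.lt_succ_iff_lt_or_eq.1 ha with h | h
          · exact h
          · subst h; exact absurd hsel hm
        obtain ⟨a', h1, h2, h3⟩ := ih ⟨a, ham, hsel⟩
        exact ⟨a', by omega, h2, h3⟩
  exact key n hex

/-- If more than half of the values are within `δ` of `y`, the vote is within `3 δ` of `y`. -/
theorem abs_voteProg_sub_le {δ y : ℝ} (hδ : 0 ≤ δ) {t o : ℕ} {V : ℕ → ℕ} (hV : ∀ ρ, t + 2 < V ρ)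
    (ho : o < t) (n : ℕ) (reg : ℕ → ℝ)
    (hbad : 2 * ((Finset.range n).filter fun ρ => ¬ |reg (V ρ) - y| ≤ δ).card < n) :
    |regRun (voteProg (4 * δ ^ 2) t o V n : List (Instr d b w)) reg o - y| ≤ 3 * δ := by
  classical
  set good := (Finset.range n).filter fun ρ => |reg (V ρ) - y| ≤ δ with hgood
  have hcard : good.card + ((Finset.range n).filter fun ρ => ¬ |reg (V ρ) - y| ≤ δ).card = n := by
    rw [Finset.card_filter_add_card_filter_not, Finset.card_range]
  obtain ⟨a0, ha0⟩ := Finset.card_pos.1 (show 0 < good.card by omega)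
  have hagree : n < 2 * agreeCount (4 * δ ^ 2) (V a0) V n reg := by
    have : good ⊆ (Finset.range n).filter fun ρ => (reg (V a0) - reg (V ρ)) ^ 2 ≤ 4 * δ ^ 2 := by
      intro ρ hρ
      obtain ⟨h1, h2⟩ := Finset.mem_filter.1 hρ
      obtain ⟨-, h3⟩ := Finset.mem_filter.1 ha0
      refine Finset.mem_filter.2 ⟨h1, ?_⟩
      rw [abs_le] at h2 h3
      nlinarith
    have := Finset.card_le_card this
    unfold agreeCount
    omega
  obtain ⟨a, ha, hsel, hval⟩ := regRun_voteProg (d := d) (b := b) (w := w) (4 * δ ^ 2) hV ho n reg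
    ⟨a0, Finset.mem_range.1 (Finset.mem_filter.1 ha0).1, hagree⟩
  rw [hval]
  -- Both the good values and the values agreeing with the winner form strict majorities, so they
  -- share a member: it is `2 δ` from the winner and `δ` from `y`.
  have hint : (good ∩ (Finset.range n).filter fun ρ =>
      (reg (V a) - reg (V ρ)) ^ 2 ≤ 4 * δ ^ 2).Nonempty := by
    rw [Finset.nonempty_iff_ne_empty]
    intro h0
    have h1 := Finset.card_union_add_card_inter good ((Finset.range n).filter fun ρ =>
      (reg (V a) - reg (V ρ)) ^ 2 ≤ 4 * δ ^ 2)
    have h2 : (good ∪ (Finset.range n).filter fun ρ =>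
        (reg (V a) - reg (V ρ)) ^ 2 ≤ 4 * δ ^ 2).card ≤ (Finset.range n).card :=
      Finset.card_le_card (Finset.union_subset (Finset.filter_subset _ _)
      (Finset.filter_subset (fun ρ => (reg (V a) - reg (V ρ)) ^ 2 ≤ 4 * δ ^ 2) (Finset.range n)))
    rw [h0, Finset.card_empty] at h1
    rw [Finset.card_range] at h2
    unfold agreeCount at hsel
    omega
  obtain ⟨ρ, hρ⟩ := hint
  rw [Finset.mem_inter] at hρ
  have h1 := (Finset.mem_filter.1 hρ.1).2
  have h2 := (Finset.mem_filter.1 hρ.2).2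
  have h3 : |reg (V a) - reg (V ρ)| ≤ 2 * δ := by
    refine abs_le_of_sq_le_sq ?_ (by positivity)
    nlinarith
  calc |reg (V a) - y| = |(reg (V a) - reg (V ρ)) + (reg (V ρ) - y)| := by ring_nf
    _ ≤ |reg (V a) - reg (V ρ)| + |reg (V ρ) - y| := abs_add_le _ _
    _ ≤ 3 * δ := by linarith

/-- Majority votes for the coordinates in a list. -/
def voteList (D : ℝ) (t V n : ℕ) (l : List (Fin d)) : List (Instr d b w) :=
  l.flatMap fun i : Fin d => voteProg D t i (fun ρ => V + ρ * d + i) n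

theorem dest_voteList {D : ℝ} {t V r n : ℕ} {l : List (Fin d)} {x : Instr d b w}
    (h : x ∈ voteList D t V n l) (h0 : r ≠ t) (h1 : r ≠ t + 1) (h2 : r ≠ t + 2)
    (ho : ∀ i ∈ l, r ≠ i) : x.dest ≠ some r := by
  obtain ⟨i, hi, h⟩ := List.mem_flatMap.1 h
  exact dest_voteProg h h0 h1 h2 (ho i hi)

theorem abs_voteList_sub_le {δ : ℝ} {y : ℝ} (hδ : 0 ≤ δ) {t V : ℕ} (ht : d ≤ t) (hV : t + 2 < V)
    (n : ℕ) (reg : ℕ → ℝ) (i : Fin d)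
    (hbad : 2 * ((Finset.range n).filter fun ρ => ¬ |reg (V + ρ * d + i) - y| ≤ δ).card < n) :
    |regRun (voteList (4 * δ ^ 2) t V n (List.finRange d) : List (Instr d b w)) reg i - y| ≤
      3 * δ := by
  obtain ⟨l1, l2, hl⟩ := List.append_of_mem (List.mem_finRange i)
  have hnd := List.nodup_finRange d
  rw [hl, List.nodup_append] at hnd
  have hi2 : i ∉ l2 := (List.nodup_cons.1 hnd.2.1).1
  have hid := i.2
  have e : voteList (4 * δ ^ 2) t V n (List.finRange d) = voteList (4 * δ ^ 2) t V n l1 ++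
      (voteProg (4 * δ ^ 2) t i (fun ρ => V + ρ * d + i) n ++
        voteList (4 * δ ^ 2) t V n l2 : List (Instr d b w)) := by
    rw [hl]; simp [voteList]
  rw [e, regRun_append, regRun_append, regRun_of_dest fun x hx => dest_voteList hx (by omega)
    (by omega) (by omega) fun i' hi' h => hi2 (by rwa [Fin.ext h])]
  refine abs_voteProg_sub_le hδ (fun ρ => by omega) (by omega) n _ ?_
  have hk : ∀ ρ, regRun (voteList (4 * δ ^ 2) t V n l1 : List (Instr d b w)) reg
      (V + ρ * d + i) = reg (V + ρ * d + i) := fun ρ => regRun_of_dest (fun x hx =>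
    dest_voteList hx (by omega) (by omega) (by omega) fun i' _ => by omega) _
  simpa only [hk] using hbad

theorem isClassical_voteList {D : ℝ} {t V n : ℕ} {l : List (Fin d)} {x : Instr d b w}
    (h : x ∈ voteList D t V n l) : x.isClassical := by
  obtain ⟨i, -, h⟩ := List.mem_flatMap.1 h
  obtain ⟨a, -, h⟩ := List.mem_flatMap.1 h
  rw [selectProg, countProg, List.mem_append, List.mem_append] at h
  rcases h with (h | h) | h
  · simp only [List.mem_cons, List.not_mem_nil, or_false] at h
    rcases h with rfl | rfl <;> rfl
  · obtain ⟨ρ, -, h⟩ := List.mem_flatMap.1 h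
    simp only [compareProg, List.mem_cons, List.not_mem_nil, or_false] at h
    rcases h with rfl | rfl | rfl | rfl <;> rfl
  · simp only [List.mem_cons, List.not_mem_nil, or_false] at h
    rcases h with rfl | rfl | rfl | rfl | rfl <;> rfl

/-- At a good origin, the runs and the vote estimate all slopes, except with probability
`d / 2^n`. -/
theorem wp_runs_vote_le {F : Pt d → BitVec w} {s G : ℝ} {J : List (Fin w × ℝ)} {t V : ℕ} {z : Pt d}
    (hG : 0 ≤ G) (ht : d ≤ t) (hV : t + 2 < V) (hb : (512 : ℝ) ≤ 2 ^ b) {x : Fin d → ℝ}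
    (hx : ∀ i, |x i| ≤ 1 / 8) (hclose : PhasesClose F b s J z x) (n : ℕ) {reg : ℕ → ℝ}
    (hz : ∀ i : Fin d, reg i = z i) (φ : (ℕ → ℝ) → ℝ≥0∞) (hφ1 : ∀ reg, φ reg ≤ 1)
    (hφ : ∀ reg, (∀ i : Fin d, |reg i - 8 * G * x i| ≤ 3 * (512 * G / 2 ^ b)) → φ reg = 0) :
    wp F (runsProg s G J t V n ++
      voteList (4 * (512 * G / 2 ^ b) ^ 2) t V n (List.finRange d)) (weight φ)
        (⟨reg, zeroKet⟩ : Config d b w) ≤ d * (2 ^ n)⁻¹ := by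
  classical
  rw [wp_append]
  -- Markov's inequality and a union bound: if the vote on coordinate `i` can fail, at least half of
  -- its runs are bad, and then `4^(-n) 16^(#bad) ≥ 1`.
  calc _ ≤ wp F (runsProg s G J t V n) (weight fun reg => ∑ i : Fin d,
        (4 ^ n)⁻¹ * badPower b G (x i) d V i n reg) (⟨reg, zeroKet⟩ : Config d b w) := by
        refine wp_mono F (fun c => ?_) _ _
        rw [wp_classical F fun i hi => isClassical_voteList hi]
        unfold weight
        gcongr
        by_cases hgood : ∀ i : Fin d, 2 * ((Finset.range n).filter fun ρ =>
            ¬ |c.reg (V + ρ * d + i) - 8 * G * x i| ≤ 512 * G / 2 ^ b).card < n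
        · rw [hφ _ fun i => abs_voteList_sub_le (by positivity) ht hV n c.reg i (hgood i)]
          exact zero_le
        · simp only [not_forall, not_lt] at hgood
          obtain ⟨i, hi⟩ := hgood
          refine (hφ1 _).trans ?_
          refine le_trans ?_ (Finset.single_le_sum (fun _ _ => zero_le) (Finset.mem_univ i))
          rw [← ENNReal.inv_mul_cancel (a := (4 : ℝ≥0∞) ^ n) (by simp) (by simp)]
          gcongr
          exact four_pow_le_badPower hi
    _ = ∑ i : Fin d, (4 ^ n)⁻¹ * wp F (runsProg s G J t V n)
          (weight (badPower b G (x i) d V i n)) (⟨reg, zeroKet⟩ : Config d b w) := by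
        rw [wp_weight_sum]
        refine Finset.sum_congr rfl fun i _ => ?_
        rw [← wp_const_mul]
        congr 1
        funext c
        simp only [weight]
        ring
    _ ≤ ∑ i : Fin d, (4 ^ n)⁻¹ * (2 ^ n : ℝ≥0∞) := by
        gcongr with i
        exact wp_runsProg_badPower_le hG ht hV hb hx hclose i n hz
    _ = _ := by
        rw [Finset.sum_const, Finset.card_univ, Fintype.card_fin, nsmul_eq_mul]
        congr 1
        have h4 : (4 : ℝ≥0∞) ^ n = 2 ^ n * 2 ^ n := by rw [← mul_pow]; norm_num
        rw [h4, ENNReal.mul_inv (by simp) (by simp), mul_assoc,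
          ENNReal.inv_mul_cancel (by simp) (by simp), mul_one]

end Vote
end

noncomputable section

/-! ### Random origin of the hypergrid -/

section Average

variable {d : ℕ}

/-- Average of `h` over `x + ∑ β_j v_j`, with independent uniform bits `β_j`. -/
def avg : List (Pt d) → (Pt d → ℝ) → Pt d → ℝ
  | [], h, x => h x
  | v :: vs, h, x => (avg vs h x + avg vs h (x + v)) / 2

theorem avg_append (l₁ l₂ : List (Pt d)) (h : Pt d → ℝ) (x : Pt d) :
    avg (l₁ ++ l₂) h x = avg l₁ (avg l₂ h) x := by
  induction l₁ generalizing x with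
  | nil => rfl
  | cons v l ih => simp only [List.cons_append, avg, ih]

theorem avg_shift (l : List (Pt d)) (h : Pt d → ℝ) (x y : Pt d) :
    avg l (fun z => h (z + y)) x = avg l h (x + y) := by
  induction l generalizing x with
  | nil => rfl
  | cons v l ih => simp only [avg, ih, add_right_comm]

theorem avg_mono (l : List (Pt d)) {h h' : Pt d → ℝ} (hh : ∀ z, h z ≤ h' z) (x : Pt d) :
    avg l h x ≤ avg l h' x := by
  induction l generalizing x with
  | nil => exact hh x
  | cons v l ih => simp only [avg]; linarith [ih x, ih (x + v)]

theorem avg_const (l : List (Pt d)) (r : ℝ) (x : Pt d) : avg l (fun _ => r) x = r := by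
  induction l generalizing x with
  | nil => rfl
  | cons v l ih => simp only [avg, ih]; ring

theorem avg_add (l : List (Pt d)) (h h' : Pt d → ℝ) (x : Pt d) :
    avg l (fun z => h z + h' z) x = avg l h x + avg l h' x := by
  induction l generalizing x with
  | nil => rfl
  | cons v l ih => simp only [avg, ih]; ring

theorem avg_sub (l : List (Pt d)) (h h' : Pt d → ℝ) (x : Pt d) :
    avg l (fun z => h z - h' z) x = avg l h x - avg l h' x := by
  induction l generalizing x with
  | nil => rfl
  | cons v l ih => simp only [avg, ih]; ring

theorem avg_const_mul (l : List (Pt d)) (r : ℝ) (h : Pt d → ℝ) (x : Pt d) :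
    avg l (fun z => r * h z) x = r * avg l h x := by
  induction l generalizing x with
  | nil => rfl
  | cons v l ih => simp only [avg, ih]; ring

theorem avg_sum {ι : Type*} (s : Finset ι) (l : List (Pt d)) (h : ι → Pt d → ℝ) (x : Pt d) :
    avg l (fun z => ∑ i ∈ s, h i z) x = ∑ i ∈ s, avg l (h i) x := by
  classical
  induction s using Finset.induction_on with
  | empty => simp [avg_const]
  | insert a s ha ih => simp only [Finset.sum_insert ha, avg_add, ih]

theorem abs_avg_le (l : List (Pt d)) {h : Pt d → ℝ} {B : ℝ} (hB : ∀ z, |h z| ≤ B) (x : Pt d) :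
    |avg l h x| ≤ B := by
  have h1 := avg_mono l (fun z => (abs_le.1 (hB z)).1) x
  have h2 := avg_mono l (fun z => (abs_le.1 (hB z)).2) x
  rw [avg_const] at h1 h2
  exact abs_le.2 ⟨h1, h2⟩

/-- The increments `2^j v` produce a uniform multiple of `v` below `2^n`, and a shift by `v`
exchanges only the two end points. In the induction the middle terms cancel, and the rest is half
the same statement for `2 v`. -/
theorem abs_avg_chain_sub_le (n : ℕ) (v : Pt d) {h : Pt d → ℝ} {B : ℝ} (hB : ∀ z, |h z| ≤ B)
    (x : Pt d) :
    |avg ((List.range n).map fun j => (2 : ℝ) ^ j • v) h x -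
      avg ((List.range n).map fun j => (2 : ℝ) ^ j • v) h (x + v)| ≤ 2 * B / 2 ^ n := by
  induction n generalizing v x with
  | zero =>
    simp only [List.range_zero, List.map_nil, avg, pow_zero, div_one]
    refine (abs_sub _ _).trans ?_
    linarith [hB x, hB (x + v)]
  | succ n ih =>
    have e : (List.range (n + 1)).map (fun j => (2 : ℝ) ^ j • v) =
        v :: (List.range n).map fun j => (2 : ℝ) ^ j • ((2 : ℝ) • v) := by
      rw [List.range_succ_eq_map, List.map_cons, List.map_map]
      simp only [pow_zero, one_smul, List.cons.injEq, true_and]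
      refine List.map_congr_left fun j _ => ?_
      simp only [Function.comp, Nat.succ_eq_add_one, pow_succ, mul_smul]
    rw [e]
    simp only [avg]
    have h1 := ih ((2 : ℝ) • v) x
    have h2 : x + v + v = x + (2 : ℝ) • v := by rw [two_smul, add_assoc]
    rw [h2]
    have h3 : ∀ p q r : ℝ, (p + q) / 2 - (q + r) / 2 = (p - r) / 2 := by intros; ring
    rw [h3, abs_div, abs_of_pos (show (0 : ℝ) < 2 by norm_num), pow_succ, ← div_div]
    gcongr

/-- The increments that generate a uniformly random point of a hypergrid with `2^n` points per
side and spacing `s`. -/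
def gridIncs (d : ℕ) (s : ℝ) (n : ℕ) : List (Fin d × ℝ) :=
  (List.finRange d).flatMap fun i => (List.range n).map fun j => (i, 2 ^ j * s)

/-- The vector of an increment. -/
def incVec (x : Fin d × ℝ) : Pt d := x.2 • EuclideanSpace.single x.1 1

theorem abs_avg_gridIncs_sub_le (s : ℝ) (n : ℕ) {h : Pt d → ℝ} {B : ℝ} (hB : ∀ z, |h z| ≤ B)
    (i : Fin d) (x : Pt d) :
    |avg ((gridIncs d s n).map incVec) h x -
      avg ((gridIncs d s n).map incVec) h (x + s • EuclideanSpace.single i 1)| ≤ 2 * B / 2 ^ n := by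
  obtain ⟨l1, l2, hl⟩ := List.append_of_mem (List.mem_finRange i)
  set L : List (Fin d) → List (Pt d) := fun l =>
    (l.flatMap fun i => (List.range n).map fun j => (i, 2 ^ j * s)).map incVec with hL
  have e : (gridIncs d s n).map incVec = L l1 ++ (((List.range n).map fun j =>
      (2 : ℝ) ^ j • (s • EuclideanSpace.single i 1 : Pt d)) ++ L l2) := by
    rw [gridIncs, hl, hL]
    simp [incVec, mul_smul, Function.comp_def]
  rw [e, avg_append, avg_append, ← avg_shift, ← avg_sub]
  refine abs_avg_le _ (fun z => ?_) x
  simp only [avg_append]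
  exact abs_avg_chain_sub_le n _ (fun z => abs_avg_le _ hB z) z

theorem abs_sub_nsmul_le {H : Pt d → ℝ} {v : Pt d} {r : ℝ} (h : ∀ x, |H x - H (x + v)| ≤ r)
    (n : ℕ) (x : Pt d) : |H x - H (x - (n : ℝ) • v)| ≤ n * r := by
  induction n with
  | zero => simp
  | succ n ih =>
    have h1 := h (x - ((n + 1 : ℕ) : ℝ) • v)
    have h2 : x - ((n + 1 : ℕ) : ℝ) • v + v = x - (n : ℝ) • v := by push_cast; module
    rw [h2, abs_sub_comm] at h1
    calc _ = |(H x - H (x - (n : ℝ) • v)) +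
          (H (x - (n : ℝ) • v) - H (x - ((n + 1 : ℕ) : ℝ) • v))| := by ring_nf
      _ ≤ _ := (abs_add_le _ _).trans (add_le_add ih h1)
      _ = _ := by push_cast; ring

theorem abs_sub_sum_le {H : Pt d → ℝ} {v : Fin d → Pt d} {r : ℝ}
    (h : ∀ i x, |H x - H (x + v i)| ≤ r) (k : Fin d → ℕ) (S : Finset (Fin d)) (x : Pt d) :
    |H x - H (x - ∑ i ∈ S, (k i : ℝ) • v i)| ≤ ∑ i ∈ S, k i * r := by
  classical
  induction S using Finset.induction_on with
  | empty => simp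
  | insert a S ha ih =>
    rw [Finset.sum_insert ha, Finset.sum_insert ha]
    have h1 := abs_sub_nsmul_le (h a) (k a) (x - ∑ i ∈ S, (k i : ℝ) • v i)
    rw [sub_sub, add_comm (∑ i ∈ S, (k i : ℝ) • v i)] at h1
    calc _ = |(H x - H (x - ∑ i ∈ S, (k i : ℝ) • v i)) + (H (x - ∑ i ∈ S, (k i : ℝ) • v i) -
          H (x - ((k a : ℝ) • v a + ∑ i ∈ S, (k i : ℝ) • v i)))| := by ring_nf
      _ ≤ _ := (abs_add_le _ _).trans (add_le_add ih h1)
      _ = _ := add_comm _ _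

/-- On average over the random origin, second differences of a Lipschitz function are small. -/
theorem avg_second_difference_le {f : Pt d → ℝ} {s : ℝ} {n : ℕ} {B : ℝ} (k : Fin d → ℕ) {N : ℝ}
    (hk : ∀ i, (k i : ℝ) ≤ N) {y : Pt d} (hy : y = ∑ i, (k i : ℝ) • s • EuclideanSpace.single i 1)
    (hB : ∀ z, |f (z + y) - f z| ≤ B) (hB0 : 0 ≤ B) (x : Pt d) :
    avg ((gridIncs d s n).map incVec) (fun z => f (z + y) + f (z - y) - 2 * f z) x ≤
      d * N * (2 * B / 2 ^ n) := by
  set L := (gridIncs d s n).map incVec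
  -- A second difference is a first difference at `z` minus the same one at `z - y`; averaging turns
  -- this into a change of base point by `y`, at most `N` grid steps per coordinate.
  have e : avg L (fun z => f (z + y) + f (z - y) - 2 * f z) x =
      avg L (fun z => f (z + y) - f z) x - avg L (fun z => f (z + y) - f z) (x - y) := by
    rw [sub_eq_add_neg x y, ← avg_shift, ← avg_sub]
    congr 1
    funext z
    rw [neg_add_cancel_right, ← sub_eq_add_neg]
    ring
  have h1 := abs_sub_sum_le (H := avg L fun z => f (z + y) - f z)
    (fun i x => abs_avg_gridIncs_sub_le s n hB i x) k Finset.univ x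
  rw [← hy] at h1
  rw [e]
  refine (le_abs_self _).trans (h1.trans ?_)
  calc ∑ i, (k i : ℝ) * (2 * B / 2 ^ n) ≤ ∑ _i : Fin d, N * (2 * B / 2 ^ n) := by
        gcongr with i; exact hk i
    _ = _ := by simp [mul_assoc]

end Average

/-! ### Drawing the random origin by coin tosses. -/

section Random

variable {d b w : ℕ} (F : Pt d → BitVec w)

/-- Add to the registers `0, …, d - 1` the increments of a list, each with probability `1/2`. -/
def randProg (q : Qubit d b w) (t : ℕ) (incs : List (Fin d × ℝ)) : List (Instr d b w) :=
  incs.flatMap fun x => [.had q, .measure q t, .const (t + 1) x.2, .mul t t (t + 1),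
    .add x.1 x.1 t]

theorem collapse_hadGate_zeroKet (q : Qubit d b w) (o : Bool) :
    collapse q o (hadGate q zeroKet) = (1 / (Real.sqrt 2 : ℂ)) • zeroKet := by
  funext a
  have h1 : ∀ a : Basis d b w, zeroKet (Function.update a q true) = 0 := fun a =>
    zeroOn_zeroKet q _ (by simp)
  by_cases ha : a q
  · simp [collapse, ha, zeroOn_zeroKet q a ha]
  · have h2 : Function.update a q false = a := by
      rw [← Bool.eq_false_iff.2 ha, Function.update_eq_self]
    rw [collapse, if_neg ha, hadGate, Function.update_idem, Function.update_idem, h1, h2]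
    simp [div_eq_inv_mul]

/-- The point held in the registers `0, …, d - 1`. -/
def regPt (d : ℕ) (reg : ℕ → ℝ) : Pt d := WithLp.toLp 2 fun i => reg i

/-- A Hadamard gate on `|0⟩` followed by a measurement is a fair coin: each branch is `zeroKet` with
weight `1/2`, so the same qubit serves for every toss. -/
theorem wp_randProg_le {κ : Config d b w → ℝ≥0∞} (hκ : IsHomogeneous κ) {h : Pt d → ℝ}
    (hh : ∀ z, 0 ≤ h z) (hκh : ∀ reg, κ ⟨reg, zeroKet⟩ ≤ ENNReal.ofReal (h (regPt d reg)))
    (q : Qubit d b w) {t : ℕ} (ht : d ≤ t) (incs : List (Fin d × ℝ)) (reg : ℕ → ℝ) :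
    wp F (randProg q t incs) κ ⟨reg, zeroKet⟩ ≤
      ENNReal.ofReal (avg (incs.map incVec) h (regPt d reg)) := by
  induction incs generalizing reg with
  | nil => exact hκh reg
  | cons x incs ih =>
    have hhalf : ((‖(1 / (Real.sqrt 2 : ℂ))‖₊ ^ 2 : ℝ≥0) : ℝ≥0∞) = ENNReal.ofReal (1 / 2) := by
      rw [ENNReal.ofReal, ENNReal.coe_inj, ← NNReal.coe_inj, Real.coe_toNNReal _ (by norm_num)]
      push_cast
      rw [norm_div, Complex.norm_real, Real.norm_eq_abs, div_pow, sq_abs,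
        Real.sq_sqrt (by norm_num)]
      simp
    have hnn : ∀ z, 0 ≤ avg (incs.map incVec) h z := by
      intro z
      rw [← avg_const (incs.map incVec) 0 z]
      exact avg_mono _ hh z
    have hx := x.1.2
    have e1 : (x.1 : ℕ) ≠ t := by omega
    have e2 : (x.1 : ℕ) ≠ t + 1 := by omega
    have key : ∀ (o : Bool) (y : Pt d) (reg' : ℕ → ℝ), regPt d reg' = y →
        wp F (randProg q t incs) κ ⟨reg', collapse q o (hadGate q zeroKet)⟩ ≤
          ENNReal.ofReal (1 / 2) * ENNReal.ofReal (avg (incs.map incVec) h y) := by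
      intro o y reg' hy
      rw [collapse_hadGate_zeroKet, hκ.wp F, hhalf, ← hy]
      gcongr
      exact ih reg'
    rw [randProg, List.flatMap_cons, wp_append, ← randProg]
    simp only [wp, Instr.wp, Instr.isMeasure, Instr.step, Bool.false_eq_true, if_false, if_true]
    refine (add_le_add (key false (regPt d reg) _ ?_) (key true (regPt d reg + incVec x) _
      ?_)).trans ?_
    · ext i
      by_cases hi : i = x.1
      · subst hi; simp [regPt, e1, e2]
      · have h3 : (i : ℕ) ≠ x.1 := fun h => hi (Fin.ext h)
        have h4 : (i : ℕ) ≠ t := by omega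
        have h5 : (i : ℕ) ≠ t + 1 := by omega
        simp [regPt, h4, h5]
    · ext i
      by_cases hi : i = x.1
      · subst hi; simp [regPt, e1, e2, incVec]
      · have h3 : (i : ℕ) ≠ x.1 := fun h => hi (Fin.ext h)
        have h4 : (i : ℕ) ≠ t := by omega
        have h5 : (i : ℕ) ≠ t + 1 := by omega
        simp [regPt, h3, h4, h5, incVec, hi]
    · rw [← ENNReal.ofReal_mul (by norm_num), ← ENNReal.ofReal_mul (by norm_num),
        ← ENNReal.ofReal_add (by have := hnn (regPt d reg); positivity)
          (by have := hnn (regPt d reg + incVec x); positivity)]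
      refine ENNReal.ofReal_le_ofReal (le_of_eq ?_)
      simp only [List.map_cons, avg]
      ring

end Random

/-! ### Phases of fixed-point numbers -/

section Bits

theorem mod_two_pow_eq_sum (x w : ℕ) :
    x % 2 ^ w = ∑ j ∈ Finset.range w, if x.testBit j then 2 ^ j else 0 := by
  induction w with
  | zero => simp [Nat.mod_one]
  | succ w ih =>
    rw [Nat.mod_pow_succ, ih, Finset.sum_range_succ, Nat.testBit_eq_decide_div_mod_eq]
    rcases Nat.mod_two_eq_zero_or_one (x / 2 ^ w) with h | h <;> simp [h]

/-- The weight of a bit in two's complement. -/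
def bitWeight (w j : ℕ) : ℤ := if j + 1 = w then -2 ^ j else 2 ^ j

theorem toInt_eq_sum {w : ℕ} (v : BitVec w) :
    v.toInt = ∑ j : Fin w, if v.getLsbD j then bitWeight w j else 0 := by
  rw [Fin.sum_univ_eq_sum_range (fun j => if v.getLsbD j then bitWeight w j else 0) w]
  have hn : (v.toNat : ℤ) = ∑ j ∈ Finset.range w, if v.getLsbD j then (2 : ℤ) ^ j else 0 := by
    have h1 := mod_two_pow_eq_sum v.toNat w
    rw [Nat.mod_eq_of_lt v.isLt] at h1
    rw [h1]
    push_cast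
    rfl
  cases w with
  | zero => simp [BitVec.eq_nil v]
  | succ w =>
    rw [BitVec.toInt_eq_msb_cond, hn, Finset.sum_range_succ, Finset.sum_range_succ]
    have hlow : ∑ j ∈ Finset.range w, (if v.getLsbD j then bitWeight (w + 1) j else 0) =
        ∑ j ∈ Finset.range w, if v.getLsbD j then (2 : ℤ) ^ j else 0 := by
      refine Finset.sum_congr rfl fun j hj => ?_
      have : j + 1 ≠ w + 1 := by have := Finset.mem_range.1 hj; omega
      rw [bitWeight, if_neg this]
    have hm : v.msb = v.getLsbD w := by rw [BitVec.msb_eq_getLsbD_last]; rfl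
    rw [hlow, hm, bitWeight, if_pos rfl]
    push_cast
    split_ifs <;> ring

/-- The output bits that matter for the phase `2π 2^m v`, with their angles. -/
def phaseAngles (w frac : ℕ) (m : ℤ) : List (Fin w × ℝ) :=
  ((List.finRange w).filter fun j : Fin w =>
    decide (-12 ≤ m + (j : ℕ) - frac ∧ m + (j : ℕ) - frac < 0)).map fun j =>
      (j, 2 * Real.pi * ((2 : ℝ) ^ m * bitWeight w j / 2 ^ frac))

theorem length_phaseAngles_le (w frac : ℕ) (m : ℤ) : (phaseAngles w frac m).length ≤ 12 := by
  rw [phaseAngles, List.length_map]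
  have hnd := (List.nodup_finRange w).filter fun j : Fin w =>
    decide (-12 ≤ m + (j : ℕ) - frac ∧ m + (j : ℕ) - frac < 0)
  rw [← List.toFinset_card_of_nodup hnd, ← Finset.card_range 12]
  refine Finset.card_le_card_of_injOn (fun j => (m + (j : ℕ) - frac + 12).toNat) ?_ ?_
  · intro j hj
    simp only [List.coe_toFinset, List.mem_filter, decide_eq_true_eq, Set.mem_ofPred_eq] at hj
    simp only [Finset.coe_range, Set.mem_Iio]
    omega
  · intro j hj j' hj' h
    simp only [List.coe_toFinset, List.mem_filter, decide_eq_true_eq, Set.mem_ofPred_eq] at hj hj'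
    simp only at h
    exact Fin.ext (by omega)

theorem abs_bitWeight (w j : ℕ) : |((bitWeight w j : ℤ) : ℝ)| = 2 ^ j := by
  unfold bitWeight
  split_ifs <;> simp

/-- Scaled bits of weight at least `1` contribute whole turns, with any sign in two's complement,
and those of weight below `2^(-12)` add up to at most `1/4096` of a turn. Only a window of twelve
bits needs gates, whatever the word length `w`. -/
theorem outputPhase_phaseAngles {w : ℕ} (frac : ℕ) (m : ℤ) (v : BitVec w) :
    ∃ n : ℤ, |outputPhase (phaseAngles w frac m) (fun j => v.getLsbD j) -
      2 * Real.pi * (2 ^ m * ((v.toInt : ℝ) / 2 ^ frac)) + n * (2 * Real.pi)| ≤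
        2 * Real.pi / 4096 := by
  classical
  set e : Fin w → ℝ := fun j =>
    if v.getLsbD j then (2 : ℝ) ^ m * bitWeight w j / 2 ^ frac else 0 with he
  have hpow : ∀ j : Fin w, (2 : ℝ) ^ m * 2 ^ (j : ℕ) / 2 ^ frac = 2 ^ (m + (j : ℕ) - frac) := by
    intro j
    rw [zpow_sub₀ (by norm_num), zpow_add₀ (by norm_num), zpow_natCast, zpow_natCast]
  have hout : outputPhase (phaseAngles w frac m) (fun j => v.getLsbD j) =
      2 * Real.pi * ∑ j : Fin w,
        if -12 ≤ m + (j : ℕ) - frac ∧ m + (j : ℕ) - frac < 0 then e j else 0 := by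
    have hl : ∀ l : List (Fin w), outputPhase ((l.filter fun j : Fin w =>
        decide (-12 ≤ m + (j : ℕ) - frac ∧ m + (j : ℕ) - frac < 0)).map fun j =>
        (j, 2 * Real.pi * ((2 : ℝ) ^ m * bitWeight w j / 2 ^ frac))) (fun j => v.getLsbD j) =
        2 * Real.pi * (l.map fun j : Fin w =>
          if -12 ≤ m + (j : ℕ) - frac ∧ m + (j : ℕ) - frac < 0 then e j else 0).sum := by
      intro l
      induction l with
      | nil => simp [outputPhase]
      | cons j l ih =>
        rw [List.filter_cons, List.map_cons, List.sum_cons, mul_add, ← ih]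
        by_cases hc : -12 ≤ m + (j : ℕ) - frac ∧ m + (j : ℕ) - frac < 0
        · simp only [hc, and_self, decide_true, if_true, List.map_cons, outputPhase, List.sum_cons,
            he]
          congr 1
          split_ifs <;> simp
        · rw [if_neg hc, if_neg (by simpa only [decide_eq_true_eq] using hc), mul_zero, zero_add]
    rw [phaseAngles, hl, ← List.sum_toFinset _ (List.nodup_finRange _), List.toFinset_finRange]
  have hint : (2 : ℝ) ^ m * ((v.toInt : ℝ) / 2 ^ frac) = ∑ j, e j := by
    rw [toInt_eq_sum]
    push_cast
    rw [Finset.sum_div, Finset.mul_sum]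
    refine Finset.sum_congr rfl fun j _ => ?_
    simp only [he]
    split_ifs <;> ring
  have hhigh : ∃ n : ℤ, ∑ j : Fin w, (if 0 ≤ m + (j : ℕ) - frac then e j else 0) = n := by
    have : ∀ j : Fin w, ∃ n : ℤ, (if 0 ≤ m + (j : ℕ) - frac then e j else 0) = (n : ℝ) := by
      intro j
      by_cases hc : 0 ≤ m + (j : ℕ) - frac
      · rw [if_pos hc]
        simp only [he]
        by_cases hv : v.getLsbD j
        · rw [if_pos hv]
          obtain ⟨k, hk⟩ := Int.eq_ofNat_of_zero_le hc
          have h1 := hpow j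
          rw [hk, zpow_natCast] at h1
          unfold bitWeight
          split_ifs
          · refine ⟨-2 ^ k, ?_⟩
            push_cast
            rw [← h1]; ring
          · refine ⟨2 ^ k, ?_⟩
            push_cast
            rw [← h1]
        · exact ⟨0, by rw [if_neg hv, Int.cast_zero]⟩
      · exact ⟨0, by rw [if_neg hc, Int.cast_zero]⟩
    choose n hn using this
    exact ⟨∑ j, n j, by push_cast; exact Finset.sum_congr rfl fun j _ => hn j⟩
  obtain ⟨n, hn⟩ := hhigh
  refine ⟨n, ?_⟩
  have hlow : |∑ j : Fin w, (if m + (j : ℕ) - frac < -12 then e j else 0)| ≤ 1 / 4096 := by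
    refine (Finset.abs_sum_le_sum_abs _ _).trans ?_
    have h1 : ∀ j : Fin w, |if m + (j : ℕ) - frac < -12 then e j else 0| ≤
        if m + (j : ℕ) - frac < -12 then (2 : ℝ) ^ m / 2 ^ frac * 2 ^ (j : ℕ) else 0 := by
      intro j
      split_ifs with hc
      · simp only [he]
        split_ifs
        · rw [abs_div, abs_mul, abs_bitWeight, abs_of_pos (by positivity),
            abs_of_pos (show (0 : ℝ) < 2 ^ frac by positivity)]
          exact le_of_eq (by ring)
        · rw [abs_zero]; positivity
      · simp
    refine (Finset.sum_le_sum fun j _ => h1 j).trans ?_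
    rw [Fin.sum_univ_eq_sum_range (fun j : ℕ => if m + (j : ℤ) - frac < -12 then
      (2 : ℝ) ^ m / 2 ^ frac * 2 ^ j else 0) w, ← Finset.sum_filter, ← Finset.mul_sum]
    rcases le_or_gt (frac - m - 12 : ℤ) 0 with hK | hK
    · rw [Finset.filter_false_of_mem fun j _ => by omega]
      norm_num
    · obtain ⟨K, hKe⟩ := Int.eq_ofNat_of_zero_le hK.le
      have h2 : ∑ j ∈ (Finset.range w).filter (fun j : ℕ => m + (j : ℤ) - frac < -12), 2 ^ j < 2 ^ K :=
        Nat.geomSum_lt le_rfl fun j hj => by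
          have := (Finset.mem_filter.1 hj).2
          omega
      have h3 : ∑ j ∈ (Finset.range w).filter (fun j : ℕ => m + (j : ℤ) - frac < -12),
          (2 : ℝ) ^ j ≤ 2 ^ K := by exact_mod_cast h2.le
      calc _ ≤ (2 : ℝ) ^ m / 2 ^ frac * 2 ^ K := by gcongr
        _ = 2 ^ (m - frac + K) := by
          rw [zpow_add₀ (by norm_num), zpow_sub₀ (by norm_num), zpow_natCast, zpow_natCast]
        _ = 1 / 4096 := by
          have h4 : m - frac + (K : ℤ) = -12 := by omega
          rw [h4]
          norm_num
  have hsplit : ∑ j, e j = ∑ j : Fin w, (if 0 ≤ m + (j : ℕ) - frac then e j else 0) +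
      ∑ j : Fin w, (if -12 ≤ m + (j : ℕ) - frac ∧ m + (j : ℕ) - frac < 0 then e j else 0) +
      ∑ j : Fin w, (if m + (j : ℕ) - frac < -12 then e j else 0) := by
    rw [← Finset.sum_add_distrib, ← Finset.sum_add_distrib]
    refine Finset.sum_congr rfl fun j _ => ?_
    split_ifs <;> first | omega | simp
  rw [hout, hint, hsplit, hn]
  have h5 : ∀ p q : ℝ, 2 * Real.pi * p - 2 * Real.pi * (n + p + q) + n * (2 * Real.pi) =
      -(2 * Real.pi * q) := by intros; ring
  rw [h5, abs_neg, abs_mul, abs_of_pos (by positivity)]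
  calc _ ≤ 2 * Real.pi * (1 / 4096) := by gcongr
    _ = _ := by ring

end Bits
end

noncomputable section

/-! ### The subgradient estimator -/

section Box

variable {d : ℕ}

/-- The average only sees points `x + l'.sum` for sublists `l'`; for grid increments these stay in
the box around `x`. -/
theorem avg_mono_of_sublist (l : List (Pt d)) {h h' : Pt d → ℝ} (x : Pt d)
    (hh : ∀ l' : List (Pt d), l'.Sublist l → h (x + l'.sum) ≤ h' (x + l'.sum)) : avg l h x ≤ avg l h' x := by
  induction l generalizing x with
  | nil => simpa [avg] using hh [] (List.Sublist.refl _)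
  | cons v l ih =>
    have h1 := ih x fun l' hl' => hh l' (hl'.cons v)
    have h2 := ih (x + v) fun l' hl' => by
      have := hh (v :: l') (hl'.cons_cons v)
      simpa [add_assoc] using this
    simp only [avg]
    linarith

theorem sum_gridIncs_apply_le {s : ℝ} (hs : 0 ≤ s) (n : ℕ) (i : Fin d) :
    (((gridIncs d s n).map incVec).map fun v => v i).sum ≤ s * 2 ^ n := by
  have key : ∀ l : List (Fin d), l.Nodup →
      (((l.flatMap fun i => (List.range n).map fun j => (i, 2 ^ j * s)).map incVec).map
        fun v => v i).sum = if i ∈ l then ((List.range n).map fun j => 2 ^ j * s).sum else 0 := by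
    intro l hl
    induction l with
    | nil => simp
    | cons i' l ih =>
      rw [List.nodup_cons] at hl
      rw [List.flatMap_cons, List.map_append, List.map_append, List.sum_append, ih hl.2]
      by_cases h : i = i'
      · subst h
        simp [hl.1, incVec, Function.comp_def]
      · simp [h, incVec, Function.comp_def]
  rw [gridIncs, key _ (List.nodup_finRange d), if_pos (List.mem_finRange i),
    ← List.sum_toFinset _ List.nodup_range, List.toFinset_range, ← Finset.sum_mul, mul_comm]
  gcongr
  have := Nat.geomSum_lt (m := 2) (n := n) (s := Finset.range n) le_rfl fun k hk =>
    Finset.mem_range.1 hk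
  have h := (Nat.cast_le (α := ℝ)).2 this.le
  push_cast at h
  exact h

theorem gridIncs_sublist_sum {s : ℝ} (hs : 0 ≤ s) (n : ℕ) {l' : List (Pt d)}
    (hl : l'.Sublist ((gridIncs d s n).map incVec)) (i : Fin d) :
    0 ≤ l'.sum i ∧ l'.sum i ≤ s * 2 ^ n := by
  have hproj : l'.sum i = (l'.map fun v => v i).sum :=
    map_list_sum (EuclideanSpace.proj i : Pt d →L[ℝ] ℝ) l'
  have hnn : ∀ r ∈ ((gridIncs d s n).map incVec).map fun v => v i, 0 ≤ r := by
    intro r hr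
    simp only [gridIncs, List.mem_map, List.mem_flatMap] at hr
    obtain ⟨v, ⟨y, ⟨i', -, j, -, rfl⟩, rfl⟩, rfl⟩ := hr
    simp only [incVec, PiLp.smul_apply, smul_eq_mul]
    have : (0 : ℝ) ≤ (EuclideanSpace.single i' (1 : ℝ) : Pt d) i := by
      by_cases h : i = i' <;> simp [h]
    positivity
  have hsub := hl.map fun v : Pt d => v i
  rw [hproj]
  refine ⟨List.sum_nonneg fun r hr => hnn r (hsub.subset hr), ?_⟩
  exact (hsub.sum_le_sum hnn).trans (sum_gridIncs_apply_le hs n i)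

end Box

/-! ### Good origins and the correctness of one subgradient estimate. -/

section Estimator

variable {d b w : ℕ}

/-- One factor is bounded by `2` and the other by the angle. Since the bound is linear in the angle,
control of the mean deviation of `f` suffices. -/
theorem sq_norm_exp_sub_exp_le (u v : ℝ) (n : ℤ) :
    ‖Complex.exp (u * Complex.I) - Complex.exp (v * Complex.I)‖ ^ 2 ≤
      2 * |u - v + n * (2 * Real.pi)| := by
  set y := u - v + n * (2 * Real.pi) with hy
  have e : Complex.exp (u * Complex.I) - Complex.exp (v * Complex.I) =
      Complex.exp (v * Complex.I) * (Complex.exp (Complex.I * y) - 1) := by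
    have h1 : Complex.exp (Complex.I * y) = Complex.exp ((u - v) * Complex.I) := by
      rw [hy]
      push_cast
      rw [← Complex.exp_periodic.int_mul n ((u - v : ℂ) * Complex.I)]
      congr 1
      ring
    rw [h1, mul_sub, mul_one, ← Complex.exp_add]
    congr 2
    ring
  rw [e, norm_mul, Complex.norm_exp_ofReal_mul_I, one_mul, sq]
  have h1 : ‖Complex.exp (Complex.I * y) - 1‖ ≤ |y| := Real.norm_exp_I_mul_ofReal_sub_one_le
  have h2 : ‖Complex.exp (Complex.I * y) - 1‖ ≤ 2 := by
    refine (norm_sub_le _ _).trans ?_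
    rw [mul_comm, Complex.norm_exp_ofReal_mul_I, norm_one]
    norm_num
  exact mul_le_mul h2 h1 (norm_nonneg _) (by norm_num)

/-- The displacement of the point of the hypergrid that belongs to a basis state. -/
def gridOffset (s : ℝ) (a : Basis d b w) : Pt d := WithLp.toLp 2 fun i => s * gridIndex a i

theorem gridPoint_eq (z : Pt d) (s : ℝ) (a : Basis d b w) :
    gridPoint (fun i => z i) s a = z + gridOffset s a := rfl

theorem exists_gridIndex_eq (a : Basis d b w) (i : Fin d) :
    ∃ k : ℕ, gridIndex a i = k ∧ k ≤ 2 ^ b := by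
  refine ⟨∑ j : Fin b, if a (Sum.inl (i, j)) then 2 ^ (j : ℕ) else 0, ?_, ?_⟩
  · rw [gridIndex]
    push_cast
    rfl
  · calc _ ≤ ∑ j : Fin b, 2 ^ (j : ℕ) := by
          refine Finset.sum_le_sum fun j _ => ?_
          split_ifs <;> simp
      _ = ∑ j ∈ Finset.range b, 2 ^ j := Fin.sum_univ_eq_sum_range (fun j => 2 ^ j) b
      _ ≤ 2 ^ b := (Nat.geomSum_lt le_rfl fun k hk => Finset.mem_range.1 hk).le

theorem gridOffset_apply_mem {s : ℝ} (hs : 0 ≤ s) (a : Basis d b w) (i : Fin d) :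
    0 ≤ gridOffset s a i ∧ gridOffset s a i ≤ s * 2 ^ b := by
  obtain ⟨k, hk, hkb⟩ := exists_gridIndex_eq a i
  have h : gridOffset s a i = s * k := by simp [gridOffset, hk]
  rw [h]
  refine ⟨by positivity, ?_⟩
  have h1 := (Nat.cast_le (α := ℝ)).2 hkb
  push_cast at h1
  exact mul_le_mul_of_nonneg_left h1 hs

/-- The average deviation of `f` from its affine minorant with slope `g` at `z`. -/
def deviation (b w : ℕ) (f : Pt d → ℝ) (s : ℝ) (g : Pt d → Pt d) (z : Pt d) : ℝ :=
  ∑ a : Basis d b w, ‖(uniformKet : QState d b w) a‖ ^ 2 *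
    (f (z + gridOffset s a) - f z - inner ℝ (g z) (gridOffset s a))

theorem sum_sq_norm_uniformKet :
    ∑ a : Basis d b w, ‖(uniformKet : QState d b w) a‖ ^ 2 = 1 := by
  rw [← coe_normSq, normSq_uniformKet, NNReal.coe_one]

theorem deviation_nonneg {f : Pt d → ℝ} {s : ℝ} {g : Pt d → Pt d}
    (hg : ∀ z q, f z + inner ℝ (g z) (q - z) ≤ f q) (z : Pt d) : 0 ≤ deviation b w f s g z := by
  refine Finset.sum_nonneg fun a _ => mul_nonneg (sq_nonneg _) ?_
  have := hg z (z + gridOffset s a)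
  rw [add_sub_cancel_left] at this
  linarith

/-- The subgradient inequality at `z - y` bounds `-⟨g z, y⟩` by `f (z - y) - f z`, so each deviation
is at most a second difference. -/
theorem avg_deviation_le {p : ℝ≥0∞} {f : Pt d → ℝ} {s G ϑ : ℝ} (hs : 0 ≤ s)
    (hG : 0 ≤ G) (hϑ0 : 0 ≤ ϑ) (hϑ : ∀ x : Pt d, lpNorm p x ≤ ϑ * lpNorm ∞ x)
    (hf : IsLpLipschitz p G f) {g : Pt d → Pt d}
    (hg : ∀ z q, f z + inner ℝ (g z) (q - z) ≤ f q) (n : ℕ) (x : Pt d) :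
    avg ((gridIncs d s n).map incVec) (deviation b w f s g) x ≤
      d * 2 ^ b * (2 * (G * (ϑ * (s * 2 ^ b))) / 2 ^ n) := by
  calc _ ≤ avg ((gridIncs d s n).map incVec) (fun z => ∑ a : Basis d b w,
        ‖(uniformKet : QState d b w) a‖ ^ 2 *
          (f (z + gridOffset s a) + f (z - gridOffset s a) - 2 * f z)) x := by
        refine avg_mono _ (fun z => Finset.sum_le_sum fun a _ => ?_) x
        refine mul_le_mul_of_nonneg_left ?_ (sq_nonneg _)
        have := hg z (z - gridOffset s a)
        rw [sub_sub_cancel_left, inner_neg_right] at this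
        linarith
    _ = ∑ a : Basis d b w, ‖(uniformKet : QState d b w) a‖ ^ 2 *
          avg ((gridIncs d s n).map incVec)
            (fun z => f (z + gridOffset s a) + f (z - gridOffset s a) - 2 * f z) x := by
        rw [avg_sum]
        exact Finset.sum_congr rfl fun a _ => avg_const_mul _ _ _ _
    _ ≤ ∑ a : Basis d b w, ‖(uniformKet : QState d b w) a‖ ^ 2 *
          (d * 2 ^ b * (2 * (G * (ϑ * (s * 2 ^ b))) / 2 ^ n)) := by
        gcongr with a
        choose k hk hkb using exists_gridIndex_eq a
        refine avg_second_difference_le k (fun i => by exact_mod_cast hkb i) ?_ (fun z => ?_)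
          (by positivity) x
        · ext i
          simp [gridOffset, hk, Finset.sum_apply, Pi.single_apply, mul_comm]
        · refine (hf _ _).trans ?_
          rw [add_sub_cancel_left]
          gcongr
          refine (hϑ _).trans ?_
          gcongr
          refine lpNorm_top_le (by positivity) fun i => ?_
          obtain ⟨h1, h2⟩ := gridOffset_apply_mem hs a i
          rw [abs_of_nonneg h1]
          exact h2
    _ = _ := by rw [← Finset.sum_mul, sum_sq_norm_uniformKet, one_mul]

/-- By `hsG` one grid step in direction `i` turns the phase by `2π g_i / (8 G)`. The phase error has
three sources: dropped bits, oracle error and deviation of `f`, with total `2 (2π / 4096 + 1/400) +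
2/400 < 1/64`. -/
theorem phasesClose_of_deviation_le {F : Pt d → BitVec w} {f : Pt d → ℝ} {g : Pt d → Pt d}
    {s G θ : ℝ} {m : ℤ} {frac : ℕ} {z : Pt d} (hG : 0 < G) (hsG : 8 * G * (2 ^ m * s) = 1)
    (hg : ∀ z q, f z + inner ℝ (g z) (q - z) ≤ f q)
    (hF : ∀ a : Basis d b w, |((F (z + gridOffset s a)).toInt : ℝ) / 2 ^ frac -
      f (z + gridOffset s a)| ≤ θ) (hθ : 2 * Real.pi * 2 ^ m * θ ≤ 1 / 400)
    (hdev : 2 * Real.pi * 2 ^ m * deviation b w f s g z ≤ 1 / 400) :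
    PhasesClose F b s (phaseAngles w frac m) z fun i => g z i / (8 * G) := by
  set S : ℝ := 2 * Real.pi * 2 ^ m with hS
  have hS0 : 0 < S := by positivity
  refine ⟨S * f z, ?_⟩
  have hlin : ∀ a : Basis d b w, linearPhase (S * f z) (fun i => g z i / (8 * G)) a =
      S * (f z + inner ℝ (g z) (gridOffset s a)) := by
    intro a
    rw [linearPhase, inner_eq_sum, mul_add, Finset.mul_sum, Finset.mul_sum]
    congr 1
    refine Finset.sum_congr rfl fun i _ => ?_
    simp only [gridOffset]
    rw [hS]
    field_simp
    linear_combination (-(g z i) * gridIndex a i) * hsG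
  have hterm : ∀ a : Basis d b w,
      ‖Complex.exp (oraclePhase F (phaseAngles w frac m) z s a * Complex.I) -
        Complex.exp (linearPhase (S * f z) (fun i => g z i / (8 * G)) a * Complex.I)‖ ^ 2 ≤
      2 * (2 * Real.pi / 4096 + S * θ +
        S * (f (z + gridOffset s a) - f z - inner ℝ (g z) (gridOffset s a))) := by
    intro a
    obtain ⟨n, hn⟩ := outputPhase_phaseAngles frac m (F (z + gridOffset s a))
    refine (sq_norm_exp_sub_exp_le _ _ n).trans ?_
    gcongr
    rw [hlin, oraclePhase, gridPoint_eq]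
    have h1 := hg z (z + gridOffset s a)
    rw [add_sub_cancel_left] at h1
    have h2 := hF a
    rw [← mul_assoc, ← hS] at hn
    set P := outputPhase (phaseAngles w frac m)
      fun j => (F (z + gridOffset s a)).getLsbD j
    set v := ((F (z + gridOffset s a)).toInt : ℝ) / 2 ^ frac
    have h3 : 0 ≤ S * (f (z + gridOffset s a) - f z - inner ℝ (g z) (gridOffset s a)) :=
      mul_nonneg hS0.le (by linarith)
    have h4 : |S * (v - f (z + gridOffset s a))| ≤ S * θ := by
      rw [abs_mul, abs_of_pos hS0]; gcongr
    rw [abs_le] at hn h4 ⊢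
    constructor <;> nlinarith
  calc _ ≤ ∑ a : Basis d b w, ‖(uniformKet : QState d b w) a‖ ^ 2 *
        (2 * (2 * Real.pi / 4096 + S * θ +
        S * (f (z + gridOffset s a) - f z - inner ℝ (g z) (gridOffset s a)))) :=
        Finset.sum_le_sum fun a _ => mul_le_mul_of_nonneg_left (hterm a) (sq_nonneg _)
    _ = 2 * (2 * Real.pi / 4096 + S * θ) * (∑ a : Basis d b w,
          ‖(uniformKet : QState d b w) a‖ ^ 2) + 2 * (S * deviation b w f s g z) := by
        rw [deviation, Finset.mul_sum, Finset.mul_sum, Finset.mul_sum, ← Finset.sum_add_distrib]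
        exact Finset.sum_congr rfl fun a _ => by ring
    _ ≤ 1 / 64 := by
        rw [sum_sq_norm_uniformKet, mul_one]
        have := Real.pi_lt_d2
        linarith

/-- The program that estimates a subgradient at the point in the registers `0, …, d - 1`. -/
def gradProg (q : Qubit d b w) (s G : ℝ) (J : List (Fin w × ℝ)) (n r : ℕ) : List (Instr d b w) :=
  randProg q d (gridIncs d s n) ++ (runsProg s G J d (d + 3) r ++
    voteList (4 * (512 * G / 2 ^ b) ^ 2) d (d + 3) r (List.finRange d))

/-- `v` is close to a subgradient of `f` at some point close to `x`. -/
def NearSubgradient (f : Pt d → ℝ) (x : Pt d) (ρ δ : ℝ) (v : Pt d) : Prop :=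
  ∃ z g : Pt d, (∀ i, |z i - x i| ≤ ρ) ∧ (∀ q, f z + inner ℝ g (q - z) ≤ f q) ∧
    ∀ i, |v i - g i| ≤ δ

theorem expect_estimate (F : Pt d → BitVec w) (prog : List (Instr d b w)) (x : Pt d)
    (φ : Pt d → ℝ≥0∞) : expect (estimate F prog x) φ =
      wp F prog (weight fun reg => φ (regPt d reg)) ⟨(initConfig b w x).reg, zeroKet⟩ := by
  rw [estimate, expect_map, ← normSq_mul_expect, normSq_zeroKet, ENNReal.coe_one, one_mul]
  rfl

theorem expect_gradProg_le {p : ℝ≥0∞} (hp : 1 ≤ p) {F : Pt d → BitVec w} {f : Pt d → ℝ}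
    {s G θ ϑ : ℝ} {m : ℤ} {frac : ℕ} (q : Qubit d b w) (n r : ℕ) (hG : 0 < G) (hs : 0 < s)
    (hsG : 8 * G * (2 ^ m * s) = 1) (hϑ0 : 0 ≤ ϑ)
    (hϑ : ∀ x : Pt d, lpNorm p x ≤ ϑ * lpNorm ∞ x) (hb : (512 : ℝ) ≤ 2 ^ b)
    (hconv : ConvexOn ℝ Set.univ f) (hf : IsLpLipschitz p G f)
    (hθ : 2 * Real.pi * 2 ^ m * θ ≤ 1 / 400) (x : Pt d)
    (hF : ∀ y : Pt d, (∀ i, |y i - x i| ≤ s * (2 ^ n + 2 ^ b)) →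
      |((F y).toInt : ℝ) / 2 ^ frac - f y| ≤ θ) :
    expect (estimate F (gradProg q s G (phaseAngles w frac m) n r) x)
      ({v | NearSubgradient f x (s * 2 ^ n) (3 * (512 * G / 2 ^ b)) v}ᶜ.indicator 1) ≤
      ENNReal.ofReal (d / 2 ^ r + 640 * (ϑ * d * (2 ^ b) ^ 2 / 2 ^ n)) := by
  classical
  have hcont : Continuous f := hf.continuous hG.le hϑ0 hϑ
  choose g hg using exists_subgradient hconv hcont
  set S : ℝ := 2 * Real.pi * 2 ^ m with hS
  have hS0 : 0 < S := by positivity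
  set box : Pt d → Prop := fun z => ∀ i, |z i - x i| ≤ s * 2 ^ n with hbox
  -- `h z` bounds the failure at origin `z`: the vote at a good origin, and otherwise Markov's
  -- inequality, as `400 S deviation > 1` at a bad one. Outside the box the oracle is not
  -- controlled, but such origins never occur.
  set h : Pt d → ℝ := fun z =>
    if box z then d / 2 ^ r + 400 * S * deviation b w f s g z else 1 with hh
  have hdev := fun z => deviation_nonneg (b := b) (w := w) (s := s) hg z
  have hh0 : ∀ z, 0 ≤ h z := by
    intro z
    simp only [hh]
    split_ifs
    · have := hdev z
      positivity
    · norm_num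
  set bad : Set (Pt d) := {v | NearSubgradient f x (s * 2 ^ n) (3 * (512 * G / 2 ^ b)) v}ᶜ with hbad
  rw [expect_estimate, gradProg, wp_append]
  have hx0 : regPt d (initConfig b w x).reg = x := by
    ext i
    simp [regPt, initConfig]
  refine (wp_randProg_le F ((isHomogeneous_weight _).wp F _) hh0 (fun reg => ?_) q le_rfl
    (gridIncs d s n) _).trans ?_
  · have hφ1 : ∀ reg : ℕ → ℝ, bad.indicator (1 : Pt d → ℝ≥0∞) (regPt d reg) ≤ 1 := by
      intro reg
      by_cases hb : regPt d reg ∈ bad <;> simp [hb]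
    have htriv : wp F (runsProg s G (phaseAngles w frac m) d (d + 3) r ++
        voteList (4 * (512 * G / 2 ^ b) ^ 2) d (d + 3) r (List.finRange d))
        (weight fun reg => bad.indicator 1 (regPt d reg)) (⟨reg, zeroKet⟩ : Config d b w) ≤ 1 := by
      have h1 := wp_weight_one F (runsProg s G (phaseAngles w frac m) d (d + 3) r ++
        voteList (4 * (512 * G / 2 ^ b) ^ 2) d (d + 3) r (List.finRange d))
        (⟨reg, zeroKet⟩ : Config d b w)
      rw [normSq_zeroKet, ENNReal.coe_one] at h1
      rw [← h1]
      refine wp_mono F (fun c => ?_) _ _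
      unfold weight
      gcongr
      exact hφ1 _
    set z := regPt d reg with hz
    by_cases hzbox : box z
    · simp only [hh, if_pos hzbox]
      by_cases hgood : S * deviation b w f s g z ≤ 1 / 400
      · have hclose := phasesClose_of_deviation_le (F := F) (frac := frac) hG hsG hg (fun a => by
          refine hF _ fun i => ?_
          obtain ⟨h1, h2⟩ := gridOffset_apply_mem hs.le a i
          have h3 := hzbox i
          rw [abs_le] at h3 ⊢
          simp only [PiLp.add_apply]
          constructor <;> nlinarith) hθ hgood
        refine (wp_runs_vote_le hG.le le_rfl (by omega) hb (fun i => ?_) hclose r (fun i => rfl)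
          (fun reg => bad.indicator 1 (regPt d reg)) hφ1 fun reg' hreg' => ?_).trans ?_
        · rw [abs_div, abs_of_pos (show 0 < 8 * G by positivity), div_le_iff₀ (by positivity)]
          have := abs_subgradient_apply_le hp hf (hg z) i
          linarith
        · refine Set.indicator_of_notMem ?_ _
          rw [hbad, Set.notMem_compl_iff]
          refine ⟨z, g z, hzbox, hg z, fun i => ?_⟩
          have := hreg' i
          rwa [mul_div_cancel₀ _ (show 8 * G ≠ 0 by positivity)] at this
        · have e : (d : ℝ≥0∞) * (2 ^ r)⁻¹ = ENNReal.ofReal (d / 2 ^ r) := by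
            rw [div_eq_mul_inv, ENNReal.ofReal_mul (by positivity), ENNReal.ofReal_natCast,
              ENNReal.ofReal_inv_of_pos (by positivity), ENNReal.ofReal_pow (by norm_num)]
            norm_num
          rw [e]
          refine ENNReal.ofReal_le_ofReal ?_
          have := hdev z
          have h5 : 0 ≤ 400 * S * deviation b w f s g z := by positivity
          linarith
      · refine htriv.trans ?_
        rw [← ENNReal.ofReal_one]
        refine ENNReal.ofReal_le_ofReal ?_
        have h5 : (0 : ℝ) ≤ d / 2 ^ r := by positivity
        push Not at hgood
        linarith
    · simp only [hh, if_neg hzbox, ENNReal.ofReal_one]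
      exact htriv
  · rw [hx0]
    refine ENNReal.ofReal_le_ofReal ?_
    calc avg ((gridIncs d s n).map incVec) h x
        ≤ avg ((gridIncs d s n).map incVec) (fun z => d / 2 ^ r + 400 * S *
            deviation b w f s g z) x := by
          refine avg_mono_of_sublist _ _ fun l' hl' => le_of_eq ?_
          simp only [hh]
          refine if_pos fun i => ?_
          obtain ⟨h1, h2⟩ := gridIncs_sublist_sum hs.le n hl' i
          rw [PiLp.add_apply, add_sub_cancel_left, abs_of_nonneg h1]
          exact h2
      _ = d / 2 ^ r + 400 * S * avg ((gridIncs d s n).map incVec) (deviation b w f s g) x := by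
          rw [avg_add, avg_const, avg_const_mul]
      _ ≤ d / 2 ^ r + 400 * S * (d * 2 ^ b * (2 * (G * (ϑ * (s * 2 ^ b))) / 2 ^ n)) := by
          gcongr
          exact avg_deviation_le hs.le hG.le hϑ0 hϑ hf hg n x
      -- `400 · 2π · 2 / 8 = 200 π`, and `π < 3.15` gives at most `640`.
      _ = d / 2 ^ r + 200 * Real.pi * (ϑ * d * (2 ^ b) ^ 2 / 2 ^ n) * (8 * G * (2 ^ m * s)) := by
          rw [hS]; ring
      _ ≤ _ := by
          rw [hsG, mul_one]
          gcongr
          have := Real.pi_lt_d2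
          linarith

end Estimator
end

noncomputable section

/-! ### Costs -/

section Costs

variable {d b w : ℕ}

theorem queryCount_append (l₁ l₂ : List (Instr d b w)) :
    queryCount (l₁ ++ l₂) = queryCount l₁ + queryCount l₂ := List.countP_append

theorem queryCount_flatMap_eq_zero {α : Type*} (l : List α) {f : α → List (Instr d b w)}
    (h : ∀ a, queryCount (f a) = 0) : queryCount (l.flatMap f) = 0 := by
  induction l with
  | nil => rfl
  | cons a l ih => rw [List.flatMap_cons, queryCount_append, h, ih]

theorem length_flatMap_eq {α β : Type*} (l : List α) {f : α → List β} {n : ℕ}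
    (h : ∀ a, (f a).length = n) : (l.flatMap f).length = l.length * n := by
  induction l with
  | nil => simp
  | cons a l ih => rw [List.flatMap_cons, List.length_append, h, ih, List.length_cons]; ring

theorem cost_stages (i : Fin d) (V t n : ℕ) (hn : n ≤ b) :
    (stages i V t n hn : List (Instr d b w)).length = n * 8 ∧
      queryCount (stages i V t n hn : List (Instr d b w)) = 0 := by
  induction n with
  | zero => exact ⟨rfl, rfl⟩
  | succ n ih =>
    obtain ⟨h1, h2⟩ := ih (Nat.le_of_succ_le hn)
    constructor
    · rw [stages, List.length_append, h1]
      simp [stage]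
      ring
    · rw [stages, queryCount_append, h2]
      rfl

theorem cost_runProg (s G : ℝ) (J : List (Fin w × ℝ)) (t V : ℕ) :
    (runProg s G J t V : List (Instr d b w)).length =
        3 + d * b + J.length * 2 + d * (b * 8 + 8) ∧
      queryCount (runProg s G J t V : List (Instr d b w)) = 2 := by
  have hm : ∀ i : Fin d, (measCoord G i (V + i) t : List (Instr d b w)).length = b * 8 + 8 ∧
      queryCount (measCoord G i (V + i) t : List (Instr d b w)) = 0 := by
    intro i
    obtain ⟨h1, h2⟩ := cost_stages (w := w) i (V + i) t b le_rfl
    constructor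
    · simp [measCoord, h1, decode]
    · have : queryCount (measCoord G i (V + i) t : List (Instr d b w)) =
          queryCount (stages i (V + i) t b le_rfl ++ decode G (V + i) t : List (Instr d b w)) :=
        List.countP_cons_of_neg (by simp [Instr.isQuery])
      rw [this, queryCount_append, h2]
      rfl
  have hJ : (J.flatMap fun x => [(.const t x.2 : Instr d b w), .phase (Sum.inr x.1) t]).length =
      J.length * 2 := length_flatMap_eq _ fun _ => rfl
  have hJ' : queryCount (J.flatMap fun x => [(.const t x.2 : Instr d b w),
      .phase (Sum.inr x.1) t]) = 0 := queryCount_flatMap_eq_zero _ fun _ => rfl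
  have hI : (inputQubits d b w).length = d * b := by
    rw [inputQubits, length_flatMap_eq _ (n := b) (by simp)]
    simp
  have hH : queryCount ((inputQubits d b w).map Instr.had) = 0 := by
    rw [queryCount, List.countP_eq_zero]
    intro a ha
    obtain ⟨q, -, rfl⟩ := List.mem_map.1 ha
    simp [Instr.isQuery]
  constructor
  · rw [runProg, List.length_append, measList, length_flatMap_eq _ fun i => (hm i).1]
    simp only [prep, List.length_cons, List.length_append, List.length_map, hI, hJ,
      List.length_nil, List.length_finRange]
    ring
  · rw [runProg, queryCount_append, measList, queryCount_flatMap_eq_zero _ fun i => (hm i).2]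
    have : queryCount (prep s J t : List (Instr d b w)) =
        queryCount ((inputQubits d b w).map Instr.had) + (queryCount (J.flatMap fun x =>
          [(.const t x.2 : Instr d b w), .phase (Sum.inr x.1) t]) + 1 + 1) := by
      simp only [prep, queryCount, List.countP_cons, List.countP_append, Instr.isQuery]
      simp
    rw [this, hH, hJ']

theorem cost_runsProg (s G : ℝ) (J : List (Fin w × ℝ)) (t V r : ℕ) :
    (runsProg s G J t V r : List (Instr d b w)).length =
        r * (3 + d * b + J.length * 2 + d * (b * 8 + 8)) ∧
      queryCount (runsProg s G J t V r : List (Instr d b w)) = r * 2 := by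
  constructor
  · rw [runsProg, length_flatMap_eq _ fun ρ => (cost_runProg s G J t (V + ρ * d)).1,
      List.length_range]
  · induction r with
    | zero => rfl
    | succ r ih =>
      rw [runsProg_succ, queryCount_append, ih, (cost_runProg s G J t (V + r * d)).2]
      ring

theorem cost_voteList (D : ℝ) (t V r : ℕ) :
    (voteList D t V r (List.finRange d) : List (Instr d b w)).length =
        d * (r * (r * 4 + 7)) ∧
      queryCount (voteList D t V r (List.finRange d) : List (Instr d b w)) = 0 := by
  have hc : ∀ u (W : ℕ → ℕ), (countProg D t u W r : List (Instr d b w)).length = r * 4 + 2 ∧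
      queryCount (countProg D t u W r : List (Instr d b w)) = 0 := by
    intro u W
    constructor
    · rw [countProg, List.length_append, length_flatMap_eq _ (n := 4) fun _ => rfl,
        List.length_range]
      simp only [List.length_cons, List.length_nil]
      ring
    · rw [countProg, queryCount_append, queryCount_flatMap_eq_zero _ fun _ => rfl]
      rfl
  have hs : ∀ o (W : ℕ → ℕ) a, (selectProg D t o W r a : List (Instr d b w)).length = r * 4 + 7 ∧
      queryCount (selectProg D t o W r a : List (Instr d b w)) = 0 := by
    intro o W a
    constructor
    · rw [selectProg, List.length_append, (hc _ _).1]
      rfl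
    · rw [selectProg, queryCount_append, (hc _ _).2]
      rfl
  constructor
  · rw [voteList, length_flatMap_eq _ (n := r * (r * 4 + 7)), List.length_finRange]
    intro i
    rw [voteProg, length_flatMap_eq _ fun a => (hs _ _ a).1, List.length_range]
  · exact queryCount_flatMap_eq_zero _ fun i => queryCount_flatMap_eq_zero _ fun a => (hs _ _ a).2

theorem queryCount_gradProg (q : Qubit d b w) (s G : ℝ) (J : List (Fin w × ℝ)) (n r : ℕ) :
    queryCount (gradProg q s G J n r) = r * 2 := by
  rw [gradProg, queryCount_append, queryCount_append, (cost_voteList _ _ _ _).2,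
    (cost_runsProg _ _ _ _ _ _).2, randProg, queryCount_flatMap_eq_zero _ fun _ => rfl]
  ring

theorem length_gradProg_le (q : Qubit d b w) (s G : ℝ) {J : List (Fin w × ℝ)} (hJ : J.length ≤ 12)
    (n r : ℕ) : (gradProg q s G J n r).length ≤
      d * n * 5 + r * (27 + d * b + d * (b * 8 + 8)) + d * (r * (r * 4 + 7)) := by
  rw [gradProg, List.length_append, List.length_append, (cost_voteList _ _ _ _).1,
    (cost_runsProg _ _ _ _ _ _).1, randProg, length_flatMap_eq _ (n := 5) fun _ => rfl,
    gridIncs, length_flatMap_eq _ (n := n) (by simp), List.length_finRange, ← add_assoc]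
  have : 3 + d * b + J.length * 2 ≤ 27 + d * b := by omega
  gcongr

end Costs
end

noncomputable section

/-! ### Mirror descent with estimated subgradients -/

section Descent

variable {d b w : ℕ}

theorem NearSubgradient.inner_le {p : ℝ≥0∞} (hp : 1 ≤ p) {f : Pt d → ℝ} {G ϑs δ ρ : ℝ}
    (hf : IsLpLipschitz p G f) (hδ : 0 ≤ δ) (hϑs0 : 0 ≤ ϑs)
    (hϑs : ∀ x : Pt d, dualLpNorm p x ≤ ϑs * lpNorm ∞ x) {x v : Pt d}
    (h : NearSubgradient f x ρ δ v) (u : Pt d) : inner ℝ v u ≤ (G + ϑs * δ) * lpNorm p u := by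
  obtain ⟨z, g, -, hg, hv⟩ := h
  have h1 := inner_subgradient_le hf hg u
  have h2 := inner_le_dualLpNorm_mul hp (v - g) u
  have h3 : dualLpNorm p (v - g) ≤ ϑs * δ :=
    (hϑs _).trans (mul_le_mul_of_nonneg_left (lpNorm_top_le hδ hv) hϑs0)
  have h4 := mul_le_mul_of_nonneg_right h3 (lpNorm_nonneg hp u)
  rw [inner_sub_left] at h2
  linarith

/-- Moving the base point from `z` to `x` costs `G ϑ ρ` twice, once in the value of `f` and once in
the linear term. The coordinate error of `v` pairs with `q - x`, of norm at most the diameter. -/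
theorem NearSubgradient.isApproxSubgradient {p : ℝ≥0∞} (hp : 1 ≤ p) {X : Set (Pt d)}
    (hb : Bornology.IsBounded X) {f : Pt d → ℝ} {G ϑ ϑs δ ρ : ℝ} (hG : 0 ≤ G)
    (hf : IsLpLipschitz p G f) (hδ : 0 ≤ δ) (hρ : 0 ≤ ρ) (hϑ0 : 0 ≤ ϑ)
    (hϑ : ∀ x : Pt d, lpNorm p x ≤ ϑ * lpNorm ∞ x) (hϑs0 : 0 ≤ ϑs)
    (hϑs : ∀ x : Pt d, dualLpNorm p x ≤ ϑs * lpNorm ∞ x) {x v : Pt d} (hx : x ∈ X)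
    (h : NearSubgradient f x ρ δ v) :
    IsApproxSubgradient X f (2 * (G * (ϑ * ρ)) + ϑs * δ * lpDiam p X) x v := by
  obtain ⟨z, g, hz, hg, hv⟩ := h
  intro q hq
  have h1 : lpNorm p (x - z) ≤ ϑ * ρ := by
    refine (hϑ _).trans (mul_le_mul_of_nonneg_left (lpNorm_top_le hρ fun i => ?_) hϑ0)
    rw [PiLp.sub_apply, abs_sub_comm]
    exact hz i
  have h2 : f x - f z ≤ G * (ϑ * ρ) :=
    (le_abs_self _).trans ((hf x z).trans (mul_le_mul_of_nonneg_left h1 hG))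
  have h3 : inner ℝ g (z - x) ≤ G * (ϑ * ρ) := by
    refine (inner_subgradient_le hf hg _).trans (mul_le_mul_of_nonneg_left ?_ hG)
    rwa [← neg_sub, lpNorm_neg hp]
  have h4 := inner_le_dualLpNorm_mul hp (v - g) (q - x)
  have h5 : dualLpNorm p (v - g) ≤ ϑs * δ :=
    (hϑs _).trans (mul_le_mul_of_nonneg_left (lpNorm_top_le hδ hv) hϑs0)
  have h6 := mul_le_mul_of_nonneg_right h5 (lpNorm_nonneg hp (q - x))
  have h7 := mul_le_mul_of_nonneg_left (lpNorm_sub_le_lpDiam hb hϑ0 hϑ hq hx)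
    (mul_nonneg hϑs0 hδ)
  have h8 := hg q
  have e : inner ℝ g (q - z) = inner ℝ g (q - x) - inner ℝ g (z - x) := by
    rw [← inner_sub_right, sub_sub_sub_cancel_right]
  rw [inner_sub_left] at h4
  linarith

/-- The regret bound that the state of mirror descent satisfies after `t` accurate steps: the sum
of the iterates is `t` times a feasible point whose value is controlled. -/
def RegretBound (X P : Set (Pt d)) (Φ f : Pt d → ℝ) (xs : Pt d) (η B D : ℝ) (t : ℕ)
    (s : Pt d × Pt d) : Prop :=
  s.1 ∈ X ∩ P ∧ ∃ a ∈ X, s.2 = (t : ℝ) • a ∧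
    η * (t * (f a - f xs)) ≤ D - bregman Φ xs s.1 + t * B

/-- The new average is a convex combination of the old one and the current iterate, so convexity of
`f` adds their values and `mirrorStep_regret` telescopes. -/
theorem RegretBound.succ {p : ℝ≥0∞} (hp : 1 ≤ p) {X P : Set (Pt d)} {Φ f : Pt d → ℝ}
    (hcl : IsClosed X) (hb : Bornology.IsBounded X) (hX : Convex ℝ X) (hm : IsMirrorMap X P Φ)
    {μ η H α D : ℝ} (hsc : IsLpStronglyConvexOn p μ (X ∩ P) Φ) (hμ : 0 < μ) (hη : 0 ≤ η)
    (hf : ConvexOn ℝ Set.univ f) {xs : Pt d} (hxs : xs ∈ X ∩ P) {t : ℕ} {s : Pt d × Pt d}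
    (hs : RegretBound X P Φ f xs η (η * α + (H * η) ^ 2 / (2 * μ)) D t s) {g : Pt d}
    (hg : IsApproxSubgradient X f α s.1 g) (hgH : ∀ v, inner ℝ g v ≤ H * lpNorm p v) :
    RegretBound X P Φ f xs η (η * α + (H * η) ^ 2 / (2 * μ)) D (t + 1)
      (mirrorStep X P Φ η s.1 g, s.2 + s.1) := by
  obtain ⟨hx, a, ha, hsa, hbd⟩ := hs
  refine ⟨(mirrorStep_spec hcl hb hX hm η s.1 g).1, ?_⟩
  have ht : (0 : ℝ) < t + 1 := by positivity
  have hw : (t : ℝ) / (t + 1) + 1 / (t + 1) = 1 := by field_simp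
  refine ⟨((t : ℝ) / (t + 1)) • a + ((1 : ℝ) / (t + 1)) • s.1,
    hX ha hx.1 (by positivity) (by positivity) hw, ?_, ?_⟩
  · rw [hsa, smul_add, smul_smul, smul_smul]
    push_cast
    rw [mul_div_cancel₀ _ ht.ne', mul_div_cancel₀ _ ht.ne', one_smul]
  · have h1 := hf.2 (Set.mem_univ a) (Set.mem_univ s.1)
      (show 0 ≤ (t : ℝ) / (t + 1) by positivity) (show 0 ≤ (1 : ℝ) / (t + 1) by positivity) hw
    set y := ((t : ℝ) / (t + 1)) • a + ((1 : ℝ) / (t + 1)) • s.1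
    have h2 : (t + 1) * f y ≤ t * f a + f s.1 := by
      have := mul_le_mul_of_nonneg_left h1 ht.le
      simp only [smul_eq_mul] at this
      calc _ ≤ _ := this
        _ = _ := by field_simp
    have h3 := mirrorStep_regret hp hcl hb hX hm hsc hμ hη hx hxs hgH
    have h4 := hg xs hxs.1
    have e : inner ℝ g (xs - s.1) = -inner ℝ g (s.1 - xs) := by rw [← inner_neg_right, neg_sub]
    rw [e] at h4
    have h5 : η * (f s.1 - f xs) ≤ η * (inner ℝ g (s.1 - xs) + α) :=
      mul_le_mul_of_nonneg_left (by linarith) hη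
    have h6 := mul_le_mul_of_nonneg_left h2 hη
    push_cast
    linarith

/-- Union bound by induction. The estimator is good at every point of `X`, so the distribution of
the iterate does not matter; once the regret bound is lost, the failure is counted as certain. -/
theorem expect_mirrorDescent_le {p : ℝ≥0∞} (hp : 1 ≤ p) {X P : Set (Pt d)} {Φ f : Pt d → ℝ}
    (hcl : IsClosed X) (hb : Bornology.IsBounded X) (hX : Convex ℝ X) (hm : IsMirrorMap X P Φ)
    {μ η H α δ : ℝ} (hsc : IsLpStronglyConvexOn p μ (X ∩ P) Φ) (hμ : 0 < μ) (hη : 0 ≤ η)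
    (hf : ConvexOn ℝ Set.univ f) {x₁ xs : Pt d} (hx₁ : x₁ ∈ X ∩ P) (hxs : xs ∈ X ∩ P)
    (hδ : 0 ≤ δ) {F : Pt d → BitVec w} {prog : List (Instr d b w)}
    (hest : ∀ x ∈ X, expect (estimate F prog x) ({g | IsApproxSubgradient X f α x g ∧
      ∀ v, inner ℝ g v ≤ H * lpNorm p v}ᶜ.indicator 1) ≤ ENNReal.ofReal δ) (t : ℕ) :
    expect (mirrorDescent X P Φ η F prog x₁ t)
      ({s | RegretBound X P Φ f xs η (η * α + (H * η) ^ 2 / (2 * μ)) (bregman Φ xs x₁) t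
        s}ᶜ.indicator 1) ≤ ENNReal.ofReal (t * δ) := by
  set D := bregman Φ xs x₁ with hD
  set B := η * α + (H * η) ^ 2 / (2 * μ) with hB
  induction t with
  | zero =>
    rw [mirrorDescent, expect_pure, Set.indicator_of_notMem]
    · simp
    · rw [Set.notMem_compl_iff]
      -- The empty sum is `0` times any feasible point.
      exact ⟨hx₁, x₁, hx₁.1, by simp, by simp [hD]⟩
  | succ t ih =>
    have hstep : ∀ s : Pt d × Pt d,
        expect ((estimate F prog s.1).map fun g => (mirrorStep X P Φ η s.1 g, s.2 + s.1))
          ({s | RegretBound X P Φ f xs η B D (t + 1) s}ᶜ.indicator 1) ≤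
        {s | RegretBound X P Φ f xs η B D t s}ᶜ.indicator 1 s + ENNReal.ofReal δ := by
      intro s
      rw [expect_map]
      by_cases hs : RegretBound X P Φ f xs η B D t s
      · refine le_add_left ((expect_mono _ fun g => ?_).trans (hest s.1 hs.1.1))
        by_cases hg : IsApproxSubgradient X f α s.1 g ∧ ∀ v, inner ℝ g v ≤ H * lpNorm p v
        · rw [Set.indicator_of_notMem]
          · exact zero_le
          · rw [Set.notMem_compl_iff]
            exact hs.succ hp hcl hb hX hm hsc hμ hη hf hxs hg.1 hg.2
        · rw [Set.indicator_of_mem (s := {g | IsApproxSubgradient X f α s.1 g ∧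
            ∀ v, inner ℝ g v ≤ H * lpNorm p v}ᶜ) hg]
          exact Set.indicator_le_self' (fun _ _ => zero_le) _
      · refine le_add_right ?_
        rw [Set.indicator_of_mem (s := {s | RegretBound X P Φ f xs η B D t s}ᶜ) hs]
        refine (expect_mono _ fun g => Set.indicator_le_self' (fun _ _ => zero_le) _).trans ?_
        exact (expect_const _ 1).le
    rw [mirrorDescent, expect_bind]
    refine (expect_mono _ hstep).trans ?_
    rw [expect_add, expect_const]
    refine (add_le_add_left ih _).trans ?_
    rw [← ENNReal.ofReal_add (by positivity) hδ]
    refine ENNReal.ofReal_le_ofReal (le_of_eq ?_)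
    push_cast
    ring

theorem le_prob_mirrorDescentOutput {p : ℝ≥0∞} (hp : 1 ≤ p) {X P : Set (Pt d)} {Φ f : Pt d → ℝ}
    (hcl : IsClosed X) (hb : Bornology.IsBounded X) (hX : Convex ℝ X) (hm : IsMirrorMap X P Φ)
    {μ η H α δ ε : ℝ} (hsc : IsLpStronglyConvexOn p μ (X ∩ P) Φ) (hμ : 0 < μ) (hη : 0 < η)
    (hf : ConvexOn ℝ Set.univ f) {x₁ xs : Pt d} (hx₁ : x₁ ∈ X ∩ P) (hxs : xs ∈ X ∩ P)
    (hδ : 0 ≤ δ) {F : Pt d → BitVec w} {prog : List (Instr d b w)}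
    (hest : ∀ x ∈ X, expect (estimate F prog x) ({g | IsApproxSubgradient X f α x g ∧
      ∀ v, inner ℝ g v ≤ H * lpNorm p v}ᶜ.indicator 1) ≤ ENNReal.ofReal δ) {T : ℕ} (hT : 0 < T)
    (hε : bregman Φ xs x₁ + T * (η * α + (H * η) ^ 2 / (2 * μ)) ≤ η * (T * ε)) :
    1 - T * δ ≤ prob (mirrorDescentOutput X P Φ η F prog x₁ T) {x | x ∈ X ∧ f x - f xs ≤ ε} := by
  refine one_sub_le_prob _ _ (by positivity) ?_
  rw [mirrorDescentOutput, expect_map]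
  refine (expect_mono _ fun s => ?_).trans
    (expect_mirrorDescent_le hp hcl hb hX hm hsc hμ hη.le hf hx₁ hxs hδ hest T)
  by_cases hs : RegretBound X P Φ f xs η (η * α + (H * η) ^ 2 / (2 * μ)) (bregman Φ xs x₁) T s
  · rw [Set.indicator_of_notMem]
    · exact zero_le
    · rw [Set.notMem_compl_iff]
      obtain ⟨hx, a, ha, hsa, hbd⟩ := hs
      have hT0 : (0 : ℝ) < T := by exact_mod_cast hT
      have e : (1 / (T : ℝ)) • s.2 = a := by
        rw [hsa, smul_smul, one_div, inv_mul_cancel₀ hT0.ne', one_smul]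
      rw [e]
      refine ⟨ha, ?_⟩
      have h1 := hsc s.1 hx xs hxs
      -- The last divergence in the telescoped bound is nonnegative by strong convexity and can be
      -- dropped.
      have h2 : 0 ≤ bregman Φ xs s.1 := by
        have : 0 ≤ μ / 2 * lpNorm p (xs - s.1) ^ 2 := by positivity
        rw [bregman]
        linarith
      have h3 : η * (T * (f a - f xs)) ≤ η * (T * ε) := by linarith
      exact le_of_mul_le_mul_left (le_of_mul_le_mul_left h3 hη) hT0
  · rw [Set.indicator_of_mem (s := {s | RegretBound X P Φ f xs η
      (η * α + (H * η) ^ 2 / (2 * μ)) (bregman Φ xs x₁) T s}ᶜ) hs]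
    exact Set.indicator_le_self' (fun _ _ => zero_le) _

end Descent
end

noncomputable section

/-! ### Choice of the parameters -/

section Parameters

/-- Rounding up to a power of two. Taking logarithms gives `n log 2 ≤ a log 2 + e log A`; as `log 2
> 1/2` and `e ≤ a`, the exponent is at most `a + 2 a log A + 1`. -/
theorem exists_two_pow_near {Y A : ℝ} {a e : ℕ} (hY : 1 ≤ Y) (hA : 1 ≤ A) (he : e ≤ a)
    (h : Y ≤ 2 ^ a * A ^ e) :
    ∃ j : ℕ, Y ≤ 2 ^ j ∧ (2 : ℝ) ^ j ≤ 2 * Y ∧ (j : ℝ) ≤ (2 * a + 1) * (1 + Real.log A) := by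
  obtain ⟨n, h1, h2⟩ := exists_nat_pow_near hY (one_lt_two : (1 : ℝ) < 2)
  refine ⟨n + 1, h2.le, by rw [pow_succ]; linarith, ?_⟩
  have h3 : Real.log (2 ^ n) ≤ Real.log (2 ^ a * A ^ e) :=
    Real.log_le_log (by positivity) (h1.trans h)
  rw [Real.log_mul (by positivity) (by positivity), Real.log_pow, Real.log_pow, Real.log_pow] at h3
  have hl := Real.log_two_gt_d9
  have hA0 := Real.log_nonneg hA
  have he' : (e : ℝ) ≤ a := by exact_mod_cast he
  have h4 : (e : ℝ) * Real.log A ≤ (2 * a * Real.log A) * Real.log 2 := by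
    have h5 : (0 : ℝ) ≤ a * Real.log A := by positivity
    have h6 := mul_le_mul_of_nonneg_right he' hA0
    nlinarith
  have h7 : (n : ℝ) ≤ a + 2 * a * Real.log A :=
    le_of_mul_le_mul_right (by linarith) (show 0 < Real.log 2 by linarith)
  have h8 : (0 : ℝ) ≤ a := a.cast_nonneg
  push_cast
  nlinarith

/-- The requirements on the parameters of the algorithm: the number `T` of iterations, the number
`b` of qubits per coordinate, the number `r` of repetitions, the width `2 ^ n` of the random shift,
the scale `2 ^ m` of the phase, and the spacing `s` of the hypergrid. -/
structure IsParameterChoice (d : ℕ) (ϑ ϑs κ Γ G ε θ : ℝ) (T b r n : ℕ) (m : ℤ) (s : ℝ) :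
    Prop where
  one_lt : 1 < T
  le_T : 16 * κ ^ 2 ≤ T
  T_le : T ≤ 17 * (1 + κ ^ 2)
  r_le : r ≤ 15 * (1 + Real.log (d * (1 + κ)))
  b_le : b ≤ 29 * (1 + Real.log (d * (1 + κ) * (1 + Γ)))
  n_le : n ≤ 95 * (1 + Real.log (d * (1 + κ) * (1 + Γ)))
  le_two_pow_b : 12288 * Γ * ϑs ≤ 2 ^ b
  failure_le : d / 2 ^ r + 640 * (ϑ * d * (2 ^ b) ^ 2 / 2 ^ n) ≤ 1 / (3 * (T : ℝ))
  s_pos : 0 < s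
  scale_eq : 8 * G * (2 ^ m * s) = 1
  shift_le : 2 * (G * (ϑ * (s * 2 ^ n))) ≤ ε / 8
  two_pow_b_le : (2 : ℝ) ^ b ≤ 2 ^ n
  phase_error_le : 2 * Real.pi * 2 ^ m * θ ≤ 1 / 400

-- The choices are made in the order `T`, `r`, `b`, `n`, `m`, `s`: the accuracy fixes `b`, the width
-- of the shift must dominate `(2^b)²` and `T`, and the scale is then forced by the permitted
-- displacement `ε / 8`.
set_option maxHeartbeats 1000000 in
theorem exists_isParameterChoice {d : ℕ} {ϑ ϑs κ Γ G ε θ : ℝ} (h1ϑ : 1 ≤ ϑ) (hϑd : ϑ ≤ d)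
    (h1ϑs : 1 ≤ ϑs) (hϑsd : ϑs ≤ d) (hκ0 : 0 ≤ κ) (hκ : 1 / 2 < κ ^ 2) (hΓ : 1 < Γ) (hG : 0 < G)
    (hε : 0 < ε) (hθ0 : 0 < θ)
    (hθ : θ * (κ ^ 2 * Γ ^ 2 * ϑs ^ 2 * ϑ * d ^ 3) ≤ 1 / 10 ^ 18 * ε) :
    ∃ (T b r n : ℕ) (m : ℤ) (s : ℝ), IsParameterChoice d ϑ ϑs κ Γ G ε θ T b r n m s := by
  have hd : (1 : ℝ) ≤ d := h1ϑ.trans hϑd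
  have hT1 := Nat.le_ceil (16 * κ ^ 2)
  have hT2 := (Nat.ceil_lt_add_one (show 0 ≤ 16 * κ ^ 2 by positivity)).le
  set T := ⌈16 * κ ^ 2⌉₊
  have hT8 : (8 : ℝ) < T := by linarith
  have hT18 : (T : ℝ) ≤ 18 * κ ^ 2 := by linarith
  set A : ℝ := d * (1 + κ) with hA
  set B : ℝ := d * (1 + κ) * (1 + Γ) with hB
  have hκA : 1 + κ ≤ A := le_mul_of_one_le_left (by linarith) hd
  have hA1 : 1 ≤ A := by linarith
  have hAB : A ≤ B := le_mul_of_one_le_right (by linarith) (by linarith)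
  have hB1 : 1 ≤ B := hA1.trans hAB
  have hdA : (d : ℝ) ≤ A := le_mul_of_one_le_right (by linarith) (by linarith)
  have hκ2 : κ ^ 2 ≤ (1 + κ) ^ 2 := by gcongr; linarith
  -- Half of the failure budget `1 / (3 T)` goes to the vote: `d / 2^r ≤ 1 / (6 T)`.
  obtain ⟨r, hr1, -, hr3⟩ := exists_two_pow_near (Y := 6 * d * T) (A := A) (a := 7) (e := 2)
    (by nlinarith) hA1 (by norm_num) (by
      calc 6 * d * (T : ℝ) ≤ 6 * d * (18 * (1 + κ) ^ 2) := by gcongr; linarith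
        _ = 108 * (d * 1) * (1 + κ) ^ 2 := by ring
        _ ≤ 128 * (d * d) * (1 + κ) ^ 2 := by gcongr; norm_num
        _ = 2 ^ 7 * A ^ 2 := by rw [hA]; ring)
  have hΓϑs : 1 ≤ Γ * ϑs := one_le_mul_of_one_le_of_one_le hΓ.le h1ϑs
  have hΓB : Γ * ϑs ≤ B := by
    calc Γ * ϑs ≤ (1 + Γ) * A := by gcongr <;> linarith
      _ = B := by rw [hB, hA]; ring
  -- `12288 = 8 · 3 · 512`, so that the error `3 · 512 G / 2^b` of the vote, times `ϑs Γ`, is at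
  -- most `G / 8`.
  obtain ⟨b, hb1, hb2, hb3⟩ := exists_two_pow_near (Y := 12288 * Γ * ϑs) (A := B) (a := 14) (e := 1)
    (by linarith) hB1 (by norm_num) (by norm_num; linarith)
  have hb512 : (1 : ℝ) ≤ 2 ^ b := by linarith
  have hTϑd : 1 ≤ T * (ϑ * d) :=
    one_le_mul_of_one_le_of_one_le (by linarith) (one_le_mul_of_one_le_of_one_le h1ϑ hd)
  -- The other half goes to bad origins: `3840 = 6 · 640`.
  obtain ⟨n, hn1, hn2, hn3⟩ := exists_two_pow_near
    (Y := 3840 * (T * (ϑ * d)) * (2 ^ b) ^ 2) (A := B) (a := 47) (e := 4)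
    (by nlinarith [one_le_pow₀ hb512 (n := 2)]) hB1 (by norm_num) (by
      calc 3840 * (T * (ϑ * d)) * ((2 : ℝ) ^ b) ^ 2
          ≤ 3840 * (18 * (1 + κ) ^ 2 * (d * d)) * (2 * (12288 * Γ * ϑs)) ^ 2 := by
            gcongr; linarith
        _ = 3840 * 18 * 24576 ^ 2 * A ^ 2 * (Γ * ϑs) ^ 2 := by rw [hA]; ring
        _ ≤ 2 ^ 47 * B ^ 2 * B ^ 2 := by gcongr; norm_num
        _ = 2 ^ 47 * B ^ 4 := by ring)
  -- The scale used is `2^(m + 1)`: it exceeds `2 ϑ 2^n / ε`, so the shift costs at most `ε / 8`,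
  -- and is at most twice that, so the oracle error is not amplified more than needed.
  obtain ⟨m, hm1, hm2⟩ := exists_mem_Ico_zpow (show 0 < 2 * ϑ * 2 ^ n / ε by positivity)
    (one_lt_two : (1 : ℝ) < 2)
  have hm3 : (2 : ℝ) ^ (m + 1) ≤ 4 * ϑ * 2 ^ n / ε := by
    rw [zpow_add_one₀ (by norm_num)]
    calc (2 : ℝ) ^ m * 2 ≤ 2 * ϑ * 2 ^ n / ε * 2 := by gcongr
      _ = _ := by ring
  have hσ : (0 : ℝ) < 2 ^ (m + 1) := by positivity
  refine ⟨T, b, r, n, m + 1, 1 / (8 * G * 2 ^ (m + 1)), ?_, hT1, by linarith, ?_, ?_, ?_, hb1, ?_,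
    by positivity, by field_simp, ?_, ?_, ?_⟩
  · have : ((1 : ℕ) : ℝ) < T := by push_cast; linarith
    exact_mod_cast this
  · norm_num at hr3; exact hr3
  · norm_num at hb3; exact hb3
  · norm_num at hn3; exact hn3
  · have h1 : (d : ℝ) / 2 ^ r ≤ 1 / (6 * (T : ℝ)) := by
      rw [div_le_div_iff₀ (by positivity) (by positivity)]
      linarith
    have h2 : 640 * (ϑ * d * (2 ^ b) ^ 2 / 2 ^ n) ≤ 1 / (6 * (T : ℝ)) := by
      rw [← mul_div_assoc, div_le_div_iff₀ (by positivity) (by positivity)]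
      linarith
    calc _ ≤ 1 / (6 * (T : ℝ)) + 1 / (6 * (T : ℝ)) := add_le_add h1 h2
      _ = _ := by ring
  · rw [div_lt_iff₀ hε] at hm2
    rw [show 2 * (G * (ϑ * (1 / (8 * G * 2 ^ (m + 1)) * 2 ^ n))) = 2 * ϑ * 2 ^ n / 2 ^ (m + 1) / 8 by
      field_simp]
    gcongr
    rw [div_le_iff₀ hσ]
    linarith
  · calc (2 : ℝ) ^ b ≤ 2 ^ b * 2 ^ b := le_mul_of_one_le_left (by positivity) hb512
      _ = 1 * (2 ^ b) ^ 2 := by ring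
      _ ≤ 3840 * (T * (ϑ * d)) * (2 ^ b) ^ 2 := by gcongr; linarith
      _ ≤ 2 ^ n := hn1
  -- This is where `10^(-18)` comes from: the numerical factors multiply to about `2.1 · 10^15`, and
  -- the product must stay below `1/400`.
  · have hpi := Real.pi_lt_d2
    calc 2 * Real.pi * 2 ^ (m + 1) * θ
        ≤ 2 * 3.15 * (4 * ϑ * (2 * (3840 * (18 * κ ^ 2 * (ϑ * d)) *
            (2 * (12288 * Γ * ϑs)) ^ 2)) / ε) * θ := by
          have : (2 : ℝ) ^ n ≤ 2 * (3840 * (18 * κ ^ 2 * (ϑ * d)) *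
            (2 * (12288 * Γ * ϑs)) ^ 2) := hn2.trans (by gcongr)
          gcongr
          exact hm3.trans (by gcongr)
      _ = 2 * 3.15 * 4 * 2 * 3840 * 18 * 24576 ^ 2 *
            (θ * (κ ^ 2 * Γ ^ 2 * ϑs ^ 2 * ϑ * (ϑ * d))) / ε := by ring
      _ ≤ 2 * 3.15 * 4 * 2 * 3840 * 18 * 24576 ^ 2 *
            (θ * (κ ^ 2 * Γ ^ 2 * ϑs ^ 2 * ϑ * d ^ 3)) / ε := by
          have : ϑ * d ≤ (d : ℝ) ^ 3 := by
            calc ϑ * d ≤ d * d := by gcongr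
              _ ≤ d * d * d := le_mul_of_one_le_right (by positivity) hd
              _ = _ := by ring
          gcongr
      _ ≤ 2 * 3.15 * 4 * 2 * 3840 * 18 * 24576 ^ 2 * (1 / 10 ^ 18 * ε) / ε := by gcongr
      _ ≤ 1 / 400 := by
          rw [← mul_assoc, mul_div_assoc, div_self hε.ne']
          norm_num

end Parameters
end

/-! ### The main theorem -/

section Main

variable {d b w : ℕ} {p : ℝ≥0∞} {X P : Set (Pt d)} {Φ f : Pt d → ℝ} {x₁ xs : Pt d}
  {μ G R ε : ℝ}

theorem lpDiam_nonneg (hp : 1 ≤ p) (hb : Bornology.IsBounded X) {ϑ : ℝ} (hϑ0 : 0 ≤ ϑ)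
    (hϑ : ∀ x : Pt d, lpNorm p x ≤ ϑ * lpNorm ∞ x) {x : Pt d} (hx : x ∈ X) : 0 ≤ lpDiam p X :=
  (lpNorm_nonneg hp (x - x)).trans (lpNorm_sub_le_lpDiam hb hϑ0 hϑ hx hx)

theorem le_prob_mirrorDescentOutput_one (η : ℝ) (F : Pt d → BitVec w)
    (prog : List (Instr d b w)) (hx₁ : x₁ ∈ X) (h : f x₁ - f xs ≤ ε) :
    2 / 3 ≤ prob (mirrorDescentOutput X P Φ η F prog x₁ 1) {x | x ∈ X ∧ f x - f xs ≤ ε} := by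
  have h0 : f x₁ ≤ ε + f xs := by linarith
  have h1 := one_sub_le_prob (mirrorDescentOutput X P Φ η F prog x₁ 1)
    {x | x ∈ X ∧ f x - f xs ≤ ε} le_rfl (by
      rw [mirrorDescentOutput, expect_map, mirrorDescent, expect_bind, mirrorDescent, expect_pure,
        expect_map]
      simp [hx₁, h0, expect])
  linarith

/-- Strong convexity bounds the distance from `x₁` to the minimizer by `R √(2 / μ)`, so the gap is
at most `√2 κ ε`. -/
theorem sub_le_of_kappa_le (hp : 1 ≤ p) (hμ : 0 < μ) (hε : 0 < ε)
    (hsc : IsLpStronglyConvexOn p μ (X ∩ P) Φ) (hx₁ : x₁ ∈ X ∩ P) (hxs : xs ∈ X ∩ P)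
    (hf : IsLpLipschitz p G f) (hR : R ^ 2 = bregman Φ xs x₁)
    (hκ : (G * R / (√μ * ε)) ^ 2 ≤ 1 / 2) : f x₁ - f xs ≤ ε := by
  have h1 := hsc x₁ hx₁ xs hxs
  have h2 : μ / 2 * lpNorm p (xs - x₁) ^ 2 ≤ R ^ 2 := by
    rw [hR, bregman]
    linarith
  rw [div_pow, mul_pow, mul_pow, Real.sq_sqrt hμ.le, div_le_iff₀ (by positivity)] at hκ
  have h3 : G * lpNorm p (xs - x₁) ≤ ε := by
    refine le_of_sq_le_sq ?_ hε.le
    have h4 := mul_le_mul_of_nonneg_left h2 (sq_nonneg G)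
    refine le_of_mul_le_mul_left ?_ hμ
    nlinarith
  have h5 := hf x₁ xs
  rw [← neg_sub xs x₁, lpNorm_neg hp] at h5
  exact (le_abs_self _).trans (h5.trans h3)

/-- With this step size the quadratic terms sum to `2 R²` and the initial divergence is `R²`, while
the approximation error uses a quarter of the right side. What is left is `4 R² ≤ η T ε`, that is,
`T ≥ 16 κ²`. -/
theorem regret_budget (hμ : 0 < μ) (hG : 0 < G) (hR : 0 ≤ R) (hε : 0 < ε) {T : ℕ} (hT : 0 < T)
    (hκT : 16 * (G * R / (√μ * ε)) ^ 2 ≤ T) :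
    R ^ 2 + T * (R / G * √(μ / T) * (ε / 4) + (2 * G * (R / G * √(μ / T))) ^ 2 / (2 * μ)) ≤
      R / G * √(μ / T) * (T * ε) := by
  have hT0 : (0 : ℝ) < T := by exact_mod_cast hT
  set y := √(μ / T) with hy
  have hy2 : y ^ 2 = μ / T := Real.sq_sqrt (by positivity)
  have hy0 : 0 < y := Real.sqrt_pos.2 (by positivity)
  have h1 : T * ((2 * G * (R / G * y)) ^ 2 / (2 * μ)) = 2 * R ^ 2 := by
    rw [show 2 * G * (R / G * y) = 2 * (R * y) by field_simp, mul_pow, mul_pow, hy2]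
    field_simp
  have h2 : 4 * (G * R) ≤ T * y * ε := by
    refine le_of_sq_le_sq ?_ (by positivity)
    rw [div_pow, mul_pow (√μ), Real.sq_sqrt hμ.le, ← mul_div_assoc, div_le_iff₀ (by positivity)]
      at hκT
    rw [mul_pow, mul_pow (T * y), mul_pow (T : ℝ) y, hy2]
    calc _ = 16 * (G * R) ^ 2 := by ring
      _ ≤ _ := hκT
      _ = _ := by field_simp
  have h3 : 4 * R ^ 2 ≤ R / G * (T * y * ε) := by
    calc 4 * R ^ 2 = R / G * (4 * (G * R)) := by field_simp
      _ ≤ _ := by gcongr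
  nlinarith

theorem le_of_length_le {Λ L t κ y : ℝ} {b n r : ℕ} (hd : 1 ≤ d) (hL : L ≤ Λ) (hΛ : 1 ≤ Λ)
    (ht : t ≤ 17 * (1 + κ ^ 2)) (hr : r ≤ 15 * L) (hb : b ≤ 29 * Λ) (hn : n ≤ 95 * Λ)
    {l : ℕ} (hy : 0 ≤ y)
    (hl : l ≤ d * n * 5 + r * (27 + d * b + d * (b * 8 + 8)) + d * (r * (r * 4 + 7))) :
    t * (l + d + y) ≤ 200000 * ((d + y) * (1 + κ ^ 2)) * Λ ^ 2 := by
  have hd' : (1 : ℝ) ≤ d := by exact_mod_cast hd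
  have hl' : (l : ℝ) ≤ d * n * 5 + r * (27 + d * b + d * (b * 8 + 8)) +
      d * (r * (r * 4 + 7)) := by exact_mod_cast hl
  have hr' : (r : ℝ) ≤ 15 * Λ := by linarith
  have h1 : (l : ℝ) ≤ 6000 * d * Λ ^ 2 := by
    calc (l : ℝ) ≤ d * (95 * Λ) * 5 + 15 * Λ * (27 * d + d * (29 * Λ) + d * (29 * Λ * 8 + 8)) +
          d * (15 * Λ * (15 * Λ * 4 + 7)) := by
          refine hl'.trans ?_
          gcongr
          linarith
      _ = d * (475 * Λ + 15 * Λ * 35 + 15 * Λ * 7 + 4815 * Λ ^ 2) := by ring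
      _ ≤ d * (6000 * Λ ^ 2) := by
          gcongr
          nlinarith
      _ = _ := by ring
  have h2 : (1 : ℝ) ≤ Λ ^ 2 := one_le_pow₀ hΛ
  have h3 : (l : ℝ) + d + y ≤ 6001 * (d + y) * Λ ^ 2 := by
    nlinarith [mul_nonneg hy (sub_nonneg.2 h2), mul_nonneg (zero_le_one.trans hd') (sub_nonneg.2 h2)]
  calc t * (l + d + y) ≤ 17 * (1 + κ ^ 2) * (6001 * (d + y) * Λ ^ 2) := by gcongr
    _ = 102017 * ((d + y) * (1 + κ ^ 2)) * Λ ^ 2 := by ring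
    _ ≤ _ := by gcongr; norm_num

end Main

theorem mainTheorem2 :
    -- constants that depend on nothing
    ∃ (c C : ℝ) (k : ℕ), 0 < c ∧ 0 < C ∧
    -- the norm and its comparison constants
    ∀ (d : ℕ) (p : ℝ≥0∞) (ϑ ϑs : ℝ), 1 ≤ p →
      1 ≤ ϑ → ϑ ≤ d → 1 ≤ ϑs → ϑs ≤ d → ϑ * ϑs ≤ d →
      (∀ x : Pt d, lpNorm p x ≤ ϑ * lpNorm ∞ x) →
      (∀ x : Pt d, dualLpNorm p x ≤ ϑs * lpNorm ∞ x) →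
    -- the feasible set, the mirror map, the starting point and the numerical parameters
    ∀ (X P : Set (Pt d)) (Φ : Pt d → ℝ) (x₁ : Pt d) (μ G R ε θ : ℝ),
      IsClosed X → Bornology.IsBounded X → Convex ℝ X →
      IsMirrorMap X P Φ → IsLpStronglyConvexOn p μ (X ∩ P) Φ → x₁ ∈ X ∩ P →
      0 < μ → 0 < G → 0 ≤ R → 0 < ε → 0 < θ →
      θ * (G ^ 4 * R ^ 2 * lpDiam p X ^ 2 * ϑs ^ 2 * ϑ * d ^ 3) ≤ c * (μ * ε ^ 5) →
    -- the number format of the oracle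
    ∀ (w frac : ℕ),
    -- the algorithm, which does not depend on `f`, on its minimizer or on the oracle
    ∃ (T b : ℕ) (prog : List (Instr d b w)), 0 < T ∧
      ((T * queryCount prog : ℕ) : ℝ) ≤
        C * (1 + (G * R / (√μ * ε)) ^ 2) * (1 + Real.log (d * (1 + G * R / (√μ * ε)))) ^ k ∧
      (∀ Tnext : ℕ, (gateCount prog Tnext T : ℝ) ≤
        C * ((d + Tnext) * (1 + (G * R / (√μ * ε)) ^ 2)) *
          (1 + Real.log (d * (1 + G * R / (√μ * ε)) * (1 + G * lpDiam p X / ε))) ^ k) ∧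
      ∀ (f : Pt d → ℝ) (xs : Pt d) (F : Pt d → BitVec w),
        ConvexOn ℝ Set.univ f → IsLpLipschitz p G f →
        xs ∈ X ∩ P → (∀ x ∈ X, f xs ≤ f x) → R ^ 2 = bregman Φ xs x₁ →
        IsBinaryOracle frac F f θ (supNbhd X (ε / (G * ϑ))) →
        -- every subgradient estimate that can influence the output is accurate
        (1 < T → ∀ x ∈ X,
          1 - 1 / (3 * T) ≤ prob (estimate F prog x) {g | IsApproxSubgradient X f ε x g}) ∧
        -- the averaged iterate solves the problem
        2 / 3 ≤ prob (mirrorDescentOutput X P Φ (R / G * √(μ / T)) F prog x₁ T)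
          {x | x ∈ X ∧ f x - f xs ≤ ε} := by
  refine ⟨1 / 10 ^ 18, 200000, 2, by norm_num, by norm_num, ?_⟩
  intro d p ϑ ϑs hp h1ϑ hϑd h1ϑs hϑsd _ hϑ hϑs X P Φ x₁ μ G R ε θ hcl hb hX hm hsc hx₁ hμ hG hR hε
    hθ0 hθ w frac
  have hd : (1 : ℝ) ≤ d := h1ϑ.trans hϑd
  have hd1 : 1 ≤ d := by exact_mod_cast hd
  have hϑ0 : 0 ≤ ϑ := by linarith
  have hϑs0 : 0 ≤ ϑs := by linarith
  have hK := lpDiam_nonneg hp hb hϑ0 hϑ hx₁.1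
  set K := lpDiam p X with hKdef
  set κ := G * R / (√μ * ε) with hκdef
  set Γ := G * K / ε with hΓdef
  have hκ0 : 0 ≤ κ := by positivity
  have hΓ0 : 0 ≤ Γ := by positivity
  have hA1 : 1 ≤ d * (1 + κ) := one_le_mul_of_one_le_of_one_le hd (by linarith)
  have hB1 : 1 ≤ d * (1 + κ) * (1 + Γ) := one_le_mul_of_one_le_of_one_le hA1 (by linarith)
  have hL1 : 1 ≤ 1 + Real.log (d * (1 + κ)) := by linarith [Real.log_nonneg hA1]
  have hΛ1 : 1 ≤ 1 + Real.log (d * (1 + κ) * (1 + Γ)) := by linarith [Real.log_nonneg hB1]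
  have hLΛ : 1 + Real.log (d * (1 + κ)) ≤ 1 + Real.log (d * (1 + κ) * (1 + Γ)) := by
    refine add_le_add le_rfl (Real.log_le_log (by linarith) ?_)
    exact le_mul_of_one_le_right (by linarith) (by linarith)
  -- Outside this case `x₁` already has gap at most `ε`, by strong convexity or by the diameter, and
  -- one iteration with the empty program is enough: the average is `x₁`.
  by_cases hmain : 1 / 2 < κ ^ 2 ∧ 1 < Γ
  · obtain ⟨hκ, hΓ⟩ := hmain
    -- `κ² Γ² = G⁴ R² K² / (μ ε⁴)`, so this is the assumption divided by `μ ε⁴`.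
    have hθ' : θ * (κ ^ 2 * Γ ^ 2 * ϑs ^ 2 * ϑ * d ^ 3) ≤ 1 / 10 ^ 18 * ε := by
      have hμε : 0 < μ * ε ^ 4 := by positivity
      refine le_of_mul_le_mul_right ?_ hμε
      calc _ = θ * (G ^ 4 * R ^ 2 * K ^ 2 * ϑs ^ 2 * ϑ * d ^ 3) := by
            rw [hκdef, hΓdef, div_pow, mul_pow (√μ), Real.sq_sqrt hμ.le]
            field_simp
        _ ≤ _ := hθ
        _ = _ := by ring
    obtain ⟨T, b, r, n, m, s, hpar⟩ := exists_isParameterChoice h1ϑ hϑd h1ϑs hϑsd hκ0 hκ hΓ hG hε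
      hθ0 hθ'
    have hT : 0 < T := zero_lt_one.trans hpar.one_lt
    have hT0 : (0 : ℝ) < T := by exact_mod_cast hT
    have hs := hpar.s_pos
    have hΓϑs : 1 ≤ Γ * ϑs := one_le_mul_of_one_le_of_one_le hΓ.le h1ϑs
    have hbpos : 0 < b := by
      rcases Nat.eq_zero_or_pos b with h | h
      · have := hpar.le_two_pow_b
        rw [h, pow_zero] at this
        linarith
      · exact h
    set J := phaseAngles w frac m with hJ
    set prog : List (Instr d b w) := gradProg (Sum.inl (⟨0, hd1⟩, ⟨0, hbpos⟩)) s G J n r with hprog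
    refine ⟨T, b, prog, hT, ?_, fun Tnext => ?_, ?_⟩
    · rw [hprog, queryCount_gradProg]
      push_cast
      calc (T : ℝ) * (r * 2) ≤ 17 * (1 + κ ^ 2) * (15 * (1 + Real.log (d * (1 + κ))) * 2) := by
            have h1 := hpar.T_le
            have h2 := hpar.r_le
            gcongr
        _ = 510 * (1 + κ ^ 2) * ((1 + Real.log (d * (1 + κ))) * 1) := by ring
        _ ≤ 200000 * (1 + κ ^ 2) *
            ((1 + Real.log (d * (1 + κ))) * (1 + Real.log (d * (1 + κ)))) := by
            gcongr
            norm_num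
        _ = _ := by ring
    · rw [gateCount]
      push_cast
      exact le_of_length_le hd1 hLΛ hΛ1 hpar.T_le hpar.r_le hpar.b_le hpar.n_le
        Tnext.cast_nonneg (length_gradProg_le _ s G (length_phaseAngles_le w frac m) n r)
    · intro f xs F hconv hf hxs _ hRb hF
      set δ := 3 * (512 * G / 2 ^ b) with hδ
      have hδ0 : 0 ≤ δ := by positivity
      have hδϑs : ϑs * δ * Γ ≤ G / 8 := by
        have := hpar.le_two_pow_b
        rw [show ϑs * δ * Γ = 12288 * Γ * ϑs / 2 ^ b * (G / 8) by rw [hδ]; ring]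
        exact mul_le_of_le_one_left (by positivity) ((div_le_one (by positivity)).2 this)
      have hest : ∀ x ∈ X, expect (estimate F prog x)
          ({g | IsApproxSubgradient X f (ε / 4) x g ∧
            ∀ v, inner ℝ g v ≤ 2 * G * lpNorm p v}ᶜ.indicator 1) ≤
          ENNReal.ofReal (1 / (3 * (T : ℝ))) := by
        intro x hx
        -- Random shift and grid together stay within `2 s 2^n` of `x`, well inside the region where
        -- the oracle is accurate.
        have hgrid : s * (2 ^ n + 2 ^ b) ≤ ε / (G * ϑ) := by
          have h1 := hpar.shift_le
          have h2 : s * (2 ^ n + 2 ^ b) ≤ s * (2 ^ n + 2 ^ n) := by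
            have := hpar.two_pow_b_le
            gcongr
          rw [le_div_iff₀ (by positivity)]
          have h3 := mul_le_mul_of_nonneg_right h2 (show 0 ≤ G * ϑ by positivity)
          linarith
        have hcalc := expect_gradProg_le hp (F := F) (frac := frac)
          (Sum.inl (⟨0, hd1⟩, ⟨0, hbpos⟩) : Qubit d b w) n r hG hs hpar.scale_eq hϑ0 hϑ
          (by have := hpar.le_two_pow_b; linarith) hconv hf hpar.phase_error_le x
          (fun y hy => (hF y ⟨x, hx, (lpNorm_top_le (by positivity) fun i => hy i).trans hgrid⟩).le)
        refine (expect_mono _ fun g => ?_).trans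
          (hcalc.trans (ENNReal.ofReal_le_ofReal hpar.failure_le))
        refine Set.indicator_le_indicator_of_subset (Set.compl_subset_compl.2 fun v hv => ?_)
          (fun _ => zero_le) g
        have hv' : NearSubgradient f x (s * 2 ^ n) δ v := hv
        constructor
        · intro q hq
          have h1 := hv'.isApproxSubgradient hp hb hG.le hf hδ0 (by positivity) hϑ0 hϑ hϑs0 hϑs hx
            q hq
          have h2 : ϑs * δ * K ≤ ε / 8 := by
            have : K = Γ * (ε / G) := by rw [hΓdef]; field_simp
            rw [this, ← mul_assoc]
            calc _ ≤ G / 8 * (ε / G) := by gcongr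
              _ = _ := by field_simp
          have h3 := hpar.shift_le
          linarith
        · intro u
          refine (hv'.inner_le hp hf hδ0 hϑs0 hϑs u).trans ?_
          have h1 : ϑs * δ ≤ G := by
            have : ϑs * δ ≤ ϑs * δ * Γ := le_mul_of_one_le_right (by positivity) hΓ.le
            linarith
          exact mul_le_mul_of_nonneg_right (by linarith) (lpNorm_nonneg hp u)
      -- `κ² > 1/2` excludes `R = 0`, so the step size is positive.
      have hRpos : 0 < R := by
        refine lt_of_le_of_ne hR fun h => ?_
        rw [hκdef, ← h] at hκ
        norm_num at hκ
      constructor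
      · intro _ x hx
        refine one_sub_le_prob _ _ (by positivity) ((expect_mono _ fun g => ?_).trans (hest x hx))
        refine Set.indicator_le_indicator_of_subset (Set.compl_subset_compl.2 fun v hv q hq => ?_)
          (fun _ => zero_le) g
        have := hv.1 q hq
        linarith
      · have h1 := le_prob_mirrorDescentOutput hp hcl hb hX hm (η := R / G * √(μ / T)) (ε := ε) hsc
          hμ (by positivity) hconv hx₁ hxs (by positivity) hest hT
          (by rw [← hRb]; exact regret_budget hμ hG hR hε hT hpar.le_T)
        refine le_trans (le_of_eq ?_) h1
        field_simp
        norm_num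
  · refine ⟨1, 0, [], one_pos, ?_, fun Tnext => ?_, ?_⟩
    · simp only [queryCount, List.countP_nil, mul_zero, Nat.cast_zero]
      positivity
    · have h1 := le_of_length_le (d := d) (t := 1) (κ := κ) (b := 0) (n := 0) (r := 0) (l := 0) hd1
        hLΛ hΛ1 (by nlinarith [sq_nonneg κ]) (by push_cast; linarith)
        (by push_cast; linarith) (by push_cast; linarith) (Nat.cast_nonneg Tnext) (Nat.zero_le _)
      simpa [gateCount] using h1
    · intro f xs F _ hf hxs _ hRb _
      refine ⟨fun h => absurd h (lt_irrefl _), ?_⟩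
      refine le_prob_mirrorDescentOutput_one _ F [] hx₁.1 ?_
      rw [not_and_or, not_lt, not_lt] at hmain
      rcases hmain with h | h
      · exact sub_le_of_kappa_le hp hμ hε hsc hx₁ hxs hf hRb h
      · rw [hΓdef, div_le_one hε] at h
        refine (le_abs_self _).trans ((hf x₁ xs).trans (le_trans ?_ h))
        gcongr
        exact lpNorm_sub_le_lpDiam hb hϑ0 hϑ hx₁.1 hxs.1
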